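/- **Setting.** Let $(M,F)$ and $(N,\widetilde F)$ be Finsler manifolds of dimensions $p$ and $n$: $F\ge 0$ on $TM$ is smooth on $TM\setminus\{0\}$, positively homogeneous of degree one in the fibres, and $g_{\alpha\beta}=\frac12\,\partial^2F^2/\partial s^\alpha\partial s^\beta$ is positive definite; similarly for $\widetilde F$. Fix charts of $M$ and $N$, with induced coordinates $(t^\alpha,s^a)$ on $TM$ and $(x^i,y^i)$ on $TN$; Greek indices and $a,b,c,d,f$ run over $1,\dots,p$, the indices $i,j,k,l,m,q$ over $1,\dots,n$, and repeated indices are summed. With $$C_{\alpha\beta\gamma}=\tfrac12\frac{\partial g_{\alpha\beta}}{\partial s^\gamma},\quad C^\beta_{\alpha\varepsilon}=g^{\beta\lambda}C_{\lambda\alpha\varepsilon},\quad \gamma^\mu_{\alpha\beta}=\tfrac12 g^{\mu\varepsilon}\Big(\frac{\partial g_{\varepsilon\alpha}}{\partial t^\beta}+\frac{\partial g_{\varepsilon\beta}}{\partial t^\alpha}-\frac{\partial g_{\alpha\beta}}{\partial t^\varepsilon}\Big)$$ the nonlinear Cartan connection is $N^\beta_\alpha=\gamma^\beta_{\alpha\varepsilon}s^\varepsilon-C^\beta_{\alpha\varepsilon}\gamma^\varepsilon_{\mu\nu}s^\mu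 s^\nu$. Put $\frac{\delta}{\delta t^\alpha}=\frac{\partial}{\partial t^\alpha}-N^\varepsilon_\alpha\frac{\partial}{\partial s^\varepsilon}$, let $\Gamma^\gamma_{\alpha\beta}$ be given by the formula for $\gamma^\gamma_{\alpha\beta}$ with $\delta/\delta t$ in place of $\partial/\partial t$, and set $$B^\gamma_{\alpha\beta}=\Gamma^\gamma_{\alpha\beta}+C^\gamma_{\alpha\beta|\mu}s^\mu,\qquad C^\gamma_{\alpha\beta|\mu}=\frac{\delta C^\gamma_{\alpha\beta}}{\delta t^\mu}+C^\varepsilon_{\alpha\beta}\Gamma^\gamma_{\varepsilon\mu}-C^\gamma_{\varepsilon\beta}\Gamma^\varepsilon_{\alpha\mu}-C^\gamma_{\alpha\varepsilon}\Gamma^\varepsilon_{\beta\mu},$$ $$\mathcal R^\alpha_{\beta\gamma}=\frac{\delta N^\alpha_\beta}{\delta t^\gamma}-\frac{\delta N^\alpha_\gamma}{\delta t^\beta},\quad \mathcal R^\alpha_{\beta\gamma\varepsilon}=\frac{\delta B^\alpha_{\beta\gamma}}{\delta t^\varepsilon}-\frac{\delta B^\alpha_{\beta\varepsilon}}{\delta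 t^\gamma}+B^\mu_{\beta\gamma}B^\alpha_{\mu\varepsilon}-B^\mu_{\beta\varepsilon}B^\alpha_{\mu\gamma},\quad \mathcal P^\alpha_{\beta\gamma\varepsilon}=\frac{\partial B^\alpha_{\beta\gamma}}{\partial s^\varepsilon},$$ $$N^c_{\alpha:\beta}=\frac{\partial N^c_\alpha}{\partial t^\beta}+N^d_\alpha B^c_{d\beta}-N^c_\gamma B^\gamma_{\alpha\beta}.$$ The same objects of $(N,\widetilde F)$ carry a tilde. The Berwald connection of $TM\setminus\{0\}$ is given by $\nabla_{\delta/\delta t^\beta}\frac{\delta}{\delta t^\alpha}=B^\gamma_{\alpha\beta}\frac{\delta}{\delta t^\gamma}$, $\nabla_{\delta/\delta t^\beta}\frac{\partial}{\partial s^a}=B^c_{a\beta}\frac{\partial}{\partial s^c}$, $\nabla_{\partial/\partial s^b}\frac{\delta}{\delta t^\alpha}=\nabla_{\partial/\partial s^b}\frac{\partial}{\partial s^a}=0$. With $(T^A)=(t^\alpha,s^a)$, $A=(\alpha,a)$, let $\Gamma^C_{AB}$ be its components in the coordinate basis: $\nabla_{\partial/\partial T^B}\frac{\partial}{\partial T^A}=\Gamma^C_{AB}\frac{\partial}{\partial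 T^C}$. Let $(T^A,x^i,X^i_A)$, $(X^i_A)=(x^i_\alpha,y^i_a)$, be the induced coordinates on $J^1(TM,N)$, where we restrict to jets with $s\ne0$ and $(y^l_as^a)_l\neq 0$. Objects of $(M,F)$ are evaluated at $(t^\alpha,s^a)$, those of $(N,\widetilde F)$ at $(x^l,y^l_as^a)$. The jet adapted basis is $$\frac{\delta^J}{\delta T^A}=\frac{\partial}{\partial T^A}+\Gamma^C_{AB}X^j_C\frac{\partial}{\partial X^j_B},\qquad \frac{\delta^J}{\delta x^i}=\frac{\partial}{\partial x^i}-\widetilde B^j_{ik}X^k_B\frac{\partial}{\partial X^j_B},\qquad \frac{\partial}{\partial X^i_A},$$ and the jet Berwald linear d-connection $B\Gamma^{\mathbf b}_{\rm jet}$ is the linear connection $D$ with $$D_{\frac{\delta^J}{\delta T^C}}\frac{\delta^J}{\delta T^B}=\Gamma^A_{BC}\frac{\delta^J}{\delta T^A},\quad D_{\frac{\delta^J}{\delta T^C}}\frac{\partial}{\partial X^j_B}=-\Gamma^B_{CA}\frac{\partial}{\partial X^j_A},\quad D_{\frac{\delta^J}{\delta x^j}}\frac{\delta^J}{\delta x^i}=\widetilde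 B^k_{ij}\frac{\delta^J}{\delta x^k},\quad D_{\frac{\delta^J}{\delta x^k}}\frac{\partial}{\partial X^j_B}=\widetilde B^i_{jk}\frac{\partial}{\partial X^i_B},$$ all other derivatives of basis fields being zero. Its local adapted d-torsions are the components of $\mathbf T(X,Y)=D_XY-D_YX-[X,Y]$ in the jet adapted basis: a component with lower indices $u,v$ (in this order) is the component of $\mathbf T(E_v,E_u)$, where $E_u,E_v$ are the corresponding basis fields. The letter $T$ denotes components along $\delta^J/\delta T$, and an index pair ${}^{(m)}_{(\mu)}$, ${}^{(m)}_{(c)}$ denotes components along $\partial/\partial x^m_\mu$, $\partial/\partial y^m_c$. **Theorem.** The following fifteen formulas hold: - (T1) $T^a_{\beta\gamma}=N^a_{\beta:\gamma}-N^a_{\gamma:\beta}=\mathcal R^a_{\beta\gamma}$ - (T2) $P^{(m)\,(b)}_{(\mu)i(j)}=\widetilde{\mathcal P}^m_{ikj}x^k_\mu s^b$ - (T3) $P^{(m)\,(b)}_{(c)i(j)}=\widetilde{\mathcal P}^m_{ikj}y^k_c s^b$ - (T4) $R^{(m)}_{(\mu)\alpha\beta}=-[\mathcal R^\varepsilon_{\mu\alpha\beta}+\mathcal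 P^\varepsilon_{\mu\alpha c}N^c_\beta-\mathcal P^\varepsilon_{\mu\beta c}N^c_\alpha]x^m_\varepsilon+\mathcal A_{\{\alpha,\beta\}}\Big[\dfrac{\partial N^c_{\beta:\mu}}{\partial t^\alpha}+N^d_{\beta:\mu}B^c_{d\alpha}-N^c_{\beta:\gamma}B^\gamma_{\alpha\mu}\Big]y^m_c$ - (T5) $R^{(m)}_{(\mu)\alpha b}=-\mathcal P^\varepsilon_{\mu\alpha b}x^m_\varepsilon+\Big[\dfrac{\partial B^c_{b\mu}}{\partial t^\alpha}-\dfrac{\partial N^c_{\alpha:\mu}}{\partial s^b}+B^d_{b\mu}B^c_{d\alpha}-B^\gamma_{\alpha\mu}B^c_{\gamma b}\Big]y^m_c$ - (T6) $R^{(m)}_{(\mu)a\beta}=\mathcal P^\varepsilon_{\mu a\beta}x^m_\varepsilon-\Big[\dfrac{\partial B^c_{a\mu}}{\partial t^\beta}-\dfrac{\partial N^c_{\beta:\mu}}{\partial s^a}+B^d_{a\mu}B^c_{d\beta}-B^\gamma_{\beta\mu}B^c_{\gamma a}\Big]y^m_c$ - (T7) $R^{(m)}_{(c)\alpha\beta}=-[\mathcal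 R^d_{c\alpha\beta}+\mathcal P^d_{c\alpha f}N^f_\beta-\mathcal P^d_{c\beta f}N^f_\alpha]y^m_d$ - (T8) $R^{(m)}_{(c)\alpha b}=-\mathcal P^d_{c\alpha b}y^m_d$ - (T9) $R^{(m)}_{(c)a\beta}=\mathcal P^d_{ca\beta}y^m_d$ - (T10) $R^{(m)}_{(\mu)\alpha j}=-\widetilde{\mathcal P}^m_{jkl}B^c_{\alpha b}s^bx^k_\mu y^l_c$ - (T11) $R^{(m)}_{(\mu)aj}=-\widetilde{\mathcal P}^m_{jkl}x^k_\mu y^l_a$ - (T12) $R^{(m)}_{(c)\alpha j}=-\widetilde{\mathcal P}^m_{jkl}B^d_{\alpha b}s^by^k_cy^l_d$ - (T13) $R^{(m)}_{(c)aj}=-\widetilde{\mathcal P}^m_{jkl}y^k_cy^l_a$ - (T14) $R^{(m)}_{(\mu)ij}=[\widetilde{\mathcal R}^m_{kij}+\widetilde{\mathcal P}^m_{kil}\widetilde N^l_j-\widetilde{\mathcal P}^m_{kjl}\widetilde N^l_i]x^k_\mu-[\widetilde{\mathcal P}^m_{kil}\widetilde B^l_{jq}-\widetilde{\mathcal P}^m_{kjl}\widetilde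 B^l_{iq}]x^k_\mu y^q_as^a$ - (T15) $R^{(m)}_{(c)ij}=[\widetilde{\mathcal R}^m_{kij}+\widetilde{\mathcal P}^m_{kil}\widetilde N^l_j-\widetilde{\mathcal P}^m_{kjl}\widetilde N^l_i]y^k_c-[\widetilde{\mathcal P}^m_{kil}\widetilde B^l_{jq}-\widetilde{\mathcal P}^m_{kjl}\widetilde B^l_{iq}]y^k_cy^q_as^a$ where $\mathcal A_{\{\alpha,\beta\}}[f_{\alpha\beta}]=f_{\alpha\beta}-f_{\beta\alpha}$. The torsion is skew-symmetric in its two lower indices and, up to this skew-symmetry, every adapted component of the torsion that is not of one of the types (T1)–(T15) vanishes identically. In general none of the fifteen vanishes: there are Finsler structures on open sets $U\subset\mathbb R^p$, $V\subset\mathbb R^n$ (for some $p,n$) for which each of the fifteen families has a component that is nonzero at some point. -/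

import Mathlib

open scoped Manifold ContDiff

universe u v

noncomputable section

namespace JetBerwald

/-! ### Calculus in a coordinate space `ι → ℝ` -/

section Calculus

variable {ι : Type} [Fintype ι] [DecidableEq ι]

/-- The partial derivative `∂f/∂u^k`. -/
def pd (k : ι) (f : (ι → ℝ) → ℝ) (u : ι → ℝ) : ℝ :=
  fderiv ℝ f u (Pi.single k 1)

/-- The coordinate vector field `∂/∂u^k`. -/
def coordField (k : ι) : (ι → ℝ) → (ι → ℝ) := fun _ => Pi.single k 1

/-- The components at `u` of the vector `v` in the frame `E`: the solution `(v^c)` of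
`v = ∑ c, v^c E_c(u)`. -/
def frameCoord (E : ι → (ι → ℝ) → (ι → ℝ)) (u v : ι → ℝ) : ι → ℝ :=
  (Matrix.of fun i c => E c u i)⁻¹.mulVec v

/-- The linear connection with coefficients `Γ` in the frame `E`, that is
`∇_{E_b} E_a = ∑ c, Γ c a b E_c`, extended to all vector fields by linearity and the
Leibniz rule. -/
def frameConn (E : ι → (ι → ℝ) → (ι → ℝ)) (Γ : ι → ι → ι → (ι → ℝ) → ℝ)
    (X Y : (ι → ℝ) → (ι → ℝ)) (u : ι → ℝ) : ι → ℝ :=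
  ∑ c, (fderiv ℝ (fun w => frameCoord E w (Y w) c) u (X u)
      + ∑ a, ∑ b, Γ c a b u * frameCoord E u (Y u) a * frameCoord E u (X u) b) • E c u

/-- The torsion `∇_X Y - ∇_Y X - [X, Y]` of that connection. -/
def frameTorsion (E : ι → (ι → ℝ) → (ι → ℝ)) (Γ : ι → ι → ι → (ι → ℝ) → ℝ)
    (X Y : (ι → ℝ) → (ι → ℝ)) (u : ι → ℝ) : ι → ℝ :=
  frameConn E Γ X Y u - frameConn E Γ Y X u - VectorField.lieBracket ℝ X Y u

end Calculus

/-! ### Finsler geometry in local coordinates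

A point of `TM` is described by `T = (t^α, s^a) : Fin p ⊕ Fin p → ℝ`, with `T (inl α) = t^α` and
`T (inr a) = s^a`. In the names below the upper index of a coefficient comes first and is followed
by its lower indices from left to right. -/

section Finsler

/-- The index `A = (α, a)`. -/
abbrev TIdx (p : ℕ) := Fin p ⊕ Fin p

/-- The part over `U` of the slit tangent bundle: `t ∈ U` and `s ≠ 0`. -/
def slit {p : ℕ} (U : Set (Fin p → ℝ)) : Set (TIdx p → ℝ) :=
  {T | (fun α => T (Sum.inl α)) ∈ U ∧ (fun a => T (Sum.inr a)) ≠ 0}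

variable {p : ℕ} (F : (TIdx p → ℝ) → ℝ)

/-- `g_{αβ} = (1/2) ∂²F²/∂s^α∂s^β`. -/
def metric (α β : Fin p) (T : TIdx p → ℝ) : ℝ :=
  (1 / 2) * pd (Sum.inr α) (pd (Sum.inr β) fun T' => F T' ^ 2) T

/-- `F` is (the local expression over `U` of) a Finsler structure. -/
structure IsFinslerOn (U : Set (Fin p → ℝ)) : Prop where
  nonneg : ∀ T : TIdx p → ℝ, (fun α => T (Sum.inl α)) ∈ U → 0 ≤ F T
  smooth : ContDiffOn ℝ ∞ F (slit U)
  homogeneous : ∀ t ∈ U, ∀ (s : Fin p → ℝ) (r : ℝ), 0 < r →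
    F (Sum.elim t (r • s)) = r * F (Sum.elim t s)
  posDef : ∀ T ∈ slit U, (Matrix.of fun α β => metric F α β T).PosDef

/-- `g^{αβ}`. -/
def metricInv (α β : Fin p) (T : TIdx p → ℝ) : ℝ :=
  (Matrix.of fun μ ν => metric F μ ν T)⁻¹ α β

/-- `C_{αβγ} = (1/2) ∂g_{αβ}/∂s^γ`. -/
def cartanLow (α β γ : Fin p) (T : TIdx p → ℝ) : ℝ :=
  (1 / 2) * pd (Sum.inr γ) (metric F α β) T

/-- `C^β_{αε} = g^{βλ} C_{λαε}`. -/
def cartan (β α ε : Fin p) (T : TIdx p → ℝ) : ℝ :=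
  ∑ l, metricInv F β l T * cartanLow F l α ε T

/-- The formal Christoffel symbols `γ^μ_{αβ}`. -/
def formalChristoffel (μ α β : Fin p) (T : TIdx p → ℝ) : ℝ :=
  ∑ ε, metricInv F μ ε T / 2 *
    (pd (Sum.inl β) (metric F ε α) T + pd (Sum.inl α) (metric F ε β) T
      - pd (Sum.inl ε) (metric F α β) T)

/-- The nonlinear Cartan connection
`N^β_α = γ^β_{αε} s^ε - C^β_{αε} γ^ε_{μν} s^μ s^ν`. -/
def cartanN (β α : Fin p) (T : TIdx p → ℝ) : ℝ :=
  ∑ ε, formalChristoffel F β α ε T * T (Sum.inr ε)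
    - ∑ ε, ∑ μ, ∑ ν, cartan F β α ε T * formalChristoffel F ε μ ν T
        * T (Sum.inr μ) * T (Sum.inr ν)

/-- `δf/δt^α = ∂f/∂t^α - N^ε_α ∂f/∂s^ε`. -/
def deltaT (α : Fin p) (f : (TIdx p → ℝ) → ℝ) (T : TIdx p → ℝ) : ℝ :=
  pd (Sum.inl α) f T - ∑ ε, cartanN F ε α T * pd (Sum.inr ε) f T

/-- The generalized Christoffel symbols `Γ^γ_{αβ}` (Rund, or Chern, connection). -/
def chern (γ α β : Fin p) (T : TIdx p → ℝ) : ℝ :=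
  ∑ μ, metricInv F γ μ T / 2 *
    (deltaT F β (metric F μ α) T + deltaT F α (metric F μ β) T
      - deltaT F μ (metric F α β) T)

/-- The horizontal covariant derivative `C^γ_{αβ|μ}` by the Rund connection. -/
def cartanCov (γ α β μ : Fin p) (T : TIdx p → ℝ) : ℝ :=
  deltaT F μ (cartan F γ α β) T
    + ∑ ε, cartan F ε α β T * chern F γ ε μ T
    - ∑ ε, cartan F γ ε β T * chern F ε α μ T
    - ∑ ε, cartan F γ α ε T * chern F ε β μ T

/-- The Berwald components `B^γ_{αβ} = Γ^γ_{αβ} + C^γ_{αβ|μ} s^μ`. -/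
def berwald (γ α β : Fin p) (T : TIdx p → ℝ) : ℝ :=
  chern F γ α β T + ∑ μ, cartanCov F γ α β μ T * T (Sum.inr μ)

/-- The Berwald torsion `R^α_{βγ} = δN^α_β/δt^γ - δN^α_γ/δt^β`. -/
def berwaldTorsion (α β γ : Fin p) (T : TIdx p → ℝ) : ℝ :=
  deltaT F γ (cartanN F α β) T - deltaT F β (cartanN F α γ) T

/-- The Berwald curvature `R^α_{βγε}`. -/
def berwaldR (α β γ ε : Fin p) (T : TIdx p → ℝ) : ℝ :=
  deltaT F ε (berwald F α β γ) T - deltaT F γ (berwald F α β ε) T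
    + ∑ μ, berwald F μ β γ T * berwald F α μ ε T
    - ∑ μ, berwald F μ β ε T * berwald F α μ γ T

/-- The Berwald curvature `P^α_{βγε} = ∂B^α_{βγ}/∂s^ε`. -/
def berwaldP (α β γ ε : Fin p) (T : TIdx p → ℝ) : ℝ :=
  pd (Sum.inr ε) (berwald F α β γ) T

/-- `N^c_{α:β} = ∂N^c_α/∂t^β + N^d_α B^c_{dβ} - N^c_γ B^γ_{αβ}`. -/
def cartanNcov (c α β : Fin p) (T : TIdx p → ℝ) : ℝ :=
  pd (Sum.inl β) (cartanN F c α) T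
    + ∑ d, cartanN F d α T * berwald F c d β T
    - ∑ γ, cartanN F c γ T * berwald F γ α β T

/-- The adapted basis `δ/δt^α = ∂/∂t^α - N^b_α ∂/∂s^b`, `∂/∂s^a` of the slit tangent bundle. -/
def adaptedFrame : TIdx p → (TIdx p → ℝ) → (TIdx p → ℝ)
  | Sum.inl α => fun T =>
      coordField (Sum.inl α) T - ∑ b, cartanN F b α T • coordField (Sum.inr b) T
  | Sum.inr a => coordField (Sum.inr a)

/-- The coefficients of the Berwald connection in the adapted basis: `B^γ_{αβ}` for
`∇_{δ/δt^β} δ/δt^α`, `B^c_{aβ}` for `∇_{δ/δt^β} ∂/∂s^a`, and zero otherwise. -/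
def berwaldCoef : TIdx p → TIdx p → TIdx p → (TIdx p → ℝ) → ℝ
  | Sum.inl γ, Sum.inl α, Sum.inl β => berwald F γ α β
  | Sum.inr c, Sum.inr a, Sum.inl β => berwald F c a β
  | _, _, _ => fun _ => 0

/-- The normal components `Γ^C_{AB}` of the Berwald connection:
`∇_{∂/∂T^B} ∂/∂T^A = Γ^C_{AB} ∂/∂T^C`. -/
def normalGamma (C A B : TIdx p) (T : TIdx p → ℝ) : ℝ :=
  frameConn (adaptedFrame F) (berwaldCoef F) (coordField B) (coordField A) T C

end Finsler

/-! ### Finsler manifolds -/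

section Manifold

variable {p : ℕ} {M : Type u} [TopologicalSpace M] [ChartedSpace (Fin p → ℝ) M]

/-- The expression of `F : TM → ℝ` in the coordinates `(t, s)` of `TM` induced by the chart `e`
of `M`: `(t, s)` is the tangent vector `s^α ∂/∂t^α` at the point with coordinates `t`. -/
def localExpr (F : TangentBundle 𝓘(ℝ, Fin p → ℝ) M → ℝ) (e : OpenPartialHomeomorph M (Fin p → ℝ))
    (T : TIdx p → ℝ) : ℝ :=
  F ⟨e.symm fun α => T (Sum.inl α),
    mfderiv 𝓘(ℝ, Fin p → ℝ) 𝓘(ℝ, Fin p → ℝ) e.symm (fun α => T (Sum.inl α))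
      (fun a => T (Sum.inr a) : Fin p → ℝ)⟩

/-- `F` is a Finsler structure on `M`. -/
def IsFinslerStructure (F : TangentBundle 𝓘(ℝ, Fin p → ℝ) M → ℝ) : Prop :=
  ∀ e ∈ IsManifold.maximalAtlas 𝓘(ℝ, Fin p → ℝ) ∞ M, IsFinslerOn (localExpr F e) e.target

end Manifold

/-! ### The 1-jet space `J¹(TM, N)` in local coordinates -/

section Jet

variable {p n : ℕ}

/-- The index set of the coordinates `(T^A, x^i, X^i_A)` of `J¹(TM, N)`. -/
abbrev JIdx (p n : ℕ) := TIdx p ⊕ (Fin n ⊕ (Fin n × TIdx p))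

/-- The index of `T^A`. -/
abbrev jT (A : TIdx p) : JIdx p n := Sum.inl A
/-- The index of `t^α`. -/
abbrev jt (α : Fin p) : JIdx p n := Sum.inl (Sum.inl α)
/-- The index of `s^a`. -/
abbrev js (a : Fin p) : JIdx p n := Sum.inl (Sum.inr a)
/-- The index of `x^i`. -/
abbrev jx (i : Fin n) : JIdx p n := Sum.inr (Sum.inl i)
/-- The index of `X^i_A`. -/
abbrev jX (i : Fin n) (A : TIdx p) : JIdx p n := Sum.inr (Sum.inr (i, A))
/-- The index of `x^i_α`. -/
abbrev jxt (i : Fin n) (α : Fin p) : JIdx p n := jX i (Sum.inl α)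
/-- The index of `y^i_a`. -/
abbrev jy (i : Fin n) (a : Fin p) : JIdx p n := jX i (Sum.inr a)

/-- The point `(t^α, s^a)` of `TM` under a jet. -/
def source (z : JIdx p n → ℝ) : TIdx p → ℝ := fun A => z (jT A)

/-- The point `(x^l, y^l_a s^a)` of `TN` at which the objects of the target are evaluated. -/
def target (z : JIdx p n → ℝ) : TIdx n → ℝ :=
  Sum.elim (fun l => z (jx l)) (fun l => ∑ a, z (jy l a) * z (js a))

/-- The jets whose points `(t^α, s^a)` and `(x^l, y^l_a s^a)` lie in the slit tangent bundles over
the coordinate domains `U` and `V`. -/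
def jetDomain (U : Set (Fin p → ℝ)) (V : Set (Fin n → ℝ)) : Set (JIdx p n → ℝ) :=
  {z | source z ∈ slit U ∧ target z ∈ slit V}

variable (F : (TIdx p → ℝ) → ℝ) (F' : (TIdx n → ℝ) → ℝ)

/-- The Berwald temporal nonlinear connection `M^{(j)}_{(B)A} = -Γ^C_{AB} X^j_C`. -/
def jetM (j : Fin n) (B A : TIdx p) (z : JIdx p n → ℝ) : ℝ :=
  -∑ C, normalGamma F C A B (source z) * z (jX j C)

/-- The Berwald spatial nonlinear connection `N^{(j)}_{(B)i} = B̃^j_{ik} X^k_B`. -/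
def jetN (j : Fin n) (B : TIdx p) (i : Fin n) (z : JIdx p n → ℝ) : ℝ :=
  ∑ k, berwald F' j i k (target z) * z (jX k B)

/-- The jet adapted basis `δ/δT^A`, `δ/δx^i`, `∂/∂X^i_A`. -/
def jetFrame : JIdx p n → (JIdx p n → ℝ) → (JIdx p n → ℝ)
  | Sum.inl A => fun z =>
      coordField (jT A) z - ∑ j, ∑ B, jetM F j B A z • coordField (jX j B) z
  | Sum.inr (Sum.inl i) => fun z =>
      coordField (jx i) z - ∑ j, ∑ B, jetN F' j B i z • coordField (jX j B) z
  | Sum.inr (Sum.inr (i, A)) => coordField (jX i A)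

/-- The coefficients of the jet Berwald linear d-connection in the jet adapted basis; with the
arguments `c a b` this is the coefficient of `E_c` in `∇_{E_b} E_a`. The nonzero ones are
`Γ^A_{BC}`, `-δ^i_j Γ^B_{CA}`, `B̃^k_{ij}` and `δ^B_A B̃^i_{jk}`. -/
def jetCoef : JIdx p n → JIdx p n → JIdx p n → (JIdx p n → ℝ) → ℝ
  | Sum.inl A, Sum.inl B, Sum.inl C => fun z => normalGamma F A B C (source z)
  | Sum.inr (Sum.inr (i, A)), Sum.inr (Sum.inr (j, B)), Sum.inl C => fun z =>
      -((if i = j then 1 else 0) * normalGamma F B C A (source z))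
  | Sum.inr (Sum.inl k), Sum.inr (Sum.inl i), Sum.inr (Sum.inl j) => fun z =>
      berwald F' k i j (target z)
  | Sum.inr (Sum.inr (i, A)), Sum.inr (Sum.inr (j, B)), Sum.inr (Sum.inl k) => fun z =>
      (if A = B then 1 else 0) * berwald F' i j k (target z)
  | _, _, _ => fun _ => 0

/-- The adapted components of the torsion of the jet Berwald linear d-connection:
`dTorsion F F' c a b` is the component along `E_c` of `T(E_b, E_a)`. -/
def dTorsion (c a b : JIdx p n) (z : JIdx p n → ℝ) : ℝ :=
  frameCoord (jetFrame F F') z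
    (frameTorsion (jetFrame F F') (jetCoef F F') (jetFrame F F' b) (jetFrame F F' a) z) c

end Jet

/-! ### Types of adapted components -/

/-- The five blocks `δ/δt^α`, `δ/δs^a`, `δ/δx^i`, `∂/∂x^i_α`, `∂/∂y^i_a` of the jet adapted
basis. -/
inductive Block
  | t | s | x | xt | y

/-- The block of an index. -/
def block {p n : ℕ} : JIdx p n → Block
  | Sum.inl (Sum.inl _) => Block.t
  | Sum.inl (Sum.inr _) => Block.s
  | Sum.inr (Sum.inl _) => Block.x
  | Sum.inr (Sum.inr (_, Sum.inl _)) => Block.xt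
  | Sum.inr (Sum.inr (_, Sum.inr _)) => Block.y

/-- The block types `(c, a, b)` of the fifteen families of adapted torsion components. -/
def torsionFamilies : List (Block × Block × Block) :=
  [(.s, .t, .t), (.xt, .x, .y), (.y, .x, .y), (.xt, .t, .t), (.xt, .t, .s), (.xt, .s, .t),
    (.y, .t, .t), (.y, .t, .s), (.y, .s, .t), (.xt, .t, .x), (.xt, .s, .x), (.y, .t, .x),
    (.y, .s, .x), (.xt, .x, .x), (.y, .x, .x)]

end JetBerwald

end

open JetBerwald

set_option linter.unusedSectionVars false
set_option linter.unnecessarySeqFocus false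

noncomputable section

namespace JetBerwald

open Filter Topology

/-! ### Partial derivatives of functions on a coordinate space -/

section PartialDerivatives

variable {ι : Type} [Fintype ι] [DecidableEq ι] {f g : (ι → ℝ) → ℝ} {u : ι → ℝ} {S : Set (ι → ℝ)}

/-! Everything reduces to one torsion formula, one Finsler identity and one example.

Both adapted bases are shears of the coordinate frame: E_c = ∂_c - A^i_c ∂_i, where A leads from one
group of coordinates into a complementary one. Hence A² = 0, the inverse of the frame matrix 1 - A
is 1 + A, and the E_c-component of T(E_b, E_a) is Γ^c_{ab} - Γ^c_{ba} + E_b(A^c_a) - E_a(A^c_b)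
(`IsShearFrame.frameCoord_frameTorsion`). In the jet basis the components along δ/δT and δ/δx are
therefore just skew parts of Γ^C_{AB} and B̃. Along ∂/∂X the shear is linear in X with the very
coefficients of the linear connection. A pair of T-directions then gives the curvature of Γ^C_{AB}
contracted with X. A pair of x-directions gives that of B̃, and all remaining terms come from
differentiating B̃ through its base point (x, y_a s^a); these are the P̃ terms.

The Finsler input makes this explicit. The normal components Γ^C_{AB} are B, N_{α:β}, zero, and
∂N/∂s; the last is again B (`pd_inr_cartanN`). Moreover N is half the fibre derivative of the spray
γ^ε_{μν} s^μ s^ν (`pd_inr_spray`). Both identities rest on the total symmetry of the Cartan tensor,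
on Euler's identity C_{αβγ} s^γ = 0, and on the metric being parallel along the spray. So B and P
are second and third fibre derivatives of half the spray and are symmetric in all lower indices,
which removes every component outside the fifteen families. The combination R + PN - PN is the
curvature of B with δ/δt replaced by ∂/∂t (`berwaldR_add_berwaldP`).

For the nonvanishing both sides carry the Randers metric |s| + t^1 s^1. Its one-form is closed, so
the metric is projectively flat with spray (s^1)² s / F, and N and B are explicit. At s = (1, 0) one
P-component is -3/2 and one curvature component is 3/4; up to nonzero factors these settle every
family except (T1), which is evaluated directly. -/

lemma pd_congr (k : ι) (h : f =ᶠ[𝓝 u] g) : pd k f u = pd k g u := by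
  rw [pd, pd, h.fderiv_eq]

lemma pd_congr_on (k : ι) (hS : IsOpen S) (hu : u ∈ S) (h : ∀ w ∈ S, f w = g w) :
    pd k f u = pd k g u :=
  pd_congr k (Filter.eventuallyEq_of_mem (hS.mem_nhds hu) h)

lemma pd_const (k : ι) (c : ℝ) : pd k (fun _ : ι → ℝ => c) u = 0 := by
  simp [pd]

lemma pd_add (k : ι) (hf : DifferentiableAt ℝ f u) (hg : DifferentiableAt ℝ g u) :
    pd k (fun w => f w + g w) u = pd k f u + pd k g u := by
  simp [pd, fderiv_fun_add hf hg]

lemma pd_sub (k : ι) (hf : DifferentiableAt ℝ f u) (hg : DifferentiableAt ℝ g u) :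
    pd k (fun w => f w - g w) u = pd k f u - pd k g u := by
  simp [pd, fderiv_fun_sub hf hg]

lemma pd_mul (k : ι) (hf : DifferentiableAt ℝ f u) (hg : DifferentiableAt ℝ g u) :
    pd k (fun w => f w * g w) u = pd k f u * g u + f u * pd k g u := by
  simp [pd, fderiv_fun_mul hf hg]; ring

lemma pd_const_mul (k : ι) (c : ℝ) (hf : DifferentiableAt ℝ f u) :
    pd k (fun w => c * f w) u = c * pd k f u := by
  simp [pd, fderiv_const_mul hf]

lemma pd_sum {κ : Type*} (k : ι) {s : Finset κ} {h : κ → (ι → ℝ) → ℝ}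
    (hh : ∀ i ∈ s, DifferentiableAt ℝ (h i) u) :
    pd k (fun w => ∑ i ∈ s, h i w) u = ∑ i ∈ s, pd k (h i) u := by
  simp [pd, fderiv_fun_sum hh]

lemma differentiableAt_coord (i : ι) : DifferentiableAt ℝ (fun w : ι → ℝ => w i) u := by
  fun_prop

lemma fderiv_coord (i : ι) (w : ι → ℝ) : fderiv ℝ (fun w : ι → ℝ => w i) u w = w i := by
  have h : HasFDerivAt (fun w : ι → ℝ => w i) (ContinuousLinearMap.proj (R := ℝ) i) u :=
    (ContinuousLinearMap.proj (R := ℝ) (φ := fun _ : ι => ℝ) i).hasFDerivAt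
  rw [h.fderiv]; rfl

lemma pd_coord (k i : ι) : pd k (fun w : ι → ℝ => w i) u = if i = k then 1 else 0 := by
  rw [pd, fderiv_coord, Pi.single_apply]

lemma fderiv_eq_sum_pd (f : (ι → ℝ) → ℝ) (u w : ι → ℝ) :
    fderiv ℝ f u w = ∑ k, w k * pd k f u := by
  conv_lhs => rw [← Finset.univ_sum_single w, map_sum]
  refine Finset.sum_congr rfl fun k _ => ?_
  rw [pd, ← smul_eq_mul, ← map_smul, ← Pi.single_smul, smul_eq_mul, mul_one]

lemma contDiffOn_pd (k : ι) (hS : IsOpen S) (hf : ContDiffOn ℝ ∞ f S) :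
    ContDiffOn ℝ ∞ (pd k f) S :=
  (hf.fderiv_of_isOpen hS (m := ∞) (by simp)).clm_apply contDiffOn_const

lemma contDiffOn_differentiableAt (hS : IsOpen S) (hf : ContDiffOn ℝ ∞ f S) (hu : u ∈ S) :
    DifferentiableAt ℝ f u :=
  (hf.contDiffAt (hS.mem_nhds hu)).differentiableAt (by simp)

lemma pd_comm (i j : ι) (hS : IsOpen S) (hf : ContDiffOn ℝ ∞ f S) (hu : u ∈ S) :
    pd i (pd j f) u = pd j (pd i f) u := by
  have hc := hf.contDiffAt (hS.mem_nhds hu)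
  have hsymm : IsSymmSndFDerivAt ℝ f u := hc.isSymmSndFDerivAt (by
    rw [minSmoothness_of_isRCLikeNormedField]; exact WithTop.coe_le_coe.2 le_top)
  have hd : DifferentiableAt ℝ (fderiv ℝ f) u :=
    (hc.fderiv_right (m := 1) (by norm_cast)).differentiableAt (by simp)
  have key : ∀ a b : ι, pd a (pd b f) u
      = fderiv ℝ (fderiv ℝ f) u (Pi.single a 1) (Pi.single b 1) := by
    intro a b
    have : fderiv ℝ (pd b f) u = fderiv ℝ (fun w => fderiv ℝ f w (Pi.single b 1)) u := rfl
    rw [pd, this, fderiv_clm_apply hd (by fun_prop)]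
    simp
  rw [key, key, hsymm]

end PartialDerivatives

/-! ### Fibrewise homogeneity on the slit tangent bundle -/

section Slit

variable {p : ℕ} {U : Set (Fin p → ℝ)}

lemma isOpen_slit (hU : IsOpen U) : IsOpen (slit U) := by
  refine IsOpen.and ?_ ?_
  · exact hU.preimage (by fun_prop)
  · exact isOpen_ne.preimage (f := fun (T : TIdx p → ℝ) (a : Fin p) => T (Sum.inr a)) (by fun_prop)

/-- The fibrewise dilation `(t, s) ↦ (t, r s)`. -/
def dilation (r : ℝ) : (TIdx p → ℝ) →L[ℝ] (TIdx p → ℝ) :=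
  ContinuousLinearMap.pi fun A => Sum.elim
    (fun α => ContinuousLinearMap.proj (R := ℝ) (φ := fun _ : TIdx p => ℝ) (Sum.inl α))
    (fun a => r • ContinuousLinearMap.proj (R := ℝ) (φ := fun _ : TIdx p => ℝ) (Sum.inr a)) A

@[simp] lemma dilation_inl (r : ℝ) (T : TIdx p → ℝ) (α : Fin p) :
    dilation r T (Sum.inl α) = T (Sum.inl α) := rfl

@[simp] lemma dilation_inr (r : ℝ) (T : TIdx p → ℝ) (a : Fin p) :
    dilation r T (Sum.inr a) = r * T (Sum.inr a) := rfl

lemma dilation_mem_slit {r : ℝ} (hr : 0 < r) {T : TIdx p → ℝ} (hT : T ∈ slit U) :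
    dilation r T ∈ slit U := by
  refine ⟨hT.1, fun h => hT.2 ?_⟩
  funext a
  have := congrFun h a
  simpa [hr.ne'] using this

lemma dilation_one (T : TIdx p → ℝ) : dilation 1 T = T := by
  funext A; rcases A with α | a <;> simp

lemma dilation_single_inr (r : ℝ) (a : Fin p) :
    dilation r (Pi.single (Sum.inr a) 1 : TIdx p → ℝ) = r • Pi.single (Sum.inr a) 1 := by
  funext A
  rcases A with α | b
  · simp
  · simp

/-- Fibre derivatives lower the degree of homogeneity by one. -/
lemma pd_dilation (hU : IsOpen U) {f : (TIdx p → ℝ) → ℝ} (hf : ContDiffOn ℝ ∞ f (slit U))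
    {r c : ℝ} (hr : 0 < r) (h : ∀ T ∈ slit U, f (dilation r T) = c * f T) (a : Fin p)
    {T : TIdx p → ℝ} (hT : T ∈ slit U) :
    r * pd (Sum.inr a) f (dilation r T) = c * pd (Sum.inr a) f T := by
  have hO := isOpen_slit hU
  have hd := contDiffOn_differentiableAt hO hf (dilation_mem_slit hr hT)
  have h1 : HasFDerivAt (fun T => f (dilation r T))
      ((fderiv ℝ f (dilation r T)).comp (dilation r)) T :=
    hd.hasFDerivAt.comp T (dilation r).hasFDerivAt
  have h2 : pd (Sum.inr a) (fun T => f (dilation r T)) T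
      = pd (Sum.inr a) (fun T => c * f T) T := pd_congr_on _ hO hT h
  rw [pd_const_mul _ _ (contDiffOn_differentiableAt hO hf hT)] at h2
  rw [← h2, pd, pd, h1.fderiv, ContinuousLinearMap.comp_apply, dilation_single_inr, map_smul,
    smul_eq_mul]

/-- Euler's identity in degree zero. -/
lemma euler_zero (hU : IsOpen U) {f : (TIdx p → ℝ) → ℝ} (hf : ContDiffOn ℝ ∞ f (slit U))
    (h : ∀ r : ℝ, 0 < r → ∀ T ∈ slit U, f (dilation r T) = f T)
    {T : TIdx p → ℝ} (hT : T ∈ slit U) :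
    ∑ a, T (Sum.inr a) * pd (Sum.inr a) f T = 0 := by
  have hO := isOpen_slit hU
  have hd := contDiffOn_differentiableAt hO hf hT
  -- The function is constant along the ray r ↦ (t, r s), whose velocity at r = 1 is the vertical
  -- vector (0, s).
  have hγ : HasDerivAt (fun r : ℝ => dilation r T) (Sum.elim 0 fun a => T (Sum.inr a)) 1 := by
    rw [hasDerivAt_pi]
    rintro (α | a)
    · simpa using hasDerivAt_const (1 : ℝ) (T (Sum.inl α))
    · simpa using (hasDerivAt_id (1 : ℝ)).mul_const (T (Sum.inr a))
  have h1 : HasDerivAt (fun r : ℝ => f (dilation r T))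
      (fderiv ℝ f T (Sum.elim 0 fun a => T (Sum.inr a))) 1 := by
    have := hd.hasFDerivAt
    rw [← dilation_one T] at this
    have h3 := this.comp_hasDerivAt (1 : ℝ) hγ
    rwa [dilation_one] at h3
  have h2 : HasDerivAt (fun r : ℝ => f (dilation r T)) 0 1 := by
    refine (hasDerivAt_const (1 : ℝ) (f T)).congr_of_eventuallyEq ?_
    filter_upwards [lt_mem_nhds (zero_lt_one (α := ℝ))] with r hr using h r hr T hT
  have := h1.unique h2
  rw [fderiv_eq_sum_pd, Fintype.sum_sum_type] at this
  simpa using this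

end Slit

/-! ### Smoothness of the Finsler objects -/

section Smoothness

variable {p : ℕ} {U : Set (Fin p → ℝ)} {F : (TIdx p → ℝ) → ℝ}

lemma contDiffOn_coord {ι : Type} [Fintype ι] (i : ι) (S : Set (ι → ℝ)) :
    ContDiffOn ℝ ∞ (fun w : ι → ℝ => w i) S :=
  (contDiff_apply ℝ ℝ i).contDiffOn

variable (hU : IsOpen U) (hF : IsFinslerOn F U)
include hU hF

lemma contDiffOn_sq : ContDiffOn ℝ ∞ (fun T => F T ^ 2) (slit U) := hF.smooth.pow 2

lemma contDiffOn_metric (α β : Fin p) : ContDiffOn ℝ ∞ (metric F α β) (slit U) :=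
  contDiffOn_const.mul (contDiffOn_pd _ (isOpen_slit hU)
    (contDiffOn_pd _ (isOpen_slit hU) (contDiffOn_sq hU hF)))

lemma metric_det_pos {T : TIdx p → ℝ} (hT : T ∈ slit U) :
    0 < (Matrix.of fun α β => metric F α β T).det := (hF.posDef T hT).det_pos

lemma contDiffOn_metric_det : ContDiffOn ℝ ∞
    (fun T => (Matrix.of fun α β => metric F α β T).det) (slit U) := by
  simp only [Matrix.det_apply]
  refine ContDiffOn.sum fun σ _ => ContDiffOn.const_smul _ (contDiffOn_prod fun i _ => ?_)
  exact contDiffOn_metric hU hF _ _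

lemma contDiffOn_metric_adjugate (α β : Fin p) : ContDiffOn ℝ ∞
    (fun T => (Matrix.of fun α β => metric F α β T).adjugate α β) (slit U) := by
  simp only [Matrix.adjugate_apply, Matrix.det_apply]
  refine ContDiffOn.sum fun σ _ => ContDiffOn.const_smul _ (contDiffOn_prod fun i _ => ?_)
  by_cases h : σ i = β
  · simp only [h, Matrix.updateRow_self]; exact contDiffOn_const
  · simp only [Matrix.updateRow_ne h]; exact contDiffOn_metric hU hF _ _

/-- Cramer's rule: the adjugate and the determinant are polynomials in the entries of the metric,
and positive definiteness keeps the determinant away from zero. -/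
lemma contDiffOn_metricInv (α β : Fin p) : ContDiffOn ℝ ∞ (metricInv F α β) (slit U) := by
  have : ∀ T, metricInv F α β T = ((Matrix.of fun α β => metric F α β T).det)⁻¹
      * (Matrix.of fun α β => metric F α β T).adjugate α β := by
    intro T
    rw [metricInv, Matrix.inv_def, Matrix.smul_apply, Ring.inverse_eq_inv', smul_eq_mul]
  rw [funext this]
  exact ((contDiffOn_metric_det hU hF).inv fun T hT => (metric_det_pos hU hF hT).ne').mul
    (contDiffOn_metric_adjugate hU hF α β)

lemma contDiffOn_cartanLow (α β γ : Fin p) : ContDiffOn ℝ ∞ (cartanLow F α β γ) (slit U) :=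
  contDiffOn_const.mul (contDiffOn_pd _ (isOpen_slit hU) (contDiffOn_metric hU hF _ _))

lemma contDiffOn_cartan (α β γ : Fin p) : ContDiffOn ℝ ∞ (cartan F α β γ) (slit U) :=
  ContDiffOn.sum fun _ _ => (contDiffOn_metricInv hU hF _ _).mul (contDiffOn_cartanLow hU hF _ _ _)

lemma contDiffOn_formalChristoffel (α β γ : Fin p) :
    ContDiffOn ℝ ∞ (formalChristoffel F α β γ) (slit U) :=
  ContDiffOn.sum fun _ _ => ((contDiffOn_metricInv hU hF _ _).div_const _).mul
    (((contDiffOn_pd _ (isOpen_slit hU) (contDiffOn_metric hU hF _ _)).add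
      (contDiffOn_pd _ (isOpen_slit hU) (contDiffOn_metric hU hF _ _))).sub
      (contDiffOn_pd _ (isOpen_slit hU) (contDiffOn_metric hU hF _ _)))

lemma contDiffOn_cartanN (β α : Fin p) : ContDiffOn ℝ ∞ (cartanN F β α) (slit U) :=
  (ContDiffOn.sum fun _ _ => (contDiffOn_formalChristoffel hU hF _ _ _).mul
    (contDiffOn_coord _ _)).sub
  (ContDiffOn.sum fun _ _ => ContDiffOn.sum fun _ _ => ContDiffOn.sum fun _ _ =>
    (((contDiffOn_cartan hU hF _ _ _).mul (contDiffOn_formalChristoffel hU hF _ _ _)).mul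
      (contDiffOn_coord _ _)).mul (contDiffOn_coord _ _))

lemma contDiffOn_deltaT (α : Fin p) {f : (TIdx p → ℝ) → ℝ} (hf : ContDiffOn ℝ ∞ f (slit U)) :
    ContDiffOn ℝ ∞ (deltaT F α f) (slit U) :=
  (contDiffOn_pd _ (isOpen_slit hU) hf).sub (ContDiffOn.sum fun _ _ =>
    (contDiffOn_cartanN hU hF _ _).mul (contDiffOn_pd _ (isOpen_slit hU) hf))

lemma contDiffOn_chern (γ α β : Fin p) : ContDiffOn ℝ ∞ (chern F γ α β) (slit U) :=
  ContDiffOn.sum fun _ _ => ((contDiffOn_metricInv hU hF _ _).div_const _).mul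
    (((contDiffOn_deltaT hU hF _ (contDiffOn_metric hU hF _ _)).add
      (contDiffOn_deltaT hU hF _ (contDiffOn_metric hU hF _ _))).sub
      (contDiffOn_deltaT hU hF _ (contDiffOn_metric hU hF _ _)))

lemma contDiffOn_cartanCov (γ α β μ : Fin p) :
    ContDiffOn ℝ ∞ (cartanCov F γ α β μ) (slit U) :=
  (((contDiffOn_deltaT hU hF _ (contDiffOn_cartan hU hF _ _ _)).add
    (ContDiffOn.sum fun _ _ => (contDiffOn_cartan hU hF _ _ _).mul
      (contDiffOn_chern hU hF _ _ _))).sub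
    (ContDiffOn.sum fun _ _ => (contDiffOn_cartan hU hF _ _ _).mul
      (contDiffOn_chern hU hF _ _ _))).sub
    (ContDiffOn.sum fun _ _ => (contDiffOn_cartan hU hF _ _ _).mul
      (contDiffOn_chern hU hF _ _ _))

lemma contDiffOn_berwald (γ α β : Fin p) : ContDiffOn ℝ ∞ (berwald F γ α β) (slit U) :=
  (contDiffOn_chern hU hF _ _ _).add (ContDiffOn.sum fun _ _ =>
    (contDiffOn_cartanCov hU hF _ _ _ _).mul (contDiffOn_coord _ _))

lemma contDiffOn_cartanNcov (c α β : Fin p) : ContDiffOn ℝ ∞ (cartanNcov F c α β) (slit U) :=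
  ((contDiffOn_pd _ (isOpen_slit hU) (contDiffOn_cartanN hU hF _ _)).add
    (ContDiffOn.sum fun _ _ => (contDiffOn_cartanN hU hF _ _).mul
      (contDiffOn_berwald hU hF _ _ _))).sub
    (ContDiffOn.sum fun _ _ => (contDiffOn_cartanN hU hF _ _).mul
      (contDiffOn_berwald hU hF _ _ _))

end Smoothness

/-! ### The spray, the nonlinear Cartan connection and the Berwald coefficients -/

section FinslerIdentities

variable {p : ℕ} {U : Set (Fin p → ℝ)} {F : (TIdx p → ℝ) → ℝ}

/-- The Christoffel symbols of the first kind of `g_{αβ}`, with the lowered index in front. -/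
def christoffelLow (F : (TIdx p → ℝ) → ℝ) (β α ν : Fin p) (T : TIdx p → ℝ) : ℝ :=
  (1 / 2) * (pd (Sum.inl ν) (metric F β α) T + pd (Sum.inl α) (metric F β ν) T
    - pd (Sum.inl β) (metric F α ν) T)

/-- The spray coefficients `γ^ε_{μν} s^μ s^ν`. -/
def spray (F : (TIdx p → ℝ) → ℝ) (ε : Fin p) (T : TIdx p → ℝ) : ℝ :=
  ∑ μ, ∑ ν, formalChristoffel F ε μ ν T * T (Sum.inr μ) * T (Sum.inr ν)

/-- The spray `s^α ∂/∂t^α - γ^ε_{μν} s^μ s^ν ∂/∂s^ε`. -/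
def sprayVec (F : (TIdx p → ℝ) → ℝ) (T : TIdx p → ℝ) : TIdx p → ℝ :=
  Sum.elim (fun α => T (Sum.inr α)) (fun ε => -spray F ε T)

lemma formalChristoffel_eq (μ α β : Fin p) (T : TIdx p → ℝ) :
    formalChristoffel F μ α β T = ∑ ε, metricInv F μ ε T * christoffelLow F ε α β T := by
  simp only [formalChristoffel, christoffelLow]
  exact Finset.sum_congr rfl fun ε _ => by ring

lemma cartanN_eq (β α : Fin p) (T : TIdx p → ℝ) :
    cartanN F β α T = ∑ ε, formalChristoffel F β α ε T * T (Sum.inr ε)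
      - ∑ ε, cartan F β α ε T * spray F ε T := by
  simp only [cartanN, spray, Finset.mul_sum, mul_assoc]

lemma pd_inr_metric (α β γ : Fin p) (T : TIdx p → ℝ) :
    pd (Sum.inr γ) (metric F α β) T = 2 * cartanLow F α β γ T := by
  rw [cartanLow]; ring

variable (hU : IsOpen U) (hF : IsFinslerOn F U)
include hU hF

lemma metric_symm (α β : Fin p) {T : TIdx p → ℝ} (hT : T ∈ slit U) :
    metric F α β T = metric F β α T := by
  rw [metric, metric, pd_comm _ _ (isOpen_slit hU) (contDiffOn_sq hU hF) hT]

lemma cartanLow_swap_left (α β γ : Fin p) {T : TIdx p → ℝ} (hT : T ∈ slit U) :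
    cartanLow F α β γ T = cartanLow F β α γ T := by
  rw [cartanLow, cartanLow,
    pd_congr_on _ (isOpen_slit hU) hT fun w hw => metric_symm hU hF α β hw]

/-- The Cartan tensor is a quarter of the third fibre derivative of F². Together with
`cartanLow_swap_left` this yields its total symmetry. -/
lemma cartanLow_swap_right (α β γ : Fin p) {T : TIdx p → ℝ} (hT : T ∈ slit U) :
    cartanLow F α β γ T = cartanLow F α γ β T := by
  have hO := isOpen_slit hU
  have hL := contDiffOn_sq hU hF
  have key : ∀ β γ : Fin p, cartanLow F α β γ T = (1 / 2) * ((1 / 2) *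
      pd (Sum.inr α) (pd (Sum.inr γ) (pd (Sum.inr β) fun T' => F T' ^ 2)) T) := by
    intro β γ
    have : metric F α β
        = fun T => (1 / 2) * pd (Sum.inr α) (pd (Sum.inr β) fun T' => F T' ^ 2) T := rfl
    rw [cartanLow, this, pd_const_mul _ _ (contDiffOn_differentiableAt hO
      (contDiffOn_pd _ hO (contDiffOn_pd _ hO hL)) hT), pd_comm _ _ hO (contDiffOn_pd _ hO hL) hT]
  rw [key, key, pd_congr_on _ hO hT fun w hw => pd_comm (Sum.inr γ) (Sum.inr β) hO hL hw]

/-- F² has degree two in s and each fibre derivative lowers the degree by one. -/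
lemma metric_dilation (α β : Fin p) {r : ℝ} (hr : 0 < r) {T : TIdx p → ℝ} (hT : T ∈ slit U) :
    metric F α β (dilation r T) = metric F α β T := by
  have hO := isOpen_slit hU
  have hL := contDiffOn_sq hU hF
  have h0 : ∀ T ∈ slit U, (fun T' => F T' ^ 2) (dilation r T) = r ^ 2 * (fun T' => F T' ^ 2) T := by
    intro T hT
    have h := hF.homogeneous _ hT.1 (fun a => T (Sum.inr a)) r hr
    have e1 : Sum.elim (fun α => T (Sum.inl α)) (r • fun a => T (Sum.inr a)) = dilation r T := by
      funext A; rcases A with a | a <;> simp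
    have e2 : Sum.elim (fun α => T (Sum.inl α)) (fun a => T (Sum.inr a)) = T := by
      funext A; rcases A with a | a <;> simp
    rw [e1, e2] at h
    simp only [h]; ring
  have h1 : ∀ T ∈ slit U, pd (Sum.inr β) (fun T' => F T' ^ 2) (dilation r T)
      = r * pd (Sum.inr β) (fun T' => F T' ^ 2) T := by
    intro T hT
    have := pd_dilation hU hL hr h0 β hT
    apply mul_left_cancel₀ hr.ne'
    rw [this]; ring
  have h2 := pd_dilation hU (contDiffOn_pd _ hO hL) hr h1 α hT
  rw [metric, metric, mul_left_cancel₀ hr.ne' h2]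

lemma sum_cartanLow (α β : Fin p) {T : TIdx p → ℝ} (hT : T ∈ slit U) :
    ∑ γ, cartanLow F α β γ T * T (Sum.inr γ) = 0 := by
  have h := euler_zero hU (contDiffOn_metric hU hF α β)
    (fun r hr T hT => metric_dilation hU hF α β hr hT) hT
  simp only [pd_inr_metric] at h
  have h2 : 2 * ∑ γ, cartanLow F α β γ T * T (Sum.inr γ) = 0 := by
    rw [← h, Finset.mul_sum]
    exact Finset.sum_congr rfl fun _ _ => by ring
  linarith

/-- The t-derivative of `sum_cartanLow`, in which s is constant. -/
lemma sum_pd_inl_cartanLow (μ α β : Fin p) {T : TIdx p → ℝ} (hT : T ∈ slit U) :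
    ∑ γ, pd (Sum.inl μ) (cartanLow F α β γ) T * T (Sum.inr γ) = 0 := by
  have hO := isOpen_slit hU
  have h := pd_congr_on (Sum.inl μ) hO hT fun w hw => sum_cartanLow hU hF α β hw
  have hd := fun γ => contDiffOn_differentiableAt hO (contDiffOn_cartanLow hU hF α β γ) hT
  rw [pd_const, pd_sum _ fun γ _ => (hd γ).fun_mul (differentiableAt_coord _)] at h
  rw [← h]
  refine Finset.sum_congr rfl fun γ _ => ?_
  rw [pd_mul _ (hd γ) (differentiableAt_coord _), pd_coord]
  simp

lemma pd_inr_cartanLow_swap (α β γ μ : Fin p) {T : TIdx p → ℝ} (hT : T ∈ slit U) :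
    pd (Sum.inr μ) (cartanLow F α β γ) T = pd (Sum.inr γ) (cartanLow F α β μ) T := by
  have hO := isOpen_slit hU
  have hg := contDiffOn_metric hU hF α β
  have e : ∀ γ, cartanLow F α β γ = fun T => (1 / 2) * pd (Sum.inr γ) (metric F α β) T :=
    fun _ => rfl
  have hd := fun γ : Fin p => contDiffOn_differentiableAt hO (contDiffOn_pd (Sum.inr γ) hO hg) hT
  rw [e, e, pd_const_mul _ _ (hd _), pd_const_mul _ _ (hd _), pd_comm _ _ hO hg hT]

lemma pd_inl_metric_comm (μ α β γ : Fin p) {T : TIdx p → ℝ} (hT : T ∈ slit U) :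
    pd (Sum.inr γ) (pd (Sum.inl μ) (metric F α β)) T
      = 2 * pd (Sum.inl μ) (cartanLow F α β γ) T := by
  have hO := isOpen_slit hU
  rw [pd_comm _ _ hO (contDiffOn_metric hU hF α β) hT,
    pd_congr_on _ hO hT fun w _ => pd_inr_metric α β γ w,
    pd_const_mul _ _ (contDiffOn_differentiableAt hO (contDiffOn_cartanLow hU hF α β γ) hT)]

lemma metric_mul_metricInv (α β : Fin p) {T : TIdx p → ℝ} (hT : T ∈ slit U) :
    ∑ l, metric F α l T * metricInv F l β T = if α = β then 1 else 0 := by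
  have h := Matrix.mul_nonsing_inv (Matrix.of fun α β => metric F α β T)
    (metric_det_pos hU hF hT).ne'.isUnit
  have := congrFun (congrFun h α) β
  rwa [Matrix.mul_apply, Matrix.one_apply] at this

lemma metricInv_mul_metric (α β : Fin p) {T : TIdx p → ℝ} (hT : T ∈ slit U) :
    ∑ l, metricInv F α l T * metric F l β T = if α = β then 1 else 0 := by
  have h := Matrix.nonsing_inv_mul (Matrix.of fun α β => metric F α β T)
    (metric_det_pos hU hF hT).ne'.isUnit
  have := congrFun (congrFun h α) β
  rwa [Matrix.mul_apply, Matrix.one_apply] at this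

/-- Lowering an index undoes raising it. -/
lemma lower_raise (x : Fin p → ℝ) (l : Fin p) {T : TIdx p → ℝ} (hT : T ∈ slit U) :
    ∑ μ, metric F l μ T * ∑ ε, metricInv F μ ε T * x ε = x l := by
  simp only [Finset.mul_sum, ← mul_assoc]
  rw [Finset.sum_comm]
  simp only [← Finset.sum_mul, metric_mul_metricInv hU hF _ _ hT]
  simp

/-- Indices may be compared after lowering them. -/
lemma eq_of_lower_eq {x y : Fin p → ℝ} {T : TIdx p → ℝ} (hT : T ∈ slit U)
    (h : ∀ l, ∑ μ, metric F l μ T * x μ = ∑ μ, metric F l μ T * y μ) : x = y := by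
  have key : ∀ (x : Fin p → ℝ) (μ : Fin p),
      ∑ l, metricInv F μ l T * ∑ ν, metric F l ν T * x ν = x μ := by
    intro x μ
    simp only [Finset.mul_sum, ← mul_assoc]
    rw [Finset.sum_comm]
    simp only [← Finset.sum_mul, metricInv_mul_metric hU hF _ _ hT]
    simp
  funext μ
  rw [← key x μ, ← key y μ]
  simp only [h]

lemma lower_formalChristoffel (l α β : Fin p) {T : TIdx p → ℝ} (hT : T ∈ slit U) :
    ∑ μ, metric F l μ T * formalChristoffel F μ α β T = christoffelLow F l α β T := by
  simp only [formalChristoffel_eq]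
  exact lower_raise hU hF _ l hT

lemma lower_cartan (l α β : Fin p) {T : TIdx p → ℝ} (hT : T ∈ slit U) :
    ∑ μ, metric F l μ T * cartan F μ α β T = cartanLow F l α β T :=
  lower_raise hU hF (fun ε => cartanLow F ε α β T) l hT

lemma lower_spray (l : Fin p) {T : TIdx p → ℝ} (hT : T ∈ slit U) :
    ∑ μ, metric F l μ T * spray F μ T
      = ∑ μ, ∑ ν, christoffelLow F l μ ν T * T (Sum.inr μ) * T (Sum.inr ν) := by
  simp only [spray, Finset.mul_sum]
  rw [Finset.sum_comm]
  refine Finset.sum_congr rfl fun μ _ => ?_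
  rw [Finset.sum_comm]
  refine Finset.sum_congr rfl fun ν _ => ?_
  rw [← lower_formalChristoffel hU hF l μ ν hT, Finset.sum_mul, Finset.sum_mul]
  exact Finset.sum_congr rfl fun _ _ => by ring

lemma lower_cartanN (l α : Fin p) {T : TIdx p → ℝ} (hT : T ∈ slit U) :
    ∑ μ, metric F l μ T * cartanN F μ α T
      = ∑ ε, christoffelLow F l α ε T * T (Sum.inr ε)
        - ∑ ε, cartanLow F l α ε T * spray F ε T := by
  simp only [cartanN_eq, mul_sub, Finset.sum_sub_distrib, Finset.mul_sum]
  congr 1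
  · rw [Finset.sum_comm]
    refine Finset.sum_congr rfl fun ν _ => ?_
    rw [← lower_formalChristoffel hU hF l α ν hT, Finset.sum_mul]
    exact Finset.sum_congr rfl fun _ _ => by ring
  · rw [Finset.sum_comm]
    refine Finset.sum_congr rfl fun ν _ => ?_
    rw [← lower_cartan hU hF l α ν hT, Finset.sum_mul]
    exact Finset.sum_congr rfl fun _ _ => by ring

lemma sum_cartan (μ ε : Fin p) {T : TIdx p → ℝ} (hT : T ∈ slit U) :
    ∑ α, cartan F μ α ε T * T (Sum.inr α) = 0 := by
  simp only [cartan, Finset.sum_mul]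
  rw [Finset.sum_comm]
  refine Finset.sum_eq_zero fun l _ => ?_
  have h := sum_cartanLow hU hF l ε hT
  rw [← mul_zero (metricInv F μ l T), ← h, Finset.mul_sum]
  refine Finset.sum_congr rfl fun α _ => ?_
  rw [cartanLow_swap_right hU hF l α ε hT]; ring

/-- Contraction with s kills the Cartan term of N. -/
lemma cartanN_contract (β : Fin p) {T : TIdx p → ℝ} (hT : T ∈ slit U) :
    ∑ α, cartanN F β α T * T (Sum.inr α) = spray F β T := by
  simp only [cartanN_eq, sub_mul, Finset.sum_sub_distrib, Finset.sum_mul]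
  have h : ∑ α, ∑ ε, cartan F β α ε T * spray F ε T * T (Sum.inr α) = 0 := by
    rw [Finset.sum_comm]
    refine Finset.sum_eq_zero fun ε _ => ?_
    rw [← mul_zero (spray F ε T), ← sum_cartan hU hF β ε hT, Finset.mul_sum]
    exact Finset.sum_congr rfl fun _ _ => by ring
  rw [h, sub_zero, spray]
  exact Finset.sum_congr rfl fun _ _ => Finset.sum_congr rfl fun _ _ => by ring

lemma contDiffOn_spray (ε : Fin p) : ContDiffOn ℝ ∞ (spray F ε) (slit U) :=
  ContDiffOn.sum fun _ _ => ContDiffOn.sum fun _ _ =>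
    ((contDiffOn_formalChristoffel hU hF _ _ _).mul (contDiffOn_coord _ _)).mul
      (contDiffOn_coord _ _)

lemma contDiffOn_christoffelLow (β α ν : Fin p) :
    ContDiffOn ℝ ∞ (christoffelLow F β α ν) (slit U) :=
  contDiffOn_const.mul (((contDiffOn_pd _ (isOpen_slit hU) (contDiffOn_metric hU hF _ _)).add
      (contDiffOn_pd _ (isOpen_slit hU) (contDiffOn_metric hU hF _ _))).sub
      (contDiffOn_pd _ (isOpen_slit hU) (contDiffOn_metric hU hF _ _)))

lemma pd_inr_christoffelLow (β α ν b : Fin p) {T : TIdx p → ℝ} (hT : T ∈ slit U) :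
    pd (Sum.inr b) (christoffelLow F β α ν) T
      = pd (Sum.inl ν) (cartanLow F β α b) T + pd (Sum.inl α) (cartanLow F β ν b) T
        - pd (Sum.inl β) (cartanLow F α ν b) T := by
  have hO := isOpen_slit hU
  have hd : ∀ μ α β : Fin p, DifferentiableAt ℝ (pd (Sum.inl μ) (metric F α β)) T := fun μ α β =>
    contDiffOn_differentiableAt hO (contDiffOn_pd _ hO (contDiffOn_metric hU hF α β)) hT
  have e : christoffelLow F β α ν = fun T => (1 / 2) * (pd (Sum.inl ν) (metric F β α) T
    + pd (Sum.inl α) (metric F β ν) T - pd (Sum.inl β) (metric F α ν) T) := rfl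
  rw [e, pd_const_mul _ _ (((hd _ _ _).fun_add (hd _ _ _)).fun_sub (hd _ _ _)),
    pd_sub _ ((hd _ _ _).fun_add (hd _ _ _)) (hd _ _ _), pd_add _ (hd _ _ _) (hd _ _ _)]
  simp only [pd_inl_metric_comm hU hF _ _ _ _ hT]
  ring

lemma christoffelLow_swap (β α ν : Fin p) {T : TIdx p → ℝ} (hT : T ∈ slit U) :
    christoffelLow F β α ν T = christoffelLow F β ν α T := by
  have := pd_congr_on (Sum.inl β) (isOpen_slit hU) hT fun w hw => metric_symm hU hF α ν hw
  rw [christoffelLow, christoffelLow, this]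
  ring

lemma sum_pd_inl_cartanLow_mid (μ α β : Fin p) {T : TIdx p → ℝ} (hT : T ∈ slit U) :
    ∑ γ, pd (Sum.inl μ) (cartanLow F α γ β) T * T (Sum.inr γ) = 0 := by
  rw [← sum_pd_inl_cartanLow hU hF μ α β hT]
  refine Finset.sum_congr rfl fun γ _ => ?_
  rw [pd_congr_on _ (isOpen_slit hU) hT fun w hw => cartanLow_swap_right hU hF α γ β hw]

/-- Of the three derivatives of the Cartan tensor in `pd_inr_christoffelLow`, two contract a tensor
index with s and vanish by Euler's identity; only the one whose derivative index is contracted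
survives. -/
lemma sum_pd_inr_christoffelLow (β α b : Fin p) {T : TIdx p → ℝ} (hT : T ∈ slit U) :
    ∑ ν, pd (Sum.inr b) (christoffelLow F β α ν) T * T (Sum.inr ν)
      = ∑ ν, pd (Sum.inl ν) (cartanLow F β α b) T * T (Sum.inr ν) := by
  simp only [pd_inr_christoffelLow hU hF _ _ _ _ hT, add_mul, sub_mul, Finset.sum_add_distrib,
    Finset.sum_sub_distrib, sum_pd_inl_cartanLow_mid hU hF _ _ _ hT]
  ring

/-- The nonlinear Cartan connection is the fibre derivative of half the spray. -/
lemma pd_inr_spray (ε b : Fin p) {T : TIdx p → ℝ} (hT : T ∈ slit U) :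
    pd (Sum.inr b) (spray F ε) T = 2 * cartanN F ε b T := by
  have hO := isOpen_slit hU
  have hg := fun α β => contDiffOn_differentiableAt hO (contDiffOn_metric hU hF α β) hT
  have hs := fun α => contDiffOn_differentiableAt hO (contDiffOn_spray hU hF α) hT
  have hc := fun α β γ => contDiffOn_differentiableAt hO (contDiffOn_christoffelLow hU hF α β γ) hT
  have hx := fun i : TIdx p => differentiableAt_coord (u := T) i
  refine congrFun (eq_of_lower_eq hU hF (x := fun ε => pd (Sum.inr b) (spray F ε) T)
    (y := fun ε => 2 * cartanN F ε b T) hT fun l => ?_) ε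
  -- The lowered spray is differentiated, so that no derivative of the inverse metric appears; the
  -- derivative of the metric produces the Cartan term of N.
  have h := pd_congr_on (Sum.inr b) hO hT fun w hw => lower_spray hU hF l hw
  rw [pd_sum _ fun μ _ => (hg _ _).fun_mul (hs _),
    pd_sum _ fun μ _ => DifferentiableAt.fun_sum fun ν _ => ((hc _ _ _).fun_mul (hx _)).fun_mul (hx _)] at h
  have e1 : ∀ μ, pd (Sum.inr b) (fun T => ∑ ν, christoffelLow F l μ ν T * T (Sum.inr μ)
        * T (Sum.inr ν)) T
      = (∑ ν, pd (Sum.inr b) (christoffelLow F l μ ν) T * T (Sum.inr ν)) * T (Sum.inr μ)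
        + (if μ = b then ∑ ν, christoffelLow F l μ ν T * T (Sum.inr ν) else 0)
        + christoffelLow F l μ b T * T (Sum.inr μ) := by
    intro μ
    rw [pd_sum _ fun ν _ => ((hc _ _ _).fun_mul (hx _)).fun_mul (hx _)]
    have : ∀ ν, pd (Sum.inr b) (fun T => christoffelLow F l μ ν T * T (Sum.inr μ) * T (Sum.inr ν)) T
        = pd (Sum.inr b) (christoffelLow F l μ ν) T * T (Sum.inr ν) * T (Sum.inr μ)
          + (if μ = b then christoffelLow F l μ ν T * T (Sum.inr ν) else 0)
          + (if ν = b then christoffelLow F l μ ν T * T (Sum.inr μ) else 0) := by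
      intro ν
      rw [pd_mul _ ((hc _ _ _).fun_mul (hx _)) (hx _), pd_mul _ (hc _ _ _) (hx _), pd_coord, pd_coord]
      simp only [Sum.inr.injEq]
      split_ifs <;> ring
    simp only [this, Finset.sum_add_distrib, Finset.sum_mul]
    congr 1
    · congr 1
      split_ifs <;> simp
    · simp
  simp only [e1, sum_pd_inr_christoffelLow hU hF _ _ _ hT, Finset.sum_add_distrib,
    pd_mul _ (hg _ _) (hs _), pd_inr_metric] at h
  -- The term left by the first-kind symbols contains a second factor s, contracted with an index of
  -- the Cartan tensor.
  have e2 : ∑ μ, (∑ ν, pd (Sum.inl ν) (cartanLow F l μ b) T * T (Sum.inr ν)) * T (Sum.inr μ) = 0 := by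
    simp only [Finset.sum_mul]
    rw [Finset.sum_comm]
    refine Finset.sum_eq_zero fun ν _ => ?_
    rw [← mul_zero (T (Sum.inr ν)), ← sum_pd_inl_cartanLow_mid hU hF ν l b hT, Finset.mul_sum]
    exact Finset.sum_congr rfl fun _ _ => by ring
  have e3 : ∑ μ, christoffelLow F l μ b T * T (Sum.inr μ)
      = ∑ ν, christoffelLow F l b ν T * T (Sum.inr ν) :=
    Finset.sum_congr rfl fun μ _ => by rw [christoffelLow_swap hU hF l μ b hT]
  have e4 : ∑ μ, 2 * cartanLow F l μ b T * spray F μ T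
      = 2 * ∑ ε, cartanLow F l b ε T * spray F ε T := by
    rw [Finset.mul_sum]
    exact Finset.sum_congr rfl fun μ _ => by rw [cartanLow_swap_right hU hF l μ b hT]; ring
  rw [e2, e3, e4] at h
  have h5 := lower_cartanN hU hF l b hT
  have e5 : ∑ μ, metric F l μ T * (2 * cartanN F μ b T)
      = 2 * ∑ μ, metric F l μ T * cartanN F μ b T := by
    rw [Finset.mul_sum]
    exact Finset.sum_congr rfl fun μ _ => by ring
  rw [e5, h5]
  simp only [Finset.sum_ite_eq', Finset.mem_univ, if_true] at h
  linarith

/-- Because N contracts with s to the spray, s^μ δ/δt^μ is the spray vector field. -/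
lemma sum_deltaT (f : (TIdx p → ℝ) → ℝ) {T : TIdx p → ℝ} (hT : T ∈ slit U) :
    ∑ μ, deltaT F μ f T * T (Sum.inr μ) = fderiv ℝ f T (sprayVec F T) := by
  rw [fderiv_eq_sum_pd, Fintype.sum_sum_type]
  simp only [deltaT, sprayVec, Sum.elim_inl, Sum.elim_inr, sub_mul, Finset.sum_sub_distrib,
    Finset.sum_mul, neg_mul, Finset.sum_neg_distrib, ← cartanN_contract hU hF _ hT]
  rw [Finset.sum_comm (γ := Fin p), ← sub_eq_add_neg]
  congr 1
  · exact Finset.sum_congr rfl fun _ _ => by ring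
  · exact Finset.sum_congr rfl fun _ _ => Finset.sum_congr rfl fun _ _ => by ring

/-- Fibre derivative of `lower_cartanN`. By the symmetry of the fibre derivatives of the Cartan
tensor, its t- and s-derivatives combine into one derivative along the spray. -/
lemma lower_pd_inr_cartanN (β α b : Fin p) {T : TIdx p → ℝ} (hT : T ∈ slit U) :
    ∑ l, metric F β l T * pd (Sum.inr b) (cartanN F l α) T
      = christoffelLow F β α b T + fderiv ℝ (cartanLow F β α b) T (sprayVec F T)
        - 2 * ∑ ν, cartanLow F β α ν T * cartanN F ν b T
        - 2 * ∑ ν, cartanLow F β ν b T * cartanN F ν α T := by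
  have hO := isOpen_slit hU
  have hg := fun α β => contDiffOn_differentiableAt hO (contDiffOn_metric hU hF α β) hT
  have hs := fun α => contDiffOn_differentiableAt hO (contDiffOn_spray hU hF α) hT
  have hN := fun α β => contDiffOn_differentiableAt hO (contDiffOn_cartanN hU hF α β) hT
  have hC := fun α β γ => contDiffOn_differentiableAt hO (contDiffOn_cartanLow hU hF α β γ) hT
  have hc := fun α β γ => contDiffOn_differentiableAt hO (contDiffOn_christoffelLow hU hF α β γ) hT
  have hx := fun i : TIdx p => differentiableAt_coord (u := T) i
  have h := pd_congr_on (Sum.inr b) hO hT fun w hw => lower_cartanN hU hF β α hw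
  rw [pd_sum _ fun μ _ => (hg _ _).fun_mul (hN _ _),
    pd_sub _ (DifferentiableAt.fun_sum fun ν _ => (hc _ _ _).fun_mul (hx _))
      (DifferentiableAt.fun_sum fun ν _ => (hC _ _ _).fun_mul (hs _)),
    pd_sum _ fun μ _ => (hc _ _ _).fun_mul (hx _), pd_sum _ fun μ _ => (hC _ _ _).fun_mul (hs _)] at h
  simp only [pd_mul _ (hg _ _) (hN _ _), pd_mul _ (hc _ _ _) (hx _), pd_mul _ (hC _ _ _) (hs _),
    pd_inr_metric, pd_coord, Sum.inr.injEq, Finset.sum_add_distrib, mul_ite, mul_one, mul_zero,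
    Finset.sum_ite_eq', Finset.mem_univ, if_true, sum_pd_inr_christoffelLow hU hF _ _ _ hT,
    pd_inr_spray hU hF _ _ hT] at h
  have e1 : fderiv ℝ (cartanLow F β α b) T (sprayVec F T)
      = ∑ ν, pd (Sum.inl ν) (cartanLow F β α b) T * T (Sum.inr ν)
        - ∑ ν, pd (Sum.inr b) (cartanLow F β α ν) T * spray F ν T := by
    rw [fderiv_eq_sum_pd, Fintype.sum_sum_type]
    simp only [sprayVec, Sum.elim_inl, Sum.elim_inr, neg_mul, Finset.sum_neg_distrib,
      ← sub_eq_add_neg]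
    congr 1
    · exact Finset.sum_congr rfl fun _ _ => by ring
    · exact Finset.sum_congr rfl fun ν _ => by rw [pd_inr_cartanLow_swap hU hF _ _ b ν hT]; ring
  have e2 : ∑ ν, cartanLow F β α ν T * (2 * cartanN F ν b T)
      = 2 * ∑ ν, cartanLow F β α ν T * cartanN F ν b T := by
    rw [Finset.mul_sum]
    exact Finset.sum_congr rfl fun μ _ => by ring
  have e3 : ∑ ν, 2 * cartanLow F β ν b T * cartanN F ν α T
      = 2 * ∑ ν, cartanLow F β ν b T * cartanN F ν α T := by
    rw [Finset.mul_sum]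
    exact Finset.sum_congr rfl fun μ _ => by ring
  rw [e2, e3] at h
  rw [e1]
  linarith

lemma deltaT_metric (μ α β : Fin p) (T : TIdx p → ℝ) :
    deltaT F μ (metric F α β) T = pd (Sum.inl μ) (metric F α β) T
      - 2 * ∑ ν, cartanLow F α β ν T * cartanN F ν μ T := by
  simp only [deltaT, pd_inr_metric, Finset.mul_sum]
  congr 1
  exact Finset.sum_congr rfl fun μ _ => by ring

lemma lower_chern (β α b : Fin p) {T : TIdx p → ℝ} (hT : T ∈ slit U) :
    ∑ γ, metric F β γ T * chern F γ α b T
      = christoffelLow F β α b T - ∑ ν, cartanLow F β α ν T * cartanN F ν b T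
        - ∑ ν, cartanLow F β b ν T * cartanN F ν α T
        + ∑ ν, cartanLow F α b ν T * cartanN F ν β T := by
  have h : ∀ γ, chern F γ α b T = ∑ μ, metricInv F γ μ T * ((1 / 2) *
      (deltaT F b (metric F μ α) T + deltaT F α (metric F μ b) T
      - deltaT F μ (metric F α b) T)) := by
    intro γ
    rw [chern]
    exact Finset.sum_congr rfl fun _ _ => by ring
  simp only [h]
  rw [lower_raise hU hF (fun μ => (1 / 2) *
      (deltaT F b (metric F μ α) T + deltaT F α (metric F μ b) T
      - deltaT F μ (metric F α b) T)) β hT]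
  simp only [deltaT_metric hU hF, christoffelLow]
  ring

lemma sum_cartanLow_cartanN_contract (α β : Fin p) {T : TIdx p → ℝ} (hT : T ∈ slit U) :
    ∑ μ, (∑ ν, cartanLow F α β ν T * cartanN F ν μ T) * T (Sum.inr μ)
      = ∑ ν, cartanLow F α β ν T * spray F ν T := by
  simp only [← cartanN_contract hU hF _ hT, Finset.sum_mul, Finset.mul_sum]
  rw [Finset.sum_comm]
  exact Finset.sum_congr rfl fun _ _ => Finset.sum_congr rfl fun _ _ => by ring

lemma sum_cartanLow_mid (α γ : Fin p) {T : TIdx p → ℝ} (hT : T ∈ slit U) :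
    ∑ β, cartanLow F α β γ T * T (Sum.inr β) = 0 := by
  rw [← sum_cartanLow hU hF α γ hT]
  exact Finset.sum_congr rfl fun _ _ => by rw [cartanLow_swap_right hU hF _ _ _ hT]

lemma sum_cartanLow_mid_mul (α : Fin p) (x : Fin p → ℝ) {T : TIdx p → ℝ} (hT : T ∈ slit U) :
    ∑ μ, (∑ ν, cartanLow F α μ ν T * x ν) * T (Sum.inr μ) = 0 := by
  simp only [Finset.sum_mul]
  rw [Finset.sum_comm]
  refine Finset.sum_eq_zero fun ν _ => ?_
  rw [← mul_zero (x ν), ← sum_cartanLow_mid hU hF α ν hT, Finset.mul_sum]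
  exact Finset.sum_congr rfl fun _ _ => by ring

/-- After lowering, the Cartan terms that carry the contracted index vanish by Euler's identity; the
remaining one sees N only through its contraction, the spray. -/
lemma chern_contract (ε α : Fin p) {T : TIdx p → ℝ} (hT : T ∈ slit U) :
    ∑ μ, chern F ε α μ T * T (Sum.inr μ) = cartanN F ε α T := by
  refine congrFun (eq_of_lower_eq hU hF (x := fun ε => ∑ μ, chern F ε α μ T * T (Sum.inr μ))
    (y := fun ε => cartanN F ε α T) hT fun l => ?_) ε
  rw [lower_cartanN hU hF l α hT]
  have e : ∑ ε, metric F l ε T * ∑ μ, chern F ε α μ T * T (Sum.inr μ)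
      = ∑ μ, (∑ ε, metric F l ε T * chern F ε α μ T) * T (Sum.inr μ) := by
    simp only [Finset.sum_mul, Finset.mul_sum]
    rw [Finset.sum_comm]
    exact Finset.sum_congr rfl fun _ _ => Finset.sum_congr rfl fun _ _ => by ring
  simp only [e, lower_chern hU hF _ _ _ hT, add_mul, sub_mul, Finset.sum_add_distrib,
    Finset.sum_sub_distrib, sum_cartanLow_cartanN_contract hU hF _ _ hT,
    sum_cartanLow_mid_mul hU hF _ _ hT]
  ring

/-- The metric is parallel along the spray. -/
lemma fderiv_metric_sprayVec (β γ : Fin p) {T : TIdx p → ℝ} (hT : T ∈ slit U) :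
    fderiv ℝ (metric F β γ) T (sprayVec F T)
      = ∑ l, metric F β l T * cartanN F l γ T + ∑ l, metric F γ l T * cartanN F l β T := by
  rw [lower_cartanN hU hF _ _ hT, lower_cartanN hU hF _ _ hT, fderiv_eq_sum_pd,
    Fintype.sum_sum_type]
  simp only [sprayVec, Sum.elim_inl, Sum.elim_inr, pd_inr_metric]
  have e1 : ∑ ε, cartanLow F γ β ε T * spray F ε T = ∑ ε, cartanLow F β γ ε T * spray F ε T :=
    Finset.sum_congr rfl fun _ _ => by rw [cartanLow_swap_left hU hF _ _ _ hT]
  have e2 : ∑ ε, -spray F ε T * (2 * cartanLow F β γ ε T)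
      = - 2 * ∑ ε, cartanLow F β γ ε T * spray F ε T := by
    rw [Finset.mul_sum]
    exact Finset.sum_congr rfl fun μ _ => by ring
  have e3 : ∑ ε, christoffelLow F β γ ε T * T (Sum.inr ε)
      + ∑ ε, christoffelLow F γ β ε T * T (Sum.inr ε)
      = ∑ ε, T (Sum.inr ε) * pd (Sum.inl ε) (metric F β γ) T := by
    rw [← Finset.sum_add_distrib]
    refine Finset.sum_congr rfl fun ε _ => ?_
    have := pd_congr_on (Sum.inl ε) (isOpen_slit hU) hT fun w hw => metric_symm hU hF γ β hw
    rw [christoffelLow, christoffelLow, this]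
    ring
  rw [e1, e2, ← e3]
  ring

lemma cartanCov_contract (γ α β : Fin p) {T : TIdx p → ℝ} (hT : T ∈ slit U) :
    ∑ μ, cartanCov F γ α β μ T * T (Sum.inr μ)
      = fderiv ℝ (cartan F γ α β) T (sprayVec F T)
        + ∑ ε, cartan F ε α β T * cartanN F γ ε T
        - ∑ ε, cartan F γ ε β T * cartanN F ε α T
        - ∑ ε, cartan F γ α ε T * cartanN F ε β T := by
  have e : ∀ (x : Fin p → ℝ) (y : Fin p → Fin p → ℝ),
      ∑ μ, (∑ ε, x ε * y ε μ) * T (Sum.inr μ) = ∑ ε, x ε * ∑ μ, y ε μ * T (Sum.inr μ) := by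
    intro x y
    simp only [Finset.sum_mul, Finset.mul_sum]
    rw [Finset.sum_comm]
    exact Finset.sum_congr rfl fun _ _ => Finset.sum_congr rfl fun _ _ => by ring
  simp only [cartanCov, add_mul, sub_mul, Finset.sum_add_distrib, Finset.sum_sub_distrib,
    sum_deltaT hU hF _ hT]
  simp only [e (fun ε => cartan F ε α β T) (fun ε μ => chern F γ ε μ T),
    e (fun ε => cartan F γ ε β T) (fun ε μ => chern F ε α μ T),
    e (fun ε => cartan F γ α ε T) (fun ε μ => chern F ε β μ T), chern_contract hU hF _ _ hT]

/-- Product rule for the lowering of the Cartan tensor; the price is a derivative of the metric,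
which `fderiv_metric_sprayVec` evaluates when v is the spray vector. -/
lemma lower_fderiv_cartan (l α β : Fin p) (v : TIdx p → ℝ) {T : TIdx p → ℝ} (hT : T ∈ slit U) :
    ∑ γ, metric F l γ T * fderiv ℝ (cartan F γ α β) T v
      = fderiv ℝ (cartanLow F l α β) T v
        - ∑ γ, fderiv ℝ (metric F l γ) T v * cartan F γ α β T := by
  have hO := isOpen_slit hU
  have hg := fun α β => contDiffOn_differentiableAt hO (contDiffOn_metric hU hF α β) hT
  have hc := fun α β γ => contDiffOn_differentiableAt hO (contDiffOn_cartan hU hF α β γ) hT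
  have h : (fun T => ∑ γ, metric F l γ T * cartan F γ α β T) =ᶠ[𝓝 T] cartanLow F l α β :=
    Filter.eventuallyEq_of_mem (hO.mem_nhds hT) fun w hw => lower_cartan hU hF l α β hw
  rw [← h.fderiv_eq, fderiv_fun_sum fun γ _ => (hg _ _).fun_mul (hc _ _ _)]
  simp only [fderiv_fun_mul (hg _ _) (hc _ _ _), _root_.sum_apply,
    _root_.add_apply, _root_.smul_apply, smul_eq_mul,
    Finset.sum_add_distrib]
  rw [add_sub_assoc, left_eq_add, sub_eq_zero]
  exact Finset.sum_congr rfl fun _ _ => by ring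

/-- The Berwald coefficients are the fibre derivatives of the nonlinear Cartan connection. -/
lemma pd_inr_cartanN (a α b : Fin p) {T : TIdx p → ℝ} (hT : T ∈ slit U) :
    pd (Sum.inr b) (cartanN F a α) T = berwald F a α b T := by
  refine congrFun (eq_of_lower_eq hU hF (x := fun a => pd (Sum.inr b) (cartanN F a α) T)
    (y := fun a => berwald F a α b T) hT fun l => ?_) a
  rw [lower_pd_inr_cartanN hU hF _ _ _ hT]
  -- Both lowered sides now consist of the first-kind symbol, the derivative of the Cartan tensor
  -- along the spray, and products of that tensor with N; the rest of the proof matches these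
  -- products.
  simp only [berwald, cartanCov_contract hU hF _ _ _ hT, mul_add, mul_sub, Finset.sum_add_distrib,
    Finset.sum_sub_distrib, lower_chern hU hF _ _ _ hT, lower_fderiv_cartan hU hF _ _ _ _ hT,
    fderiv_metric_sprayVec hU hF _ _ hT, add_mul]
  have low : ∀ (x : Fin p → Fin p → ℝ) (y : Fin p → ℝ),
      ∑ γ, metric F l γ T * ∑ ε, x γ ε * y ε = ∑ ε, (∑ γ, metric F l γ T * x γ ε) * y ε := by
    intro x y
    simp only [Finset.sum_mul, Finset.mul_sum]
    rw [Finset.sum_comm]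
    exact Finset.sum_congr rfl fun _ _ => Finset.sum_congr rfl fun _ _ => by ring
  have e1 := low (fun γ ε => cartan F γ ε b T) (fun ε => cartanN F ε α T)
  have e2 := low (fun γ ε => cartan F γ α ε T) (fun ε => cartanN F ε b T)
  simp only [lower_cartan hU hF _ _ _ hT] at e1 e2
  have e3 : ∑ γ, metric F l γ T * ∑ ε, cartan F ε α b T * cartanN F γ ε T
      = ∑ ε, (∑ γ, metric F l γ T * cartanN F γ ε T) * cartan F ε α b T := by
    rw [← low]
    exact Finset.sum_congr rfl fun _ _ => by
      congr 1; exact Finset.sum_congr rfl fun _ _ => by ring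
  have e4 : ∑ γ, (∑ ν, metric F γ ν T * cartanN F ν l T) * cartan F γ α b T
      = ∑ ν, cartanLow F α b ν T * cartanN F ν l T := by
    simp only [Finset.sum_mul]
    rw [Finset.sum_comm]
    refine Finset.sum_congr rfl fun ν _ => ?_
    rw [cartanLow_swap_right hU hF _ _ _ hT, cartanLow_swap_left hU hF _ _ _ hT,
      cartanLow_swap_right hU hF _ _ _ hT,
      ← cartanLow_swap_right hU hF _ _ _ hT, ← lower_cartan hU hF _ _ _ hT, Finset.sum_mul]
    refine Finset.sum_congr rfl fun γ _ => ?_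
    rw [metric_symm hU hF ν γ hT]; ring
  have e5 : ∑ ν, cartanLow F l b ν T * cartanN F ν α T
      = ∑ ν, cartanLow F l ν b T * cartanN F ν α T :=
    Finset.sum_congr rfl fun _ _ => by rw [cartanLow_swap_right hU hF _ _ _ hT]
  rw [e1, e2, e3, e4, e5]
  ring

/-- N is a fibre gradient by `pd_inr_spray`, so its fibre derivatives commute as second derivatives
of half the spray. -/
lemma pd_inr_cartanN_swap (a α b : Fin p) {T : TIdx p → ℝ} (hT : T ∈ slit U) :
    pd (Sum.inr b) (cartanN F a α) T = pd (Sum.inr α) (cartanN F a b) T := by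
  have hO := isOpen_slit hU
  have h : ∀ b, ∀ w ∈ slit U, cartanN F a b w = (1 / 2) * pd (Sum.inr b) (spray F a) w := by
    intro b w hw
    rw [pd_inr_spray hU hF a b hw]; ring
  have hd := fun b : Fin p => contDiffOn_differentiableAt hO
    (contDiffOn_pd (Sum.inr b) hO (contDiffOn_spray hU hF a)) hT
  rw [pd_congr_on _ hO hT (h α), pd_congr_on _ hO hT (h b), pd_const_mul _ _ (hd _),
    pd_const_mul _ _ (hd _), pd_comm _ _ hO (contDiffOn_spray hU hF a) hT]

lemma berwald_symm (a α b : Fin p) {T : TIdx p → ℝ} (hT : T ∈ slit U) :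
    berwald F a α b T = berwald F a b α T := by
  rw [← pd_inr_cartanN hU hF _ _ _ hT, ← pd_inr_cartanN hU hF _ _ _ hT,
    pd_inr_cartanN_swap hU hF _ _ _ hT]

lemma berwaldP_swap_left (a α b c : Fin p) {T : TIdx p → ℝ} (hT : T ∈ slit U) :
    berwaldP F a α b c T = berwaldP F a b α c T :=
  pd_congr_on _ (isOpen_slit hU) hT fun _ hw => berwald_symm hU hF a α b hw

/-- P is a second fibre derivative of N. With `berwaldP_swap_left` it is symmetric in all lower
indices, which relates (T5) to (T6) and (T8) to (T9) and removes the components with two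
s-directions. -/
lemma berwaldP_swap_right (a α b c : Fin p) {T : TIdx p → ℝ} (hT : T ∈ slit U) :
    berwaldP F a α b c T = berwaldP F a α c b T := by
  have hO := isOpen_slit hU
  have h : ∀ b c, berwaldP F a α b c T = pd (Sum.inr c) (pd (Sum.inr b) (cartanN F a α)) T :=
    fun b c => pd_congr_on _ hO hT fun _ hw => (pd_inr_cartanN hU hF a α b hw).symm
  rw [h, h, pd_comm _ _ hO (contDiffOn_cartanN hU hF a α) hT]

end FinslerIdentities

/-! ### Torsion in sheared coordinate frames -/

section Frames

variable {ι : Type} [Fintype ι] [DecidableEq ι]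

/-- The frame `E` is obtained from the coordinate frame by subtracting, from the coordinate fields of
one group, combinations `A` of the coordinate fields of a complementary group. -/
structure IsShearFrame (E : ι → (ι → ℝ) → (ι → ℝ)) (A : ι → ι → (ι → ℝ) → ℝ) : Prop where
  apply : ∀ c w i, E c w i = (if i = c then 1 else 0) - A i c w
  split : ∀ d, (∀ c, A c d = 0) ∨ (∀ a, A d a = 0)

namespace IsShearFrame

variable {E : ι → (ι → ℝ) → (ι → ℝ)} {A : ι → ι → (ι → ℝ) → ℝ} (hE : IsShearFrame E A)
include hE

/-- By `split` no index is both a source and a target of the shear. Hence the shear matrix squares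
to zero and 1 + A inverts the frame matrix 1 - A. -/
lemma frameCoord_eq (u v : ι → ℝ) (c : ι) :
    frameCoord E u v c = v c + ∑ d, A c d u * v d := by
  set N : Matrix ι ι ℝ := Matrix.of fun i c => A i c u with hN
  have hM : (Matrix.of fun i c => E c u i) = 1 - N := by
    ext i c
    simp [hN, hE.apply, Matrix.one_apply]
  have hNN : N * N = 0 := by
    ext i k
    rw [Matrix.mul_apply]
    refine Finset.sum_eq_zero fun j _ => ?_
    rcases hE.split j with h | h <;> simp [hN, h]
  have hinv : (1 - N)⁻¹ = 1 + N := by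
    refine Matrix.inv_eq_right_inv ?_
    rw [sub_mul, one_mul, mul_add, mul_one, hNN, add_zero, add_sub_cancel_right]
  rw [frameCoord, hM, hinv, Matrix.add_mulVec, Matrix.one_mulVec]
  rfl

lemma frameCoord_coordField (u : ι → ℝ) (a c : ι) (w : ι → ℝ) :
    frameCoord E u (coordField a w) c = (if c = a then 1 else 0) + A c a u := by
  rw [hE.frameCoord_eq]
  simp [coordField, Pi.single_apply]

lemma frameCoord_self (u : ι → ℝ) (a c : ι) :
    frameCoord E u (E a u) c = if c = a then 1 else 0 := by
  rw [hE.frameCoord_eq]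
  simp only [hE.apply, mul_sub, Finset.sum_sub_distrib, mul_ite, mul_one, mul_zero,
    Finset.sum_ite_eq', Finset.mem_univ, if_true]
  rw [Finset.sum_eq_zero (f := fun d => A c d u * A d a u)]
  · ring
  · intro d _
    rcases hE.split d with h | h <;> simp [h]

/-- A frame field has constant components in its own frame, so the derivative term of the connection
drops out. -/
lemma frameConn_self (Γ : ι → ι → ι → (ι → ℝ) → ℝ) (a b : ι) (u : ι → ℝ) :
    frameConn E Γ (E b) (E a) u = ∑ c, Γ c a b u • E c u := by
  simp only [frameConn, hE.frameCoord_self]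
  refine Finset.sum_congr rfl fun c _ => ?_
  simp

lemma frameCoord_sum_smul (u x : ι → ℝ) (c : ι) :
    frameCoord E u (∑ d, x d • E d u) c = x c := by
  have h := congrFun (Matrix.mulVec_sum (Matrix.of fun i c => E c u i)⁻¹ Finset.univ
    fun d => x d • E d u) c
  rw [frameCoord, h, Finset.sum_apply]
  have : ∀ d, ((Matrix.of fun i c => E c u i)⁻¹.mulVec (x d • E d u)) c
      = x d * frameCoord E u (E d u) c := by
    intro d
    rw [Matrix.mulVec_smul]; rfl
  simp [this, hE.frameCoord_self]

lemma fderiv_frame {u : ι → ℝ} {a : ι} (hA : ∀ i, DifferentiableAt ℝ (A i a) u) (v : ι → ℝ)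
    (i : ι) : fderiv ℝ (E a) u v i = -fderiv ℝ (A i a) u v := by
  have h : E a = fun w i => (if i = a then 1 else 0) - A i a w := by
    funext w i; exact hE.apply a w i
  rw [h, fderiv_pi (fun i => (differentiableAt_const _).fun_sub (hA i))]
  simp only [ContinuousLinearMap.coe_pi', fderiv_const_sub]
  rfl

/-- The torsion components of a connection in a shear frame. -/
lemma frameCoord_frameTorsion (Γ : ι → ι → ι → (ι → ℝ) → ℝ) (a b c : ι) {u : ι → ℝ}
    (ha : ∀ i, DifferentiableAt ℝ (A i a) u) (hb : ∀ i, DifferentiableAt ℝ (A i b) u) :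
    frameCoord E u (frameTorsion E Γ (E b) (E a) u) c
      = Γ c a b u - Γ c b a u + fderiv ℝ (A c a) u (E b u) - fderiv ℝ (A c b) u (E a u) := by
  have hsub : ∀ v w : ι → ℝ, frameCoord E u (v - w) c = frameCoord E u v c - frameCoord E u w c := by
    intro v w
    simp only [frameCoord, Matrix.mulVec_sub, Pi.sub_apply]
  -- Derivatives of frame fields point only in target directions of the shear, on which passing to
  -- frame components changes nothing.
  have hvert : ∀ (a b : ι), (∀ i, DifferentiableAt ℝ (A i a) u) →
      frameCoord E u (fderiv ℝ (E a) u (E b u)) c = -fderiv ℝ (A c a) u (E b u) := by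
    intro a b ha
    rw [hE.frameCoord_eq, Finset.sum_eq_zero, add_zero, hE.fderiv_frame ha]
    intro d _
    rw [hE.fderiv_frame ha]
    rcases hE.split d with h | h <;> simp [h]
  rw [frameTorsion, hE.frameConn_self, hE.frameConn_self, VectorField.lieBracket, hsub, hsub, hsub,
    hE.frameCoord_sum_smul u (fun c => Γ c a b u), hE.frameCoord_sum_smul u (fun c => Γ c b a u),
    hvert _ _ ha, hvert _ _ hb]
  ring

lemma fderiv_apply_frame (f : (ι → ℝ) → ℝ) (b : ι) (u : ι → ℝ) :
    fderiv ℝ f u (E b u) = pd b f u - ∑ d, A d b u * pd d f u := by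
  rw [fderiv_eq_sum_pd]
  simp [hE.apply, sub_mul, Finset.sum_sub_distrib]

end IsShearFrame

/-- The torsion is skew-symmetric. -/
lemma frameTorsion_swap (E : ι → (ι → ℝ) → (ι → ℝ)) (Γ : ι → ι → ι → (ι → ℝ) → ℝ)
    (X Y : (ι → ℝ) → (ι → ℝ)) (u : ι → ℝ) :
    frameTorsion E Γ X Y u = -frameTorsion E Γ Y X u := by
  rw [frameTorsion, frameTorsion, VectorField.lieBracket, VectorField.lieBracket]
  abel

/-- The chain rule for partial derivatives. -/
lemma pd_comp {κ : Type} [Fintype κ] [DecidableEq κ] (k : ι) {f : (κ → ℝ) → ℝ}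
    {φ : (ι → ℝ) → (κ → ℝ)} {u : ι → ℝ} (hf : DifferentiableAt ℝ f (φ u))
    (hφ : ∀ l, DifferentiableAt ℝ (fun w => φ w l) u) :
    pd k (fun w => f (φ w)) u = ∑ l, pd k (fun w => φ w l) u * pd l f (φ u) := by
  have hφ' : DifferentiableAt ℝ φ u := differentiableAt_pi.2 hφ
  have h := (hf.hasFDerivAt.comp u hφ'.hasFDerivAt).fderiv
  have e : fderiv ℝ (f ∘ φ) u (Pi.single k 1) = fderiv ℝ f (φ u) (fderiv ℝ φ u (Pi.single k 1)) := by
    rw [h]; rfl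
  rw [pd, show (fun w => f (φ w)) = f ∘ φ from rfl, e, fderiv_eq_sum_pd]
  refine Finset.sum_congr rfl fun l _ => ?_
  rw [pd, fderiv_pi (fun i => hφ i)]
  rfl

end Frames

/-! ### Coordinate components of the Berwald connection -/

section NormalComponents

variable {p : ℕ} {U : Set (Fin p → ℝ)} {F : (TIdx p → ℝ) → ℝ}

/-- The shear coefficients of the adapted basis of the slit tangent bundle. -/
def adaptedShear (F : (TIdx p → ℝ) → ℝ) : TIdx p → TIdx p → (TIdx p → ℝ) → ℝ
  | Sum.inr b, Sum.inl α => cartanN F b α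
  | _, _ => 0

lemma isShearFrame_adaptedFrame : IsShearFrame (adaptedFrame F) (adaptedShear F) where
  apply := by
    rintro (α | a) w (i | i) <;>
      simp [adaptedFrame, adaptedShear, coordField, Pi.single_apply, Finset.sum_apply]
  split := by
    rintro (α | a)
    · right; rintro (β | b) <;> rfl
    · left; rintro (β | b) <;> rfl

/-- The coordinate fields have components δ + N in the adapted basis. The sum is kept unevaluated so
that the lemmas below only have to specialise the index types. -/
lemma normalGamma_eq (C A B : TIdx p) (T : TIdx p → ℝ) :
    normalGamma F C A B T = ∑ c, (pd B (adaptedShear F c A) T + ∑ a, ∑ b, berwaldCoef F c a b T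
      * ((if a = A then 1 else 0) + adaptedShear F a A T)
      * ((if b = B then 1 else 0) + adaptedShear F b B T))
      * ((if C = c then 1 else 0) - adaptedShear F C c T) := by
  have hE := isShearFrame_adaptedFrame (F := F)
  simp only [normalGamma, frameConn, hE.frameCoord_coordField, Finset.sum_apply, Pi.smul_apply,
    smul_eq_mul, hE.apply, fderiv_const_add]
  rfl

lemma normalGamma_inl_inl_inl (γ α β : Fin p) (T : TIdx p → ℝ) :
    normalGamma F (Sum.inl γ) (Sum.inl α) (Sum.inl β) T = berwald F γ α β T := by
  simp [normalGamma_eq, Fintype.sum_sum_type, adaptedShear, berwaldCoef, pd]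

lemma normalGamma_inl_inr (γ a : Fin p) (B : TIdx p) (T : TIdx p → ℝ) :
    normalGamma F (Sum.inl γ) (Sum.inr a) B T = 0 := by
  simp [normalGamma_eq, Fintype.sum_sum_type, adaptedShear, berwaldCoef, pd]

lemma normalGamma_inl_inr_right (γ b : Fin p) (A : TIdx p) (T : TIdx p → ℝ) :
    normalGamma F (Sum.inl γ) A (Sum.inr b) T = 0 := by
  simp [normalGamma_eq, adaptedShear, berwaldCoef, pd]

lemma normalGamma_inr_inr_inl (c a β : Fin p) (T : TIdx p → ℝ) :
    normalGamma F (Sum.inr c) (Sum.inr a) (Sum.inl β) T = berwald F c a β T := by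
  simp [normalGamma_eq, Fintype.sum_sum_type, adaptedShear, berwaldCoef, pd]

lemma normalGamma_inr_inr_inr (c a b : Fin p) (T : TIdx p → ℝ) :
    normalGamma F (Sum.inr c) (Sum.inr a) (Sum.inr b) T = 0 := by
  simp [normalGamma_eq, adaptedShear, berwaldCoef, pd]

lemma normalGamma_inr_inl_inl (c α β : Fin p) (T : TIdx p → ℝ) :
    normalGamma F (Sum.inr c) (Sum.inl α) (Sum.inl β) T = cartanNcov F c α β T := by
  simp [normalGamma_eq, Fintype.sum_sum_type, adaptedShear, berwaldCoef, cartanNcov, pd, mul_comm]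
  ring

variable (hU : IsOpen U) (hF : IsFinslerOn F U)
include hU hF

/-- The connection itself gives ∂N/∂s here. This is the one normal component whose value needs the
Finsler condition, through `pd_inr_cartanN`. -/
lemma normalGamma_inr_inl_inr (c α b : Fin p) {T : TIdx p → ℝ} (hT : T ∈ slit U) :
    normalGamma F (Sum.inr c) (Sum.inl α) (Sum.inr b) T = berwald F c α b T := by
  rw [← pd_inr_cartanN hU hF c α b hT]
  simp [normalGamma_eq, Fintype.sum_sum_type, adaptedShear, berwaldCoef, pd]

lemma contDiffOn_normalGamma (C A B : TIdx p) :
    ContDiffOn ℝ ∞ (normalGamma F C A B) (slit U) := by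
  rcases C with c | c <;> rcases A with a | a <;> rcases B with b | b
  · exact (contDiffOn_berwald hU hF c a b).congr fun T _ => normalGamma_inl_inl_inl c a b T
  · exact contDiffOn_const.congr fun T _ => normalGamma_inl_inr_right c b _ T
  · exact contDiffOn_const.congr fun T _ => normalGamma_inl_inr c a _ T
  · exact contDiffOn_const.congr fun T _ => normalGamma_inl_inr c a _ T
  · exact (contDiffOn_cartanNcov hU hF c a b).congr fun T _ => normalGamma_inr_inl_inl c a b T
  · exact (contDiffOn_berwald hU hF c a b).congr fun T hT => normalGamma_inr_inl_inr hU hF c a b hT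
  · exact (contDiffOn_berwald hU hF c a b).congr fun T _ => normalGamma_inr_inr_inl c a b T
  · exact contDiffOn_const.congr fun T _ => normalGamma_inr_inr_inr c a b T

end NormalComponents

/-! ### Torsion of the jet connection in terms of the normal components -/

section JetTorsion

variable {p n : ℕ} {U : Set (Fin p → ℝ)} {V : Set (Fin n → ℝ)}
  {F : (TIdx p → ℝ) → ℝ} {F' : (TIdx n → ℝ) → ℝ}

/-- The shear coefficients of the jet adapted basis. -/
def jetShear (F : (TIdx p → ℝ) → ℝ) (F' : (TIdx n → ℝ) → ℝ) :
    JIdx p n → JIdx p n → (JIdx p n → ℝ) → ℝ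
  | Sum.inr (Sum.inr (j, B)), Sum.inl A => jetM F j B A
  | Sum.inr (Sum.inr (j, B)), Sum.inr (Sum.inl i) => jetN F' j B i
  | _, _ => 0

lemma sum_coordField_apply (M : Fin n → TIdx p → ℝ) (z : JIdx p n → ℝ) (i : JIdx p n) :
    (∑ j, ∑ B, M j B • coordField (jX j B) z) i
      = match i with
        | Sum.inr (Sum.inr (j, B)) => M j B
        | _ => 0 := by
  rw [← Fintype.sum_prod_type' (f := fun j B => M j B • coordField (jX (n := n) j B) z),
    Finset.sum_apply]
  rcases i with A | i | ⟨j, B⟩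
  · simp [coordField]
  · simp [coordField]
  · simp [coordField, Pi.single_apply]

lemma isShearFrame_jetFrame : IsShearFrame (jetFrame F F') (jetShear F F') where
  apply := by
    rintro (A | i | ⟨i, A⟩) w k
    · simp only [jetFrame, Pi.sub_apply, sum_coordField_apply fun j B => jetM F j B A w]
      rcases k with C | k | ⟨k, C⟩ <;> simp [coordField, jetShear, Pi.single_apply]
    · simp only [jetFrame, Pi.sub_apply, sum_coordField_apply fun j B => jetN F' j B i w]
      rcases k with C | k | ⟨k, C⟩ <;> simp [coordField, jetShear, Pi.single_apply]
    · rcases k with C | k | ⟨k, C⟩ <;> simp [jetFrame, coordField, jetShear, Pi.single_apply]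
  split := by
    rintro (A | i | ⟨i, A⟩)
    · right; rintro (A | i | ⟨i, A⟩) <;> rfl
    · right; rintro (A | i | ⟨i, A⟩) <;> rfl
    · left; rintro (A | i | ⟨i, A⟩) <;> rfl

lemma sum_jetShear_mul (b : JIdx p n) (z : JIdx p n → ℝ) (x : JIdx p n → ℝ) :
    ∑ d, jetShear F F' d b z * x d
      = ∑ j, ∑ B, jetShear F F' (jX j B) b z * x (jX j B) := by
  have h1 : ∀ A, jetShear F F' (Sum.inl A) b = 0 := fun A => by
    rcases b with B | i | ⟨i, B⟩ <;> rfl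
  have h2 : ∀ i, jetShear F F' (Sum.inr (Sum.inl i)) b = 0 := fun A => by
    rcases b with B | i | ⟨i, B⟩ <;> rfl
  rw [Fintype.sum_sum_type]
  simp only [h1, Pi.zero_apply, zero_mul, Finset.sum_const_zero, zero_add]
  rw [Fintype.sum_sum_type, Fintype.sum_prod_type]
  simp only [h2, Pi.zero_apply, zero_mul, Finset.sum_const_zero, zero_add]

lemma dTorsion_swap (c a b : JIdx p n) (z : JIdx p n → ℝ) :
    dTorsion F F' c b a z = -dTorsion F F' c a b z := by
  rw [dTorsion, dTorsion, frameTorsion_swap]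
  simp only [frameCoord, Matrix.mulVec_neg, Pi.neg_apply]

lemma differentiableAt_target (l : TIdx n) (z : JIdx p n → ℝ) :
    DifferentiableAt ℝ (fun z : JIdx p n → ℝ => target z l) z := by
  rcases l with l | l
  · exact differentiableAt_coord _
  · have h : ∀ a ∈ Finset.univ, DifferentiableAt ℝ (fun z : JIdx p n → ℝ => z (jy l a) * z (js a)) z :=
      fun a _ => (differentiableAt_coord _).fun_mul (differentiableAt_coord _)
    exact DifferentiableAt.fun_sum h

lemma pd_target_inl (k : JIdx p n) (l : Fin n) (z : JIdx p n → ℝ) :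
    pd k (fun z => target z (Sum.inl l)) z = if jx l = k then 1 else 0 := pd_coord _ _

lemma pd_target_inr (k : JIdx p n) (l : Fin n) (z : JIdx p n → ℝ) :
    pd k (fun z => target z (Sum.inr l)) z = ∑ a, ((if jy l a = k then z (js a) else 0)
      + (if js a = k then z (jy l a) else 0)) := by
  have : (fun z : JIdx p n → ℝ => target z (Sum.inr l)) = fun z => ∑ a, z (jy l a) * z (js a) := rfl
  rw [this, pd_sum _ fun a _ => (differentiableAt_coord _).fun_mul (differentiableAt_coord _)]
  refine Finset.sum_congr rfl fun a _ => ?_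
  rw [pd_mul _ (differentiableAt_coord _) (differentiableAt_coord _), pd_coord, pd_coord]
  simp only [ite_mul, one_mul, zero_mul, mul_ite, mul_one, mul_zero]

/-- The derivative of `y^l_a s^a` by `X^l_B`. -/
def fibreWeight (z : JIdx p n → ℝ) (B : TIdx p) : ℝ := Sum.elim (fun _ => 0) (fun b => z (js b)) B

variable {z : JIdx p n → ℝ} {f : (TIdx p → ℝ) → ℝ} {h : (TIdx n → ℝ) → ℝ}

lemma differentiableAt_comp_source (hf : DifferentiableAt ℝ f (source z)) :
    DifferentiableAt ℝ (fun z => f (source z)) z :=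
  hf.comp z (differentiableAt_pi.2 fun A => differentiableAt_coord (jT A))

lemma differentiableAt_comp_target (hh : DifferentiableAt ℝ h (target z)) :
    DifferentiableAt ℝ (fun z : JIdx p n → ℝ => h (target z)) z :=
  hh.comp z (differentiableAt_pi.2 fun l => differentiableAt_target l z)

lemma pd_comp_source (k : JIdx p n) (hf : DifferentiableAt ℝ f (source z)) :
    pd k (fun z => f (source z)) z
      = match k with
        | Sum.inl A => pd A f (source z)
        | _ => 0 := by
  rw [pd_comp k hf fun A => differentiableAt_coord (jT A)]
  have : ∀ A, pd k (fun z : JIdx p n → ℝ => source z A) z = if jT A = k then 1 else 0 :=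
    fun A => pd_coord _ _
  simp only [this]
  rcases k with A | i | ⟨i, A⟩ <;> simp

/-- The base point (x, y_a s^a) is independent of t and of x_α and bilinear in y and s. Every P̃ in
the torsion arises from this chain rule. -/
lemma pd_comp_target (k : JIdx p n) (hh : DifferentiableAt ℝ h (target z)) :
    pd k (fun z : JIdx p n → ℝ => h (target z)) z
      = match k with
        | Sum.inl (Sum.inl _) => 0
        | Sum.inl (Sum.inr a) => ∑ l, z (jy l a) * pd (Sum.inr l) h (target z)
        | Sum.inr (Sum.inl i) => pd (Sum.inl i) h (target z)
        | Sum.inr (Sum.inr (j, B)) => fibreWeight z B * pd (Sum.inr j) h (target z) := by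
  rw [pd_comp k hh fun l => differentiableAt_target l z, Fintype.sum_sum_type]
  simp only [pd_target_inl, pd_target_inr]
  rcases k with (α | a) | i | ⟨i, (α | a)⟩ <;>
    simp [fibreWeight, ite_and]

section Derivatives

variable (hΓ : ∀ C A B, DifferentiableAt ℝ (normalGamma F C A B) (source z))
  (hB : ∀ i j k, DifferentiableAt ℝ (berwald F' i j k) (target z))

include hΓ in
lemma pd_jetM (k : JIdx p n) (m : Fin n) (B A : TIdx p) :
    pd k (jetM F m B A) z
      = match k with
        | Sum.inl D => -∑ C, pd D (normalGamma F C A B) (source z) * z (jX m C)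
        | Sum.inr (Sum.inl _) => 0
        | Sum.inr (Sum.inr (j, D)) => if m = j then -normalGamma F D A B (source z) else 0 := by
  have hd := fun C => differentiableAt_comp_source (n := n) (hΓ C A B)
  have e : jetM (n := n) F m B A
      = fun z => (-1) * ∑ C, normalGamma F C A B (source z) * z (jX m C) := by
    funext z; simp [jetM]
  rw [e, pd_const_mul _ _ (DifferentiableAt.fun_sum fun C _ =>
      (hd C).fun_mul (differentiableAt_coord _)),
    pd_sum _ fun C _ => (hd C).fun_mul (differentiableAt_coord _)]
  simp only [pd_mul _ (hd _) (differentiableAt_coord _), pd_coord, pd_comp_source k (hΓ _ A B)]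
  rcases k with D | i | ⟨j, D⟩
  · simp
  · simp
  · by_cases hm : m = j <;> simp [hm]

include hΓ in
lemma differentiableAt_jetM (m : Fin n) (B A : TIdx p) : DifferentiableAt ℝ (jetM F m B A) z :=
  (DifferentiableAt.fun_sum fun C _ =>
    (differentiableAt_comp_source (hΓ C A B)).fun_mul (differentiableAt_coord _)).fun_neg

include hB in
lemma pd_jetN (k : JIdx p n) (m : Fin n) (B : TIdx p) (i : Fin n) :
    pd k (jetN F' m B i) z
      = match k with
        | Sum.inl (Sum.inl _) => 0
        | Sum.inl (Sum.inr a) =>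
            ∑ k, (∑ l, z (jy l a) * berwaldP F' m i k l (target z)) * z (jX k B)
        | Sum.inr (Sum.inl j) => ∑ k, pd (Sum.inl j) (berwald F' m i k) (target z) * z (jX k B)
        | Sum.inr (Sum.inr (j, D)) =>
            fibreWeight z D * ∑ k, berwaldP F' m i k j (target z) * z (jX k B)
              + if B = D then berwald F' m i j (target z) else 0 := by
  have hd := fun k => differentiableAt_comp_target (p := p) (hB m i k)
  have e : jetN (p := p) F' m B i
      = fun z => ∑ k, berwald F' m i k (target z) * z (jX k B) := rfl
  rw [e, pd_sum _ fun C _ => (hd C).fun_mul (differentiableAt_coord _)]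
  simp only [pd_mul _ (hd _) (differentiableAt_coord _), pd_coord, pd_comp_target k (hB m i _)]
  rcases k with (α | a) | i | ⟨j, D⟩
  · simp
  · simp [berwaldP]
  · simp
  · by_cases hD : B = D <;> simp [hD, berwaldP, Finset.mul_sum, mul_assoc, Finset.sum_add_distrib]

include hB in
lemma differentiableAt_jetN (m : Fin n) (B : TIdx p) (i : Fin n) :
    DifferentiableAt ℝ (jetN F' m B i) z :=
  DifferentiableAt.fun_sum fun C _ =>
    (differentiableAt_comp_target (hB m i C)).fun_mul (differentiableAt_coord _)

include hΓ hB

lemma differentiableAt_jetShear (d a : JIdx p n) : DifferentiableAt ℝ (jetShear F F' d a) z := by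
  rcases d with A | i | ⟨i, A⟩ <;> rcases a with B | j | ⟨j, B⟩
  case inr.inr.inl => exact differentiableAt_jetM hΓ i A B
  case inr.inr.inr.inl => exact differentiableAt_jetN hB i A j
  all_goals exact differentiableAt_const 0

lemma dTorsion_eq (c a b : JIdx p n) :
    dTorsion F F' c a b z = jetCoef F F' c a b z - jetCoef F F' c b a z
      + (pd b (jetShear F F' c a) z
        - ∑ j, ∑ B, jetShear F F' (jX j B) b z * pd (jX j B) (jetShear F F' c a) z)
      - (pd a (jetShear F F' c b) z
        - ∑ j, ∑ B, jetShear F F' (jX j B) a z * pd (jX j B) (jetShear F F' c b) z) := by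
  have hE := isShearFrame_jetFrame (F := F) (F' := F')
  have hd := fun a i => differentiableAt_jetShear hΓ hB i a
  rw [dTorsion, hE.frameCoord_frameTorsion _ _ _ _ (hd a) (hd b), hE.fderiv_apply_frame,
    hE.fderiv_apply_frame, sum_jetShear_mul b z fun d => pd d (jetShear F F' c a) z,
    sum_jetShear_mul a z fun d => pd d (jetShear F F' c b) z]

/-- The shear has values in the ∂/∂X directions, so brackets of the basis fields have no δ/δT
component; the same holds for δ/δx below. -/
lemma dTorsion_jT (A : TIdx p) (a b : JIdx p n) :
    dTorsion F F' (jT A) a b z = jetCoef F F' (jT A) a b z - jetCoef F F' (jT A) b a z := by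
  have h : ∀ a, jetShear F F' (jT A) a = fun _ => 0 := by rintro (B | i | ⟨i, B⟩) <;> rfl
  simp [dTorsion_eq hΓ hB, h, pd_const]

lemma dTorsion_jx (i : Fin n) (a b : JIdx p n) :
    dTorsion F F' (jx i) a b z = jetCoef F F' (jx i) a b z - jetCoef F F' (jx i) b a z := by
  have h : ∀ a, jetShear F F' (jx i) a = fun _ => 0 := by rintro (B | i | ⟨i, B⟩) <;> rfl
  simp [dTorsion_eq hΓ hB, h, pd_const]

/-- No connection coefficient contributes. The bracket of two lifts that are linear in X with
coefficients Γ is the curvature of Γ applied to X. -/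
lemma dTorsion_jX_jT_jT (m : Fin n) (B A D : TIdx p) :
    dTorsion F F' (jX m B) (jT A) (jT D) z
      = ∑ C, (pd A (normalGamma F C D B) (source z) - pd D (normalGamma F C A B) (source z)
          + ∑ E, normalGamma F E D B (source z) * normalGamma F C A E (source z)
          - ∑ E, normalGamma F E A B (source z) * normalGamma F C D E (source z))
        * z (jX m C) := by
  have e : ∀ A D, ∑ E, jetM F m E D z * -normalGamma F E A B (source z)
      = ∑ C, (∑ E, normalGamma F E A B (source z) * normalGamma F C D E (source z))
        * z (jX m C) := by
    intro A D
    simp only [jetM, Finset.sum_mul]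
    rw [Finset.sum_comm]
    refine Finset.sum_congr rfl fun E _ => ?_
    rw [neg_mul_neg, Finset.sum_mul]
    exact Finset.sum_congr rfl fun C _ => by ring
  rw [dTorsion_eq hΓ hB]
  simp only [jetCoef, jetShear, pd_jetM hΓ]
  simp only [mul_ite, mul_zero]
  have hs : ∀ A D, ∑ j, ∑ E, (if m = j then jetM F j E D z * -normalGamma F E A B (source z) else 0)
      = ∑ C, (∑ E, normalGamma F E A B (source z) * normalGamma F C D E (source z))
        * z (jX m C) := by
    intro A D
    rw [← e, Finset.sum_comm]
    simp
  rw [hs, hs]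
  simp only [add_mul, sub_mul, Finset.sum_add_distrib, Finset.sum_sub_distrib]
  ring

/-- Γ acts on the lower index of X and B̃ on the upper one. These actions commute, so their products
cancel and only derivatives of B̃ through its base point remain. -/
lemma dTorsion_jX_jT_jx (m j : Fin n) (B A : TIdx p) :
    dTorsion F F' (jX m B) (jT A) (jx j) z
      = -pd (jT A) (jetN F' m B j) z
        + ∑ l, ∑ D, jetM F l D A z * (fibreWeight z D *
          ∑ k, berwaldP F' m j k l (target z) * z (jX k B)) := by
  rw [dTorsion_eq hΓ hB]
  simp only [jetCoef, jetShear, pd_jetM hΓ, mul_ite, mul_zero]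
  have e1 : ∑ i, ∑ D, jetM F i D A z * pd (jX i D) (jetN F' m B j) z
      = ∑ l, ∑ D, jetM F l D A z * (fibreWeight z D *
          ∑ k, berwaldP F' m j k l (target z) * z (jX k B))
        + ∑ l, jetM F l B A z * berwald F' m j l (target z) := by
    rw [← Finset.sum_add_distrib]
    refine Finset.sum_congr rfl fun l _ => ?_
    simp only [pd_jetN hB, mul_add, Finset.sum_add_distrib]
    simp
  have e2 : ∑ i, ∑ E, (if m = i then jetN F' i E j z * -normalGamma F E A B (source z) else 0)
      = ∑ l, jetM F l B A z * berwald F' m j l (target z) := by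
    rw [Finset.sum_comm]
    simp only [Finset.sum_ite_eq, Finset.mem_univ, if_true, jetM, jetN, Finset.sum_mul, neg_mul,
      ← Finset.sum_neg_distrib]
    rw [Finset.sum_comm]
    exact Finset.sum_congr rfl fun _ _ => Finset.sum_congr rfl fun _ _ => by ring
  rw [e1, e2]
  ring

/-- As for two T-directions, the bracket gives the curvature of B̃. The X-derivative now also
reaches the base point of B̃, which produces the second sum. -/
lemma dTorsion_jX_jx_jx (m i j : Fin n) (B : TIdx p) :
    dTorsion F F' (jX m B) (jx i) (jx j) z
      = ∑ k, (pd (Sum.inl j) (berwald F' m i k) (target z)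
            - pd (Sum.inl i) (berwald F' m j k) (target z)
            + ∑ l, berwald F' m j l (target z) * berwald F' l i k (target z)
            - ∑ l, berwald F' m i l (target z) * berwald F' l j k (target z)) * z (jX k B)
        - ∑ k, ∑ q, ∑ a, (∑ l, berwaldP F' m i k l (target z) * berwald F' l j q (target z)
            - ∑ l, berwaldP F' m j k l (target z) * berwald F' l i q (target z))
              * z (jX k B) * z (jy q a) * z (js a) := by
  rw [dTorsion_eq hΓ hB]
  simp only [jetCoef, jetShear]
  have e : ∀ i j, ∑ l, ∑ D, jetN F' l D j z * pd (jX l D) (jetN F' m B i) z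
      = ∑ k, ∑ q, ∑ a, (∑ l, berwaldP F' m i k l (target z) * berwald F' l j q (target z))
          * z (jX k B) * z (jy q a) * z (js a)
        + ∑ k, (∑ l, berwald F' m i l (target z) * berwald F' l j k (target z)) * z (jX k B) := by
    intro i j
    simp only [pd_jetN hB, mul_add, Finset.sum_add_distrib]
    congr 1
    · simp only [Fintype.sum_sum_type, fibreWeight, Sum.elim_inl, Sum.elim_inr, zero_mul, mul_zero,
        Finset.sum_const_zero, zero_add, jetN, Finset.sum_mul, Finset.mul_sum]
      have : ∀ x : Fin n → Fin p → Fin n → Fin n → ℝ,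
          ∑ l, ∑ a, ∑ k, ∑ q, x l a k q = ∑ k, ∑ q, ∑ a, ∑ l, x l a k q := by
        intro x
        rw [Finset.sum_comm]
        simp only [fun a => Finset.sum_comm (s := Finset.univ) (t := Finset.univ)
          (f := fun l k => ∑ q, x l a k q)]
        rw [Finset.sum_comm]
        refine Finset.sum_congr rfl fun k _ => ?_
        simp only [fun a => Finset.sum_comm (s := Finset.univ) (t := Finset.univ)
          (f := fun l q => x l a k q)]
        rw [Finset.sum_comm]
      rw [this fun l a k q => _]
      exact Finset.sum_congr rfl fun _ _ => Finset.sum_congr rfl fun _ _ =>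
        Finset.sum_congr rfl fun _ _ => Finset.sum_congr rfl fun _ _ => by ring
    · simp only [mul_ite, mul_zero, Finset.sum_ite_eq, Finset.mem_univ, if_true, jetN,
        Finset.sum_mul]
      rw [Finset.sum_comm]
      exact Finset.sum_congr rfl fun _ _ => Finset.sum_congr rfl fun _ _ => by ring
  rw [e, e]
  simp only [pd_jetN hB, add_mul, sub_mul, Finset.sum_add_distrib, Finset.sum_sub_distrib]
  ring

/-- The X-derivative of the temporal nonlinear connection is exactly the coefficient of D on ∂/∂X.
-/
lemma dTorsion_jX_jT_jX (m j : Fin n) (A B D : TIdx p) :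
    dTorsion F F' (jX m B) (jT A) (jX j D) z = 0 := by
  have h : ∀ c : JIdx p n, jetShear F F' c (jX j D) = fun _ => 0 := by
    rintro (B | i | ⟨i, B⟩) <;> rfl
  rw [dTorsion_eq hΓ hB]
  simp only [h, pd_const, jetCoef, zero_mul, mul_zero, Finset.sum_const_zero]
  simp only [jetShear, pd_jetM hΓ]
  split_ifs <;> simp

/-- The cancellation of the temporal case persists up to the asymmetry of B̃, but B̃ depends on y
through its base point. -/
lemma dTorsion_jX_jx_jX (m i j : Fin n) (B D : TIdx p) :
    dTorsion F F' (jX m B) (jx i) (jX j D) z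
      = fibreWeight z D * ∑ k, berwaldP F' m i k j (target z) * z (jX k B)
        + if B = D then berwald F' m i j (target z) - berwald F' m j i (target z) else 0 := by
  have h : ∀ c : JIdx p n, jetShear F F' c (jX j D) = fun _ => 0 := by
    rintro (B | i | ⟨i, B⟩) <;> rfl
  rw [dTorsion_eq hΓ hB]
  simp only [h, pd_const, jetCoef, zero_mul, mul_zero, Finset.sum_const_zero]
  simp only [jetShear, pd_jetN hB]
  split_ifs <;> ring

lemma dTorsion_jX_jX_jX (m i j : Fin n) (A B D : TIdx p) :
    dTorsion F F' (jX m B) (jX i A) (jX j D) z = 0 := by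
  have h : ∀ (c : JIdx p n) j D, jetShear F F' c (jX j D) = fun _ => 0 := by
    rintro (B | i | ⟨i, B⟩) _ _ <;> rfl
  rw [dTorsion_eq hΓ hB]
  simp [h, pd_const, jetCoef]

end Derivatives

end JetTorsion

/-! ### The fifteen families in terms of Berwald objects -/

section LocalTorsion

section Source

variable {p : ℕ} {U : Set (Fin p → ℝ)} {F : (TIdx p → ℝ) → ℝ}
  (hU : IsOpen U) (hF : IsFinslerOn F U) {T : TIdx p → ℝ} (hT : T ∈ slit U)
include hU hF hT

lemma pd_berwald_symm (A : TIdx p) (a α b : Fin p) :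
    pd A (berwald F a α b) T = pd A (berwald F a b α) T :=
  pd_congr_on _ (isOpen_slit hU) hT fun _ hw => berwald_symm hU hF a α b hw

/-- The products N^a_d B^d_{βγ} cancel by the symmetry of B; the other products are the vertical
parts of δ/δt, since ∂N/∂s = B. -/
lemma cartanNcov_sub_swap (a β γ : Fin p) :
    cartanNcov F a β γ T - cartanNcov F a γ β T = berwaldTorsion F a β γ T := by
  simp only [cartanNcov, berwaldTorsion, deltaT, pd_inr_cartanN hU hF _ _ _ hT]
  have e1 : ∑ d, cartanN F a d T * berwald F d β γ T = ∑ d, cartanN F a d T * berwald F d γ β T :=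
    Finset.sum_congr rfl fun _ _ => by rw [berwald_symm hU hF _ _ _ hT]
  have e2 : ∀ β γ, ∑ d, cartanN F d β T * berwald F a γ d T
      = ∑ d, cartanN F d β T * berwald F a d γ T := fun β γ =>
    Finset.sum_congr rfl fun _ _ => by rw [berwald_symm hU hF _ _ _ hT]
  rw [e1, e2, e2]
  ring

/-- The horizontal Berwald curvature in terms of coordinate derivatives. -/
lemma berwaldR_add_berwaldP (a β γ ε : Fin p) :
    berwaldR F a β γ ε T + ∑ c, berwaldP F a β γ c T * cartanN F c ε T
        - ∑ c, berwaldP F a β ε c T * cartanN F c γ T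
      = pd (Sum.inl ε) (berwald F a β γ) T - pd (Sum.inl γ) (berwald F a β ε) T
        + ∑ μ, berwald F μ β γ T * berwald F a μ ε T
        - ∑ μ, berwald F μ β ε T * berwald F a μ γ T := by
  have e : ∀ γ ε, ∑ c, berwaldP F a β γ c T * cartanN F c ε T
      = ∑ c, cartanN F c ε T * pd (Sum.inr c) (berwald F a β γ) T := fun γ ε =>
    Finset.sum_congr rfl fun _ _ => mul_comm _ _
  rw [e, e]
  simp only [berwaldR, deltaT]
  ring

lemma pd_normalGamma_inr_inl_inr (A : TIdx p) (c α b : Fin p) :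
    pd A (normalGamma F (Sum.inr c) (Sum.inl α) (Sum.inr b)) T = pd A (berwald F c α b) T :=
  pd_congr_on _ (isOpen_slit hU) hT fun _ hw => normalGamma_inr_inl_inr hU hF c α b hw

omit hU hF hT in
lemma pd_normalGamma (A : TIdx p) (c a b : Fin p) :
    pd A (normalGamma F (Sum.inl c) (Sum.inl a) (Sum.inl b)) T = pd A (berwald F c a b) T ∧
    pd A (normalGamma F (Sum.inl c) (Sum.inl a) (Sum.inr b)) T = 0 ∧
    pd A (normalGamma F (Sum.inl c) (Sum.inr a) (Sum.inl b)) T = 0 ∧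
    pd A (normalGamma F (Sum.inl c) (Sum.inr a) (Sum.inr b)) T = 0 ∧
    pd A (normalGamma F (Sum.inr c) (Sum.inl a) (Sum.inl b)) T = pd A (cartanNcov F c a b) T ∧
    pd A (normalGamma F (Sum.inr c) (Sum.inr a) (Sum.inl b)) T = pd A (berwald F c a b) T ∧
    pd A (normalGamma F (Sum.inr c) (Sum.inr a) (Sum.inr b)) T = 0 := by
  refine ⟨?_, ?_, ?_, ?_, ?_, ?_, ?_⟩
  · rw [funext (normalGamma_inl_inl_inl c a b)]
  · rw [funext (normalGamma_inl_inr_right c b _)]; exact pd_const _ _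
  · rw [funext (normalGamma_inl_inr c a _)]; exact pd_const _ _
  · rw [funext (normalGamma_inl_inr c a _)]; exact pd_const _ _
  · rw [funext (normalGamma_inr_inl_inl c a b)]
  · rw [funext (normalGamma_inr_inr_inl c a b)]
  · rw [funext (normalGamma_inr_inr_inr c a b)]; exact pd_const _ _

end Source

variable {p n : ℕ} {U : Set (Fin p → ℝ)} {V : Set (Fin n → ℝ)}
  {F : (TIdx p → ℝ) → ℝ} {F' : (TIdx n → ℝ) → ℝ}
  (hU : IsOpen U) (hV : IsOpen V) (hF : IsFinslerOn F U) (hF' : IsFinslerOn F' V)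
  {z : JIdx p n → ℝ} (hz : z ∈ jetDomain U V)
include hU hV hF hF' hz

omit hV hF' in
lemma differentiableAt_normalGamma (C A B : TIdx p) :
    DifferentiableAt ℝ (normalGamma F C A B) (source z) :=
  contDiffOn_differentiableAt (isOpen_slit hU) (contDiffOn_normalGamma hU hF C A B) hz.1

omit hU hF in
lemma differentiableAt_berwald (i j k : Fin n) :
    DifferentiableAt ℝ (berwald F' i j k) (target z) :=
  contDiffOn_differentiableAt (isOpen_slit hV) (contDiffOn_berwald hV hF' i j k) hz.2

lemma dTorsion_s_t_t (a β γ : Fin p) :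
    dTorsion F F' (js a) (jt β) (jt γ) z
      = cartanNcov F a β γ (source z) - cartanNcov F a γ β (source z) := by
  rw [dTorsion_jT (differentiableAt_normalGamma hU hF hz) (differentiableAt_berwald hV hF' hz)]
  simp only [jetCoef, normalGamma_inr_inl_inl]

lemma dTorsion_jX_x_y (m i j : Fin n) (B : TIdx p) (b : Fin p) :
    dTorsion F F' (jX m B) (jx i) (jy j b) z
      = ∑ k, berwaldP F' m i k j (target z) * z (jX k B) * z (js b) := by
  rw [dTorsion_jX_jx_jX (differentiableAt_normalGamma hU hF hz)
    (differentiableAt_berwald hV hF' hz), berwald_symm hV hF' m i j hz.2]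
  simp [fibreWeight, Finset.mul_sum, mul_comm]

lemma dTorsion_jX_x_xt (m i j : Fin n) (B : TIdx p) (β : Fin p) :
    dTorsion F F' (jX m B) (jx i) (jxt j β) z = 0 := by
  rw [dTorsion_jX_jx_jX (differentiableAt_normalGamma hU hF hz)
    (differentiableAt_berwald hV hF' hz), berwald_symm hV hF' m i j hz.2]
  simp [fibreWeight]

lemma dTorsion_xt_t_t (m : Fin n) (μ α β : Fin p) :
    dTorsion F F' (jxt m μ) (jt α) (jt β) z =
      -∑ ε, (berwaldR F ε μ α β (source z)
          + ∑ c, berwaldP F ε μ α c (source z) * cartanN F c β (source z)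
          - ∑ c, berwaldP F ε μ β c (source z) * cartanN F c α (source z)) * z (jxt m ε)
      + ∑ c, ((pd (Sum.inl α) (cartanNcov F c β μ) (source z)
            + ∑ d, cartanNcov F d β μ (source z) * berwald F c d α (source z)
            - ∑ γ, cartanNcov F c β γ (source z) * berwald F γ α μ (source z))
          - (pd (Sum.inl β) (cartanNcov F c α μ) (source z)
            + ∑ d, cartanNcov F d α μ (source z) * berwald F c d β (source z)
            - ∑ γ, cartanNcov F c α γ (source z) * berwald F γ β μ (source z))) * z (jy m c) := by
  rw [dTorsion_jX_jT_jT (differentiableAt_normalGamma hU hF hz)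
    (differentiableAt_berwald hV hF' hz), Fintype.sum_sum_type]
  simp only [Fintype.sum_sum_type, pd_normalGamma, normalGamma_inl_inl_inl,
    normalGamma_inl_inr_right, normalGamma_inr_inl_inl, normalGamma_inr_inl_inr hU hF _ _ _ hz.1,
    berwaldR_add_berwaldP hU hF hz.1, ← Finset.sum_neg_distrib]
  congr 1
  -- The sum over C splits into t- and s-indices. Here, for t-indices, only the curvature of B is
  -- present, up to the symmetry of B.
  · refine Finset.sum_congr rfl fun ε _ => ?_
    rw [pd_berwald_symm hU hF hz.1 _ ε β μ, pd_berwald_symm hU hF hz.1 _ ε α μ]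
    have e : ∀ α β, ∑ x, berwald F x β μ (source z) * berwald F ε α x (source z)
        = ∑ x, berwald F x μ β (source z) * berwald F ε x α (source z) := fun α β =>
      Finset.sum_congr rfl fun x _ => by
        rw [berwald_symm hU hF x β μ hz.1, berwald_symm hU hF ε α x hz.1]
    simp only [e, mul_zero, Finset.sum_const_zero]
    ring
  · refine Finset.sum_congr rfl fun c _ => ?_
    have e1 : ∀ α β, ∑ d, cartanNcov F d β μ (source z) * berwald F c α d (source z)
        = ∑ d, cartanNcov F d β μ (source z) * berwald F c d α (source z) := fun α β =>
      Finset.sum_congr rfl fun x _ => by rw [berwald_symm hU hF c α x hz.1]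
    have e2 : ∀ α β, ∑ x, berwald F x β μ (source z) * cartanNcov F c α x (source z)
        = ∑ x, cartanNcov F c α x (source z) * berwald F x β μ (source z) := fun α β =>
      Finset.sum_congr rfl fun x _ => mul_comm _ _
    simp only [e1, e2]
    ring

lemma dTorsion_xt_t_s (m : Fin n) (μ α b : Fin p) :
    dTorsion F F' (jxt m μ) (jt α) (js b) z =
      -∑ ε, berwaldP F ε μ α b (source z) * z (jxt m ε)
      + ∑ c, (pd (Sum.inl α) (berwald F c b μ) (source z)
          - pd (Sum.inr b) (cartanNcov F c α μ) (source z)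
          + ∑ d, berwald F d b μ (source z) * berwald F c d α (source z)
          - ∑ γ, berwald F γ α μ (source z) * berwald F c γ b (source z)) * z (jy m c) := by
  rw [dTorsion_jX_jT_jT (differentiableAt_normalGamma hU hF hz)
    (differentiableAt_berwald hV hF' hz), Fintype.sum_sum_type]
  simp only [Fintype.sum_sum_type, pd_normalGamma, normalGamma_inl_inl_inl, normalGamma_inl_inr,
    normalGamma_inl_inr_right, normalGamma_inr_inl_inl, normalGamma_inr_inl_inr hU hF _ _ _ hz.1,
    normalGamma_inr_inr_inl, normalGamma_inr_inr_inr, ← Finset.sum_neg_distrib]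
  congr 1
  · refine Finset.sum_congr rfl fun ε _ => ?_
    rw [berwaldP_swap_left hU hF _ _ _ _ hz.1, berwaldP]
    simp
  · refine Finset.sum_congr rfl fun c _ => ?_
    have e1 : ∑ d, berwald F d b μ (source z) * berwald F c α d (source z)
        = ∑ d, berwald F d b μ (source z) * berwald F c d α (source z) :=
      Finset.sum_congr rfl fun x _ => by rw [berwald_symm hU hF c α x hz.1]
    have e2 : ∑ d, berwald F d α μ (source z) * berwald F c b d (source z)
        = ∑ d, berwald F d α μ (source z) * berwald F c d b (source z) :=
      Finset.sum_congr rfl fun x _ => by rw [berwald_symm hU hF c b x hz.1]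
    simp only [e1, e2, zero_mul, mul_zero, Finset.sum_const_zero]
    ring

lemma dTorsion_xt_s_t (m : Fin n) (μ a β : Fin p) :
    dTorsion F F' (jxt m μ) (js a) (jt β) z =
      ∑ ε, berwaldP F ε μ a β (source z) * z (jxt m ε)
      - ∑ c, (pd (Sum.inl β) (berwald F c a μ) (source z)
          - pd (Sum.inr a) (cartanNcov F c β μ) (source z)
          + ∑ d, berwald F d a μ (source z) * berwald F c d β (source z)
          - ∑ γ, berwald F γ β μ (source z) * berwald F c γ a (source z)) * z (jy m c) := by
  rw [dTorsion_swap, dTorsion_xt_t_s hU hV hF hF' hz]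
  simp only [fun ε => berwaldP_swap_right hU hF ε μ β a hz.1]
  ring

lemma dTorsion_y_t_t (m : Fin n) (c α β : Fin p) :
    dTorsion F F' (jy m c) (jt α) (jt β) z =
      -∑ d, (berwaldR F d c α β (source z)
          + ∑ f, berwaldP F d c α f (source z) * cartanN F f β (source z)
          - ∑ f, berwaldP F d c β f (source z) * cartanN F f α (source z)) * z (jy m d) := by
  rw [dTorsion_jX_jT_jT (differentiableAt_normalGamma hU hF hz)
    (differentiableAt_berwald hV hF' hz), Fintype.sum_sum_type]
  simp only [Fintype.sum_sum_type, pd_normalGamma, pd_normalGamma_inr_inl_inr hU hF hz.1,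
    normalGamma_inl_inr_right, normalGamma_inr_inl_inr hU hF _ _ _ hz.1,
    berwaldR_add_berwaldP hU hF hz.1, ← Finset.sum_neg_distrib, zero_mul, mul_zero,
    Finset.sum_const_zero, sub_zero, add_zero, zero_add]
  refine Finset.sum_congr rfl fun ε _ => ?_
  rw [pd_berwald_symm hU hF hz.1 _ ε β c, pd_berwald_symm hU hF hz.1 _ ε α c]
  have e : ∀ α β, ∑ x, berwald F x β c (source z) * berwald F ε α x (source z)
      = ∑ x, berwald F x c β (source z) * berwald F ε x α (source z) := fun α β =>
    Finset.sum_congr rfl fun x _ => by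
      rw [berwald_symm hU hF x β c hz.1, berwald_symm hU hF ε α x hz.1]
  simp only [e]
  ring

lemma dTorsion_y_t_s (m : Fin n) (c α b : Fin p) :
    dTorsion F F' (jy m c) (jt α) (js b) z =
      -∑ d, berwaldP F d c α b (source z) * z (jy m d) := by
  rw [dTorsion_jX_jT_jT (differentiableAt_normalGamma hU hF hz)
    (differentiableAt_berwald hV hF' hz), Fintype.sum_sum_type]
  simp only [Fintype.sum_sum_type, pd_normalGamma, pd_normalGamma_inr_inl_inr hU hF hz.1,
    normalGamma_inl_inr, normalGamma_inl_inr_right, normalGamma_inr_inr_inr,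
    ← Finset.sum_neg_distrib, zero_mul, mul_zero, Finset.sum_const_zero, sub_zero, add_zero,
    zero_add, zero_sub]
  refine Finset.sum_congr rfl fun ε _ => ?_
  rw [berwaldP_swap_left hU hF _ _ _ _ hz.1, berwaldP]
  ring

lemma dTorsion_y_s_t (m : Fin n) (c a β : Fin p) :
    dTorsion F F' (jy m c) (js a) (jt β) z =
      ∑ d, berwaldP F d c a β (source z) * z (jy m d) := by
  rw [dTorsion_swap, dTorsion_y_t_s hU hV hF hF' hz, neg_neg]
  simp only [fun ε => berwaldP_swap_right hU hF ε c β a hz.1]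

lemma dTorsion_jX_s_s (m : Fin n) (B : TIdx p) (a b : Fin p) :
    dTorsion F F' (jX m B) (js a) (js b) z = 0 := by
  rw [dTorsion_jX_jT_jT (differentiableAt_normalGamma hU hF hz)
    (differentiableAt_berwald hV hF' hz), Fintype.sum_sum_type]
  rcases B with μ | c
  · simp only [Fintype.sum_sum_type, pd_normalGamma, normalGamma_inl_inr,
      normalGamma_inr_inr_inr]
    -- All products of normal components vanish here, and the derivatives cancel by the total
    -- symmetry of P.
    have : ∀ c, pd (Sum.inr a) (berwald F c b μ) (source z)
        = pd (Sum.inr b) (berwald F c a μ) (source z) := by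
      intro c
      have h1 := berwaldP_swap_left hU hF c b μ a hz.1
      have h2 := berwaldP_swap_right hU hF c μ b a hz.1
      have h3 := berwaldP_swap_left hU hF c μ a b hz.1
      exact h1.trans (h2.trans h3)
    simp [this]
  · simp [Fintype.sum_sum_type, pd_normalGamma, normalGamma_inl_inr,
      normalGamma_inr_inr_inr]

/-- The base point of B̃ is independent of t, so it moves only through the y-components of δ/δt^α,
which are given by Γ^c_{αb} = B^c_{αb}. -/
lemma dTorsion_jX_t_x (m j : Fin n) (B : TIdx p) (α : Fin p) :
    dTorsion F F' (jX m B) (jt α) (jx j) z =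
      -∑ k, ∑ l, ∑ b, ∑ c, berwaldP F' m j k l (target z) * berwald F c α b (source z) * z (js b)
          * z (jX k B) * z (jy l c) := by
  rw [dTorsion_jX_jT_jx (differentiableAt_normalGamma hU hF hz)
    (differentiableAt_berwald hV hF' hz), pd_jetN (differentiableAt_berwald hV hF' hz)]
  simp only [Fintype.sum_sum_type, fibreWeight, Sum.elim_inl, Sum.elim_inr, zero_mul, mul_zero,
    Finset.sum_const_zero, zero_add, neg_zero, jetM, normalGamma_inl_inr_right,
    normalGamma_inr_inl_inr hU hF _ _ _ hz.1, neg_mul, Finset.sum_neg_distrib]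
  simp only [Finset.mul_sum, Finset.sum_mul]
  congr 1
  rw [Finset.sum_comm' (t' := Finset.univ) (s' := fun _ => Finset.univ) (by simp)]
  conv_rhs => rw [Finset.sum_comm]; enter [2, l]; rw [Finset.sum_comm]
  rw [Finset.sum_comm]
  refine Finset.sum_congr rfl fun l _ => Finset.sum_congr rfl fun b _ =>
    Finset.sum_congr rfl fun k _ => Finset.sum_congr rfl fun c _ => by ring

/-- Opposite to the t-case: Γ^C_{ab} = 0 for two s-indices, so only the explicit dependence of y_a
s^a on s contributes. -/
lemma dTorsion_jX_s_x (m j : Fin n) (B : TIdx p) (a : Fin p) :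
    dTorsion F F' (jX m B) (js a) (jx j) z =
      -∑ k, ∑ l, berwaldP F' m j k l (target z) * z (jX k B) * z (jy l a) := by
  rw [dTorsion_jX_jT_jx (differentiableAt_normalGamma hU hF hz)
    (differentiableAt_berwald hV hF' hz), pd_jetN (differentiableAt_berwald hV hF' hz)]
  simp only [Fintype.sum_sum_type, fibreWeight, Sum.elim_inl, Sum.elim_inr, zero_mul, mul_zero,
    Finset.sum_const_zero, add_zero, neg_zero, jetM, normalGamma_inl_inr_right,
    normalGamma_inr_inr_inr, Finset.sum_mul]
  congr 1
  exact Finset.sum_congr rfl fun _ _ => Finset.sum_congr rfl fun _ _ => by ring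

lemma dTorsion_jX_x_x (m i j : Fin n) (B : TIdx p) :
    dTorsion F F' (jX m B) (jx i) (jx j) z =
      ∑ k, (berwaldR F' m k i j (target z)
          + ∑ l, berwaldP F' m k i l (target z) * cartanN F' l j (target z)
          - ∑ l, berwaldP F' m k j l (target z) * cartanN F' l i (target z)) * z (jX k B)
      - ∑ k, ∑ q, ∑ a, (∑ l, berwaldP F' m k i l (target z) * berwald F' l j q (target z)
          - ∑ l, berwaldP F' m k j l (target z) * berwald F' l i q (target z))
            * z (jX k B) * z (jy q a) * z (js a) := by
  rw [dTorsion_jX_jx_jx (differentiableAt_normalGamma hU hF hz)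
    (differentiableAt_berwald hV hF' hz)]
  simp only [berwaldR_add_berwaldP hV hF' hz.2]
  simp only [fun k l => berwaldP_swap_left hV hF' m i k l hz.2,
    fun k l => berwaldP_swap_left hV hF' m j k l hz.2]
  congr 1
  refine Finset.sum_congr rfl fun k _ => ?_
  rw [pd_berwald_symm hV hF' hz.2 _ m i k, pd_berwald_symm hV hF' hz.2 _ m j k]
  have e : ∀ i j, ∑ l, berwald F' m j l (target z) * berwald F' l i k (target z)
      = ∑ l, berwald F' l k i (target z) * berwald F' m l j (target z) := fun i j =>
    Finset.sum_congr rfl fun x _ => by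
      rw [berwald_symm hV hF' m j x hz.2, berwald_symm hV hF' x i k hz.2, mul_comm]
  simp only [e]

/-- All torsion components outside the fifteen families vanish. -/
lemma dTorsion_eq_zero (c a b : JIdx p n)
    (h1 : (block c, block a, block b) ∉ torsionFamilies)
    (h2 : (block c, block b, block a) ∉ torsionFamilies) : dTorsion F F' c a b z = 0 := by
  have hΓ := differentiableAt_normalGamma (n := n) hU hF hz
  have hB := differentiableAt_berwald (p := p) hV hF' hz
  rcases c with C | k | ⟨m, C⟩
  · rw [dTorsion_jT hΓ hB]
    -- Unless both lower indices are T-indices, both coefficients take the default value zero.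
    rcases a with A | i | ⟨i, A⟩ <;> rcases b with B | j | ⟨j, B⟩ <;>
      first
      | exact sub_self _
      | skip
    simp only [jetCoef]
    rcases C with γ | c
    · rcases A with α | a <;> rcases B with β | b <;>
        simp [normalGamma_inl_inl_inl, normalGamma_inl_inr, normalGamma_inl_inr_right]
      rw [berwald_symm hU hF _ _ _ hz.1, sub_self]
    · rcases A with α | a <;> rcases B with β | b <;>
        try simp only [normalGamma_inr_inr_inl, normalGamma_inr_inl_inr hU hF _ _ _ hz.1]
      · exact absurd (by simp [block, torsionFamilies]) h1
      · rw [berwald_symm hU hF _ _ _ hz.1, sub_self]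
      · rw [berwald_symm hU hF _ _ _ hz.1, sub_self]
      · rw [normalGamma_inr_inr_inr, normalGamma_inr_inr_inr, sub_self]
  · rw [dTorsion_jx hΓ hB]
    rcases a with A | i | ⟨i, A⟩ <;> rcases b with B | j | ⟨j, B⟩ <;>
      first
      | exact sub_self _
      | skip
    simp only [jetCoef]
    rw [berwald_symm hV hF' _ _ _ hz.2, sub_self]
  · rcases a with A | i | ⟨i, A⟩ <;> rcases b with B | j | ⟨j, B⟩
    · rcases A with α | a <;> rcases B with β | b
      · exact absurd (by rcases C with _ | _ <;> simp [block, torsionFamilies]) h1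
      · exact absurd (by rcases C with _ | _ <;> simp [block, torsionFamilies]) h1
      · exact absurd (by rcases C with _ | _ <;> simp [block, torsionFamilies]) h1
      · exact dTorsion_jX_s_s hU hV hF hF' hz m C a b
    · exact absurd (by rcases C with _ | _ <;> rcases A with _ | _ <;>
        simp [block, torsionFamilies]) h1
    · exact dTorsion_jX_jT_jX hΓ hB _ _ _ _ _
    · exact absurd (by rcases C with _ | _ <;> rcases B with _ | _ <;>
        simp [block, torsionFamilies]) h2
    · exact absurd (by rcases C with _ | _ <;> simp [block, torsionFamilies]) h1
    · rcases B with β | b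
      · exact dTorsion_jX_x_xt hU hV hF hF' hz _ _ _ _ _
      · exact absurd (by rcases C with _ | _ <;> simp [block, torsionFamilies]) h1
    · rw [dTorsion_swap, neg_eq_zero]
      exact dTorsion_jX_jT_jX hΓ hB _ _ _ _ _
    · rcases A with β | b
      · rw [dTorsion_swap, neg_eq_zero]
        exact dTorsion_jX_x_xt hU hV hF hF' hz _ _ _ _ _
      · exact absurd (by rcases C with _ | _ <;> simp [block, torsionFamilies]) h2
    · exact dTorsion_jX_jX_jX hΓ hB _ _ _ _ _ _

end LocalTorsion

/-! ### Explicit computation of partial derivatives -/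

section HasPD

variable {ι : Type} [Fintype ι] [DecidableEq ι] {k : ι} {f g : (ι → ℝ) → ℝ} {a b : ℝ} {u : ι → ℝ}

/-- `f` is differentiable at `u` with `k`-th partial derivative `d`. -/
def HasPD (k : ι) (f : (ι → ℝ) → ℝ) (d : ℝ) (u : ι → ℝ) : Prop :=
  DifferentiableAt ℝ f u ∧ pd k f u = d

namespace HasPD

lemma coord (k i : ι) (u : ι → ℝ) : HasPD k (fun w => w i) (if i = k then 1 else 0) u :=
  ⟨differentiableAt_coord i, pd_coord k i⟩

lemma const (k : ι) (c : ℝ) (u : ι → ℝ) : HasPD k (fun _ => c) 0 u :=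
  ⟨differentiableAt_const c, pd_const k c⟩

lemma add (hf : HasPD k f a u) (hg : HasPD k g b u) : HasPD k (fun w => f w + g w) (a + b) u :=
  ⟨hf.1.fun_add hg.1, by rw [pd_add k hf.1 hg.1, hf.2, hg.2]⟩

lemma sub (hf : HasPD k f a u) (hg : HasPD k g b u) : HasPD k (fun w => f w - g w) (a - b) u :=
  ⟨hf.1.fun_sub hg.1, by rw [pd_sub k hf.1 hg.1, hf.2, hg.2]⟩

lemma mul (hf : HasPD k f a u) (hg : HasPD k g b u) :
    HasPD k (fun w => f w * g w) (a * g u + f u * b) u :=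
  ⟨hf.1.fun_mul hg.1, by rw [pd_mul k hf.1 hg.1, hf.2, hg.2]⟩

lemma comp {φ : ℝ → ℝ} {φ' : ℝ} (hf : HasPD k f a u) (hφ : HasDerivAt φ φ' (f u)) :
    HasPD k (fun w => φ (f w)) (φ' * a) u := by
  have h := hφ.hasFDerivAt.comp u hf.1.hasFDerivAt
  refine ⟨h.differentiableAt, ?_⟩
  rw [← hf.2, pd, pd, show (fun w => φ (f w)) = φ ∘ f from rfl, h.fderiv]
  simp [mul_comm]

lemma pow (n : ℕ) (hf : HasPD k f a u) :
    HasPD k (fun w => f w ^ n) (n * f u ^ (n - 1) * a) u :=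
  hf.comp (hasDerivAt_pow n (f u))

lemma inv (hf : HasPD k f a u) (h0 : f u ≠ 0) :
    HasPD k (fun w => (f w)⁻¹) (-(f u ^ 2)⁻¹ * a) u :=
  hf.comp (hasDerivAt_inv h0)

lemma div (hf : HasPD k f a u) (hg : HasPD k g b u) (h0 : g u ≠ 0) :
    HasPD k (fun w => f w / g w) ((a * g u - f u * b) / g u ^ 2) u := by
  have h := hf.mul (hg.inv h0)
  refine ⟨h.1, h.2.trans ?_⟩
  field_simp
  ring

lemma congr_val (hf : HasPD k f a u) (h : a = b) : HasPD k f b u := h ▸ hf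

end HasPD

/-- A partial derivative is determined by the values on a coordinate line. -/
lemma pd_eq_of_line {φ : ℝ → ℝ} {d : ℝ} (hf : DifferentiableAt ℝ f u)
    (h : ∀ᶠ r in 𝓝 (u k), f (Function.update u k r) = φ r) (hφ : HasDerivAt φ d (u k)) :
    pd k f u = d := by
  have h1 : HasDerivAt (fun r => f (Function.update u k r)) (pd k f u) (u k) := by
    have h2 := hasDerivAt_update u k (u k)
    have h3 : HasFDerivAt f (fderiv ℝ f u) (Function.update u k (u k)) := by
      rw [Function.update_eq_self]; exact hf.hasFDerivAt
    exact h3.comp_hasDerivAt (u k) h2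
  exact h1.unique (hφ.congr_of_eventuallyEq h)

end HasPD

/-! ### The Randers metric |s| + t^1 s^1 -/

section Example

/-- The Euclidean length of `s`. -/
def exRho (T : TIdx 2 → ℝ) : ℝ := √(T (Sum.inr 0) ^ 2 + T (Sum.inr 1) ^ 2)

/-- The Randers metric `|s| + t^1 s^1` on the strip `|t^1| < 1` of the plane. -/
def exF (T : TIdx 2 → ℝ) : ℝ := exRho T + T (Sum.inl 0) * T (Sum.inr 0)

/-- The strip on which `exF` is a Finsler metric. -/
def exU : Set (Fin 2 → ℝ) := {t | |t 0| < 1}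

/-- The first fibre derivatives of `exF`. -/
def exGrad (i : Fin 2) (T : TIdx 2 → ℝ) : ℝ :=
  T (Sum.inr i) / exRho T + T (Sum.inl 0) * (if 0 = i then 1 else 0)

/-- The second fibre derivatives of `exF`. -/
def exHess (i k : Fin 2) (T : TIdx 2 → ℝ) : ℝ :=
  ((if i = k then 1 else 0) * exRho T ^ 2 - T (Sum.inr i) * T (Sum.inr k)) / exRho T ^ 3

lemma isOpen_exU : IsOpen exU :=
  isOpen_lt (by fun_prop) continuous_const

variable {T : TIdx 2 → ℝ}

lemma sq_pos_of_mem_slit (hT : T ∈ slit exU) : 0 < T (Sum.inr 0) ^ 2 + T (Sum.inr 1) ^ 2 := by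
  by_contra h
  refine hT.2 (funext fun a => ?_)
  have h0 := sq_nonneg (T (Sum.inr 0))
  have h1 := sq_nonneg (T (Sum.inr 1))
  fin_cases a
  · exact pow_eq_zero_iff (two_ne_zero) |>.1 (by linarith : T (Sum.inr 0) ^ 2 = 0)
  · exact pow_eq_zero_iff (two_ne_zero) |>.1 (by linarith : T (Sum.inr 1) ^ 2 = 0)

lemma exRho_pos (hT : T ∈ slit exU) : 0 < exRho T := Real.sqrt_pos.2 (sq_pos_of_mem_slit hT)

lemma exRho_sq (T : TIdx 2 → ℝ) : exRho T ^ 2 = T (Sum.inr 0) ^ 2 + T (Sum.inr 1) ^ 2 :=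
  Real.sq_sqrt (by positivity)

lemma abs_le_exRho (T : TIdx 2 → ℝ) : |T (Sum.inr 0)| ≤ exRho T :=
  Real.abs_le_sqrt (by nlinarith [sq_nonneg (T (Sum.inr 1))])

lemma exF_nonneg (hT : (fun α => T (Sum.inl α)) ∈ exU) : 0 ≤ exF T := by
  have h1 : |T (Sum.inl 0)| < 1 := hT
  have h2 := abs_le_exRho T
  have h3 := neg_abs_le (T (Sum.inl 0) * T (Sum.inr 0))
  rw [abs_mul] at h3
  rw [exF]
  nlinarith [abs_nonneg (T (Sum.inr 0))]

lemma exF_pos (hT : T ∈ slit exU) : 0 < exF T := by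
  have h1 : |T (Sum.inl 0)| < 1 := hT.1
  have h2 := abs_le_exRho T
  have h3 := neg_abs_le (T (Sum.inl 0) * T (Sum.inr 0))
  have h4 := exRho_pos hT
  rw [abs_mul] at h3
  rw [exF]
  nlinarith [abs_nonneg (T (Sum.inr 0)), abs_nonneg (T (Sum.inl 0))]

lemma hasPD_inr_exRho (k : Fin 2) (hT : T ∈ slit exU) :
    HasPD (Sum.inr k) exRho (T (Sum.inr k) / exRho T) T := by
  have h := (((HasPD.coord (Sum.inr k) (Sum.inr 0) T).pow 2).add
    ((HasPD.coord (Sum.inr k) (Sum.inr 1) T).pow 2)).comp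
    (Real.hasDerivAt_sqrt (sq_pos_of_mem_slit hT).ne')
  refine h.congr_val ?_
  have := exRho_pos hT
  rw [show √(T (Sum.inr 0) ^ 2 + T (Sum.inr 1) ^ 2) = exRho T from rfl]
  fin_cases k <;> simp <;> field_simp

lemma hasPD_inl_exRho (k : Fin 2) (hT : T ∈ slit exU) : HasPD (Sum.inl k) exRho 0 T := by
  have h := (((HasPD.coord (Sum.inl k) (Sum.inr 0) T).pow 2).add
    ((HasPD.coord (Sum.inl k) (Sum.inr 1) T).pow 2)).comp
    (Real.hasDerivAt_sqrt (sq_pos_of_mem_slit hT).ne')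
  exact h.congr_val (by simp)

lemma hasPD_inr_exF (k : Fin 2) (hT : T ∈ slit exU) :
    HasPD (Sum.inr k) exF (exGrad k T) T := by
  refine ((hasPD_inr_exRho k hT).add ((HasPD.coord _ (Sum.inl 0) T).mul
    (HasPD.coord _ (Sum.inr 0) T))).congr_val ?_
  simp [exGrad]

lemma hasPD_inl_exF (k : Fin 2) (hT : T ∈ slit exU) :
    HasPD (Sum.inl k) exF ((if 0 = k then 1 else 0) * T (Sum.inr 0)) T := by
  refine ((hasPD_inl_exRho k hT).add ((HasPD.coord _ (Sum.inl 0) T).mul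
    (HasPD.coord _ (Sum.inr 0) T))).congr_val ?_
  simp

lemma hasPD_inr_exGrad (i k : Fin 2) (hT : T ∈ slit exU) :
    HasPD (Sum.inr k) (exGrad i) (exHess i k T) T := by
  have h0 := exRho_pos hT
  refine (((HasPD.coord _ (Sum.inr i) T).div (hasPD_inr_exRho k hT) h0.ne').add
    ((HasPD.coord _ (Sum.inl 0) T).mul (HasPD.const _ _ T))).congr_val ?_
  simp only [exHess, Sum.inr.injEq, reduceCtorEq, if_false]
  field_simp
  ring

lemma hasPD_inl_exGrad (i k : Fin 2) (hT : T ∈ slit exU) :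
    HasPD (Sum.inl k) (exGrad i) ((if 0 = k then 1 else 0) * (if 0 = i then 1 else 0)) T := by
  have h0 := exRho_pos hT
  refine (((HasPD.coord _ (Sum.inr i) T).div (hasPD_inl_exRho k hT) h0.ne').add
    ((HasPD.coord _ (Sum.inl 0) T).mul (HasPD.const _ _ T))).congr_val ?_
  simp

lemma hasPD_inl_exHess (i j k : Fin 2) (hT : T ∈ slit exU) :
    HasPD (Sum.inl k) (exHess i j) 0 T := by
  have h0 := exRho_pos hT
  refine ((((HasPD.const _ _ T).mul ((hasPD_inl_exRho k hT).pow 2)).sub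
    ((HasPD.coord _ (Sum.inr i) T).mul (HasPD.coord _ (Sum.inr j) T))).div
    ((hasPD_inl_exRho k hT).pow 3) (pow_pos h0 3).ne').congr_val ?_
  simp

lemma differentiableAt_exHess (i j : Fin 2) (hT : T ∈ slit exU) :
    DifferentiableAt ℝ (exHess i j) T := (hasPD_inl_exHess i j 0 hT).1

lemma metric_exF (i j : Fin 2) (hT : T ∈ slit exU) :
    metric exF i j T = exGrad i T * exGrad j T + exF T * exHess j i T := by
  have h1 : ∀ w ∈ slit exU, pd (Sum.inr j) (fun T' => exF T' ^ 2) w = 2 * (exF w * exGrad j w) := by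
    intro w hw
    rw [((hasPD_inr_exF j hw).pow 2).2]
    norm_num [mul_assoc]
  rw [metric, pd_congr_on _ (isOpen_slit isOpen_exU) hT h1,
    ((HasPD.const _ (2 : ℝ) T).mul ((hasPD_inr_exF i hT).mul (hasPD_inr_exGrad j i hT))).2]
  ring

/-- The bound |t^1| < 1 makes F positive off the zero section. The metric is dF ⊗ dF plus F times
the Hessian of |s|, and the two forms have no common null vector. -/
lemma isFinslerOn_exF : IsFinslerOn exF exU where
  nonneg := fun T hT => exF_nonneg hT
  smooth := by
    refine ContDiffOn.add (ContDiffOn.sqrt ?_ fun T hT => (sq_pos_of_mem_slit hT).ne')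
      ((contDiffOn_coord _ _).mul (contDiffOn_coord _ _))
    exact ((contDiffOn_coord _ _).pow 2).add ((contDiffOn_coord _ _).pow 2)
  homogeneous := by
    intro t _ s r hr
    simp only [exF, exRho, Sum.elim_inl, Sum.elim_inr, Pi.smul_apply, smul_eq_mul]
    rw [show (r * s 0) ^ 2 + (r * s 1) ^ 2 = r ^ 2 * (s 0 ^ 2 + s 1 ^ 2) by ring,
      Real.sqrt_mul (by positivity), Real.sqrt_sq hr.le]
    ring
  posDef := by
    intro T hT
    have hF := exF_pos hT
    have hr := exRho_pos hT
    have hsq := exRho_sq T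
    refine Matrix.PosDef.of_dotProduct_mulVec_pos ?_ ?_
    · ext i j
      simp only [Matrix.conjTranspose_apply, Matrix.of_apply, star_trivial, metric_exF _ _ hT,
        exHess, eq_comm (a := i)]
      ring
    · intro v hv
      have e : star v ⬝ᵥ (Matrix.of fun α β => metric exF α β T).mulVec v
          = (exGrad 0 T * v 0 + exGrad 1 T * v 1) ^ 2
            + exF T * (T (Sum.inr 1) * v 0 - T (Sum.inr 0) * v 1) ^ 2 / exRho T ^ 3 := by
        simp only [dotProduct, Matrix.mulVec, Fin.sum_univ_two, Matrix.of_apply, metric_exF _ _ hT,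
          exHess, hsq, Pi.star_apply, star_trivial]
        simp
        ring
      rw [e]
      have h1 : 0 ≤ exF T * (T (Sum.inr 1) * v 0 - T (Sum.inr 0) * v 1) ^ 2 / exRho T ^ 3 := by
        positivity
      rcases eq_or_ne (T (Sum.inr 1) * v 0 - T (Sum.inr 0) * v 1) 0 with h2 | h2
      · suffices h : exGrad 0 T * v 0 + exGrad 1 T * v 1 ≠ 0 by positivity
        intro h3
        -- A vector that is parallel to s and annihilated by dF is also orthogonal to s, because F
        -- times its scalar product with s combines the two vanishing expressions; hence it is zero.
        have h4 : (T (Sum.inr 0) * v 0 + T (Sum.inr 1) * v 1) * exF T = 0 := by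
          have : (T (Sum.inr 0) * v 0 + T (Sum.inr 1) * v 1) * exF T
              = exRho T ^ 2 * (exGrad 0 T * v 0 + exGrad 1 T * v 1)
              - T (Sum.inl 0) * T (Sum.inr 1) *
                (T (Sum.inr 1) * v 0 - T (Sum.inr 0) * v 1) := by
            simp only [exGrad, exF]
            simp
            field_simp
            linear_combination (-(T (Sum.inl 0) * v 0)) * hsq
          rw [this, h2, h3]; ring
        have h5 := (mul_eq_zero.1 h4).resolve_right hF.ne'
        have h6 : exRho T ^ 2 * v 0 = 0 := by
          rw [hsq]; linear_combination T (Sum.inr 0) * h5 + T (Sum.inr 1) * h2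
        have h7 : exRho T ^ 2 * v 1 = 0 := by
          rw [hsq]; linear_combination T (Sum.inr 1) * h5 - T (Sum.inr 0) * h2
        have hr2 := (pow_pos hr 2).ne'
        refine hv (funext fun i => ?_)
        fin_cases i
        · exact (mul_eq_zero.1 h6).resolve_left hr2
        · exact (mul_eq_zero.1 h7).resolve_left hr2
      · have : 0 < exF T * (T (Sum.inr 1) * v 0 - T (Sum.inr 0) * v 1) ^ 2 / exRho T ^ 3 := by
          positivity
        positivity

lemma pd_inl_metric_exF (i j k : Fin 2) (hT : T ∈ slit exU) :
    pd (Sum.inl k) (metric exF i j) T = (if 0 = k then 1 else 0) *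
      ((if 0 = i then 1 else 0) * exGrad j T + exGrad i T * (if 0 = j then 1 else 0)
        + T (Sum.inr 0) * exHess j i T) := by
  rw [pd_congr_on _ (isOpen_slit isOpen_exU) hT fun w hw => metric_exF i j hw,
    (((hasPD_inl_exGrad i k hT).mul (hasPD_inl_exGrad j k hT)).add
      ((hasPD_inl_exF k hT).mul (hasPD_inl_exHess j i k hT))).2]
  ring

/-- The one-form t^1 dt^1 is closed, so the geodesics are straight lines and the spray is the
multiple (s^k ∂F/∂t^k)/F of s. The formula is checked after lowering the index, using Euler's
relations for the gradient and Hessian of F. -/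
lemma spray_exF (i : Fin 2) (hT : T ∈ slit exU) :
    spray exF i T = T (Sum.inr 0) ^ 2 * T (Sum.inr i) / exF T := by
  refine congrFun (eq_of_lower_eq isOpen_exU isFinslerOn_exF (x := fun i => spray exF i T)
    (y := fun i => T (Sum.inr 0) ^ 2 * T (Sum.inr i) / exF T) hT fun l => ?_) i
  have hF := exF_pos hT
  have hr := exRho_pos hT
  have hsq := exRho_sq T
  have hH : ∀ l, exHess 0 l T * T (Sum.inr 0) + exHess 1 l T * T (Sum.inr 1) = 0 := by
    intro l
    simp only [exHess, hsq]
    fin_cases l <;> simp <;> ring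
  have hG : exGrad 0 T * T (Sum.inr 0) + exGrad 1 T * T (Sum.inr 1) = exF T := by
    simp only [exGrad, exF]
    simp
    field_simp
    linear_combination -hsq
  have hsymm : ∀ i j, exHess i j T = exHess j i T := by
    intro i j
    simp only [exHess, eq_comm (a := i)]
    ring
  rw [lower_spray isOpen_exU isFinslerOn_exF l hT]
  simp only [Fin.sum_univ_two, christoffelLow, pd_inl_metric_exF _ _ _ hT, metric_exF _ _ hT]
  have hR : (exGrad l T * exGrad 0 T + exF T * exHess 0 l T)
        * (T (Sum.inr 0) ^ 2 * T (Sum.inr 0) / exF T)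
      + (exGrad l T * exGrad 1 T + exF T * exHess 1 l T)
        * (T (Sum.inr 0) ^ 2 * T (Sum.inr 1) / exF T) = T (Sum.inr 0) ^ 2 * exGrad l T := by
    have : (exGrad l T * exGrad 0 T + exF T * exHess 0 l T)
        * (T (Sum.inr 0) ^ 2 * T (Sum.inr 0) / exF T)
      + (exGrad l T * exGrad 1 T + exF T * exHess 1 l T)
        * (T (Sum.inr 0) ^ 2 * T (Sum.inr 1) / exF T)
      = T (Sum.inr 0) ^ 2 / exF T * (exGrad l T *
          (exGrad 0 T * T (Sum.inr 0) + exGrad 1 T * T (Sum.inr 1))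
        + exF T * (exHess 0 l T * T (Sum.inr 0) + exHess 1 l T * T (Sum.inr 1))) := by ring
    rw [this, hH, hG]
    field_simp
    ring
  rw [hR]
  have h0 := hH 0
  have h1 := hH 1
  rw [hsymm 0 1] at h1
  fin_cases l
  · simp [hsymm 0 1]
    linear_combination (T (Sum.inr 0) / 2) * (T (Sum.inr 0) * h0 - T (Sum.inr 1) * h1)
  · simp [hsymm 0 1]
    linear_combination T (Sum.inr 0) ^ 2 * h1

/-- The nonlinear Cartan connection of `exF`. -/
def exN (i k : Fin 2) (T : TIdx 2 → ℝ) : ℝ :=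
  ((2 * T (Sum.inr 0) * (if 0 = k then 1 else 0) * T (Sum.inr i)
      + T (Sum.inr 0) ^ 2 * (if i = k then 1 else 0)) * exF T
    - T (Sum.inr 0) ^ 2 * T (Sum.inr i) * exGrad k T) / (2 * exF T ^ 2)

lemma cartanN_exF (i k : Fin 2) (hT : T ∈ slit exU) : cartanN exF i k T = exN i k T := by
  have hF := exF_pos hT
  have h := pd_inr_spray isOpen_exU isFinslerOn_exF i k hT
  rw [pd_congr_on _ (isOpen_slit isOpen_exU) hT fun w hw => spray_exF i hw,
    ((((HasPD.coord _ (Sum.inr 0) T).pow 2).mul (HasPD.coord _ (Sum.inr i) T)).div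
      (hasPD_inr_exF k hT) hF.ne').2] at h
  have h2 : cartanN exF i k T = (2 * cartanN exF i k T) / 2 := by ring
  rw [h2, ← h, exN]
  simp only [Sum.inr.injEq]
  push_cast
  field_simp

/-- The Berwald coefficients of `exF`. -/
def exB (i j k : Fin 2) (T : TIdx 2 → ℝ) : ℝ :=
  ((((2 * (if 0 = k then 1 else 0)) * (if 0 = j then 1 else 0) * T (Sum.inr i)
        + (2 * T (Sum.inr 0) * (if 0 = j then 1 else 0)) * (if i = k then 1 else 0)
        + 2 * T (Sum.inr 0) * (if 0 = k then 1 else 0) * (if i = j then 1 else 0)) * exF T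
      + (2 * T (Sum.inr 0) * (if 0 = j then 1 else 0) * T (Sum.inr i)
        + T (Sum.inr 0) ^ 2 * (if i = j then 1 else 0)) * exGrad k T
      - ((2 * T (Sum.inr 0) * (if 0 = k then 1 else 0) * T (Sum.inr i)
          + T (Sum.inr 0) ^ 2 * (if i = k then 1 else 0)) * exGrad j T
        + T (Sum.inr 0) ^ 2 * T (Sum.inr i) * exHess j k T)) * exF T
    - ((2 * T (Sum.inr 0) * (if 0 = j then 1 else 0) * T (Sum.inr i)
        + T (Sum.inr 0) ^ 2 * (if i = j then 1 else 0)) * exF T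
      - T (Sum.inr 0) ^ 2 * T (Sum.inr i) * exGrad j T) * (2 * exGrad k T)) / (2 * exF T ^ 3)

lemma berwald_exF (i j k : Fin 2) (hT : T ∈ slit exU) : berwald exF i j k T = exB i j k T := by
  have hF := exF_pos hT
  rw [← pd_inr_cartanN isOpen_exU isFinslerOn_exF i j k hT,
    pd_congr_on _ (isOpen_slit isOpen_exU) hT fun w hw => cartanN_exF i j hw]
  have c0 := HasPD.coord (Sum.inr k) (Sum.inr 0) T
  have ci := HasPD.coord (Sum.inr k) (Sum.inr i) T
  have cF := hasPD_inr_exF k hT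
  have h := ((((((((HasPD.const _ (2 : ℝ) T).mul c0).mul
    (HasPD.const _ (if (0 : Fin 2) = j then (1 : ℝ) else 0) T)).mul ci).add
    ((c0.pow 2).mul (HasPD.const _ (if i = j then (1 : ℝ) else 0) T))).mul cF).sub
    (((c0.pow 2).mul ci).mul (hasPD_inr_exGrad j k hT))).div
    ((HasPD.const _ (2 : ℝ) T).mul (cF.pow 2)) (by positivity)).2
  refine h.trans ?_
  simp only [exB, Sum.inr.injEq]
  push_cast
  field_simp
  ring

/-- The point with `t = (t, t')` and `s = (r, 0)`. -/
def exPt (t t' r : ℝ) : TIdx 2 → ℝ := Sum.elim ![t, t'] ![r, 0]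

lemma exPt_mem {t t' r : ℝ} (ht : |t| < 1) (hr : 0 < r) : exPt t t' r ∈ slit exU := by
  refine ⟨by simpa [exPt, exU] using ht, fun h => ?_⟩
  have := congrFun h 0
  simp [exPt] at this
  exact hr.ne' this

section Values

variable {t t' r : ℝ} (ht : |t| < 1) (hr : 0 < r)
include ht hr

lemma exRho_exPt : exRho (exPt t t' r) = r := by
  simp [exRho, exPt, Real.sqrt_sq hr.le]

lemma exF_exPt : exF (exPt t t' r) = r * (1 + t) := by
  rw [exF, exRho_exPt ht hr]; simp [exPt]; ring

lemma exGrad_exPt (i : Fin 2) : exGrad i (exPt t t' r) = ![1 + t, 0] i := by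
  rw [exGrad, exRho_exPt ht hr]
  fin_cases i <;> simp [exPt, hr.ne']

lemma exHess_exPt (i j : Fin 2) : exHess i j (exPt t t' r) = ![![0, 0], ![0, 1 / r]] i j := by
  rw [exHess, exRho_exPt ht hr]
  fin_cases i <;> fin_cases j <;> simp [exPt] <;> field_simp <;> simp

lemma cartanN_exPt (i k : Fin 2) :
    cartanN exF i k (exPt t t' r) = ![![r / (1 + t), 0], ![0, r / (2 * (1 + t))]] i k := by
  have hw : 0 < 1 + t := by linarith [(abs_lt.1 ht).1]
  rw [cartanN_exF i k (exPt_mem ht hr), exN, exF_exPt ht hr, exGrad_exPt ht hr]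
  fin_cases i <;> fin_cases k <;> simp [exPt] <;> field_simp <;> ring

/-- On the ray s = (r, 0) the values depend on t^1 alone; derivatives in t^1, t^2 and s^1 at the
base point can be read off from this table. -/
lemma berwald_exPt (i j k : Fin 2) :
    berwald exF i j k (exPt t t' r) = ![![![1 / (1 + t), 0], ![0, -1 / (2 * (1 + t) ^ 2)]],
      ![![0, 1 / (2 * (1 + t))], ![1 / (2 * (1 + t)), 0]]] i j k := by
  have hw : 0 < 1 + t := by linarith [(abs_lt.1 ht).1]
  rw [berwald_exF i j k (exPt_mem ht hr), exB, exF_exPt ht hr, exGrad_exPt ht hr,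
    exGrad_exPt ht hr, exHess_exPt ht hr]
  fin_cases i <;> fin_cases j <;> fin_cases k <;> simp [exPt] <;> field_simp <;> ring

end Values

lemma update_exPt (t t' r x : ℝ) :
    Function.update (exPt t t' r) (Sum.inl 0) x = exPt x t' r ∧
    Function.update (exPt t t' r) (Sum.inl 1) x = exPt t x r ∧
    Function.update (exPt t t' r) (Sum.inr 0) x = exPt t t' x := by
  refine ⟨?_, ?_, ?_⟩ <;> funext A <;> rcases A with α | a <;>
    first | (fin_cases α <;> simp [exPt, Function.update]) | (fin_cases a <;> simp [exPt, Function.update])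

end Example

/-! ### Nonvanishing of the fifteen families -/

section ExampleTorsion

lemma exPt_base_mem : exPt 0 0 1 ∈ slit exU := exPt_mem (by simp) one_pos

lemma differentiableAt_berwald_exF (i j k : Fin 2) :
    DifferentiableAt ℝ (berwald exF i j k) (exPt 0 0 1) :=
  contDiffOn_differentiableAt (isOpen_slit isOpen_exU)
    (contDiffOn_berwald isOpen_exU isFinslerOn_exF i j k) exPt_base_mem

lemma differentiableAt_cartanN_exF (i j : Fin 2) :
    DifferentiableAt ℝ (cartanN exF i j) (exPt 0 0 1) :=
  contDiffOn_differentiableAt (isOpen_slit isOpen_exU)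
    (contDiffOn_cartanN isOpen_exU isFinslerOn_exF i j) exPt_base_mem

lemma eventually_abs_lt_one (t' r : ℝ) : ∀ᶠ x in 𝓝 (exPt 0 t' r (Sum.inl 0)), |x| < 1 := by
  have : exPt 0 t' r (Sum.inl 0) = 0 := by simp [exPt]
  rw [this]
  exact (isOpen_lt continuous_abs continuous_const).mem_nhds (by simp)

lemma hasDerivAt_inv_two_mul (u : TIdx 2 → ℝ) (hu : u (Sum.inl 0) = 0) :
    HasDerivAt (fun x : ℝ => 1 / (2 * (1 + x))) (-1 / 2) (u (Sum.inl 0)) := by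
  rw [hu]
  have h : HasDerivAt (fun x : ℝ => 2 * (1 + x)) 2 0 := by
    simpa using ((hasDerivAt_id (0 : ℝ)).const_add 1).const_mul 2
  have h2 := (hasDerivAt_const (0 : ℝ) (1 : ℝ)).fun_div h (by norm_num)
  exact h2.congr_deriv (by norm_num)

lemma pd_inl_zero_berwald_exF : pd (Sum.inl 0) (berwald exF 1 0 1) (exPt 0 0 1) = -1 / 2 := by
  refine pd_eq_of_line (differentiableAt_berwald_exF _ _ _) (φ := fun x => 1 / (2 * (1 + x))) ?_
    (hasDerivAt_inv_two_mul _ rfl)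
  filter_upwards [eventually_abs_lt_one 0 1] with x hx
  rw [(update_exPt 0 0 1 x).1, berwald_exPt hx one_pos]
  simp

lemma pd_inl_zero_cartanN_exF : pd (Sum.inl 0) (cartanN exF 1 1) (exPt 0 0 1) = -1 / 2 := by
  refine pd_eq_of_line (differentiableAt_cartanN_exF _ _) (φ := fun x => 1 / (2 * (1 + x))) ?_
    (hasDerivAt_inv_two_mul _ rfl)
  filter_upwards [eventually_abs_lt_one 0 1] with x hx
  rw [(update_exPt 0 0 1 x).1, cartanN_exPt hx one_pos]
  simp

lemma pd_inl_one_berwald_exF (i j k : Fin 2) :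
    pd (Sum.inl 1) (berwald exF i j k) (exPt 0 0 1) = 0 := by
  refine pd_eq_of_line (differentiableAt_berwald_exF _ _ _)
    (φ := fun _ => berwald exF i j k (exPt 0 0 1)) (Eventually.of_forall fun x => ?_)
    (hasDerivAt_const _ _)
  rw [(update_exPt 0 0 1 x).2.1, berwald_exPt (by simp) one_pos, berwald_exPt (by simp) one_pos]

lemma pd_inl_one_cartanN_exF (i j : Fin 2) :
    pd (Sum.inl 1) (cartanN exF i j) (exPt 0 0 1) = 0 := by
  refine pd_eq_of_line (differentiableAt_cartanN_exF _ _)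
    (φ := fun _ => cartanN exF i j (exPt 0 0 1)) (Eventually.of_forall fun x => ?_)
    (hasDerivAt_const _ _)
  rw [(update_exPt 0 0 1 x).2.1, cartanN_exPt (by simp) one_pos, cartanN_exPt (by simp) one_pos]

/-- At s = (1, 0) this derivative is radial, and B is constant along the ray. -/
lemma berwaldP_exF_zero (i j k : Fin 2) : berwaldP exF i j k 0 (exPt 0 0 1) = 0 := by
  refine pd_eq_of_line (differentiableAt_berwald_exF _ _ _)
    (φ := fun _ => berwald exF i j k (exPt 0 0 1)) ?_ (hasDerivAt_const _ _)
  have : ∀ᶠ x in 𝓝 (exPt 0 0 1 (Sum.inr 0)), 0 < x := by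
    have : exPt 0 0 1 (Sum.inr 0) = 1 := by simp [exPt]
    rw [this]
    exact lt_mem_nhds one_pos
  filter_upwards [this] with x hx
  rw [(update_exPt 0 0 1 x).2.2, berwald_exPt (by simp) hx, berwald_exPt (by simp) one_pos]

/-- This derivative leaves the ray s = (r, 0), so the general formula for B is needed rather than
the table. -/
lemma berwaldP_exF_one : berwaldP exF 1 1 1 1 (exPt 0 0 1) = -3 / 2 := by
  have hT := exPt_base_mem
  have hF : exF (exPt 0 0 1) ≠ 0 := (exF_pos hT).ne'
  have h1 : ∀ w ∈ slit exU, berwald exF 1 1 1 w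
      = (-(w (Sum.inr 0) ^ 2 * w (Sum.inr 1) * exHess 1 1 w) * exF w
        - (w (Sum.inr 0) ^ 2 * exF w - w (Sum.inr 0) ^ 2 * w (Sum.inr 1) * exGrad 1 w)
          * (2 * exGrad 1 w)) / (2 * exF w ^ 3) := by
    intro w hw
    rw [berwald_exF 1 1 1 hw, exB]
    simp
  -- The value of this third derivative is irrelevant: it enters multiplied by s^2, which vanishes
  -- at the base point.
  have hH : HasPD (Sum.inr 1) (exHess 1 1) (pd (Sum.inr 1) (exHess 1 1) (exPt 0 0 1)) (exPt 0 0 1) :=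
    ⟨differentiableAt_exHess 1 1 hT, rfl⟩
  have c0 := HasPD.coord (Sum.inr 1) (Sum.inr 0) (exPt 0 0 1)
  have c1 := HasPD.coord (Sum.inr 1) (Sum.inr 1) (exPt 0 0 1)
  have cF := hasPD_inr_exF 1 hT
  have cG := hasPD_inr_exGrad 1 1 hT
  have h2 : HasPD (Sum.inr 1) (fun w : TIdx 2 → ℝ =>
      (-1 * (w (Sum.inr 0) ^ 2 * w (Sum.inr 1) * exHess 1 1 w) * exF w
        - (w (Sum.inr 0) ^ 2 * exF w - w (Sum.inr 0) ^ 2 * w (Sum.inr 1) * exGrad 1 w)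
          * (2 * exGrad 1 w)) / (2 * exF w ^ 3)) _ _ :=
    ((((HasPD.const _ (-1 : ℝ) _).mul (((c0.pow 2).mul c1).mul hH)).mul cF).sub
      ((((c0.pow 2).mul cF).sub (((c0.pow 2).mul c1).mul cG)).mul
        ((HasPD.const _ (2 : ℝ) _).mul cG))).div
      ((HasPD.const _ (2 : ℝ) _).mul (cF.pow 3)) (by positivity)
  have h3 := h2.2
  simp only [neg_one_mul] at h3
  rw [berwaldP, pd_congr_on _ (isOpen_slit isOpen_exU) hT h1, h3,
    exF_exPt (by simp) one_pos, exGrad_exPt (by simp) one_pos, exHess_exPt (by simp) one_pos]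
  simp [exPt]
  norm_num

/-- The horizontal Berwald curvature component of `exF` that enters the torsion. -/
lemma curvature_exF :
    berwaldR exF 1 0 0 1 (exPt 0 0 1)
        + ∑ c, berwaldP exF 1 0 0 c (exPt 0 0 1) * cartanN exF c 1 (exPt 0 0 1)
        - ∑ c, berwaldP exF 1 0 1 c (exPt 0 0 1) * cartanN exF c 0 (exPt 0 0 1) = 3 / 4 := by
  rw [berwaldR_add_berwaldP isOpen_exU isFinslerOn_exF exPt_base_mem, pd_inl_one_berwald_exF,
    pd_inl_zero_berwald_exF]
  simp only [Fin.sum_univ_two, berwald_exPt (show |(0 : ℝ)| < 1 by simp) one_pos]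
  simp
  norm_num

/-- The jet over `t = 0`, `s = (1, 0)`, `x = 0` with `x^i_α` the identity and
`y^i_a` the diagonal matrix with entries `1, v`. -/
def exJet (v : ℝ) : JIdx 2 2 → ℝ
  | Sum.inl (Sum.inl _) => 0
  | Sum.inl (Sum.inr a) => ![1, 0] a
  | Sum.inr (Sum.inl _) => 0
  | Sum.inr (Sum.inr (i, Sum.inl μ)) => if i = μ then 1 else 0
  | Sum.inr (Sum.inr (i, Sum.inr a)) => ![![1, 0], ![0, v]] i a

lemma source_exJet (v : ℝ) : source (exJet v) = exPt 0 0 1 := by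
  funext A
  rcases A with α | a
  · fin_cases α <;> rfl
  · fin_cases a <;> rfl

lemma target_exJet (v : ℝ) : target (exJet v) = exPt 0 0 1 := by
  funext A
  rcases A with α | a
  · fin_cases α <;> rfl
  · fin_cases a <;> simp [target, exJet, exPt]

lemma exJet_mem (v : ℝ) : exJet v ∈ jetDomain exU exU := by
  refine ⟨?_, ?_⟩
  · rw [source_exJet]; exact exPt_base_mem
  · rw [target_exJet]; exact exPt_base_mem

lemma berwald_exF_base (i j k : Fin 2) :
    berwald exF i j k (exPt 0 0 1) = ![![![1, 0], ![0, -1 / 2]], ![![0, 1 / 2], ![1 / 2, 0]]] i j k := by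
  rw [berwald_exPt (by simp) one_pos]
  simp

lemma cartanN_exF_base (i k : Fin 2) :
    cartanN exF i k (exPt 0 0 1) = ![![1, 0], ![0, 1 / 2]] i k := by
  rw [cartanN_exPt (by simp) one_pos]
  simp

lemma berwaldP_exF_one_zero_zero_one : berwaldP exF 1 0 0 1 (exPt 0 0 1) = 0 := by
  rw [berwaldP_swap_right isOpen_exU isFinslerOn_exF _ _ _ _ exPt_base_mem, berwaldP_exF_zero]

/-- The conditions on X_B select the curvature component 3/4; the P̃ B̃ terms vanish because their
P̃ factors with two lower indices 0 are zero and the other products meet B^1_{00} = 0. -/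
lemma dTorsion_exF_x_x (B : TIdx 2) (v : ℝ) (h0 : exJet v (jX 0 B) = 1)
    (h1 : exJet v (jX 1 B) = 0) :
    dTorsion exF exF (jX 1 B) (jx 0) (jx 1) (exJet v) = 3 / 4 := by
  rw [dTorsion_jX_x_x isOpen_exU isOpen_exU isFinslerOn_exF isFinslerOn_exF (exJet_mem v),
    target_exJet]
  simp only [Fin.sum_univ_two (f := fun k => _ * exJet v (jX k B)), curvature_exF, h0, h1]
  simp only [Fin.sum_univ_two, h0, h1, berwald_exF_base, berwaldP_exF_zero,
    berwaldP_exF_one_zero_zero_one]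
  simp [exJet]

/-- For the Randers metric `exF` on both sides none of the fifteen families vanishes. -/
lemma exists_dTorsion_ne_zero (f : Block × Block × Block) (hf : f ∈ torsionFamilies) :
    ∃ z ∈ jetDomain exU exU, ∃ c a b : JIdx 2 2,
      (block c, block a, block b) = f ∧ dTorsion exF exF c a b z ≠ 0 := by
  have hU := isOpen_exU
  have hF := isFinslerOn_exF
  have hz := exJet_mem
  have hs := source_exJet
  have ht := target_exJet
  simp only [torsionFamilies, List.mem_cons, List.not_mem_nil, or_false] at hf
  -- Since s = (1, 0), the entry v of y does not affect the base point. With v = 0 all y^1_c vanish,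
  -- which isolates the x_ε terms of (T4)–(T6); v = 1 is taken where y^1_1 must be nonzero.
  rcases hf with rfl | rfl | rfl | rfl | rfl | rfl | rfl | rfl | rfl | rfl | rfl | rfl | rfl | rfl |
    rfl
  · refine ⟨exJet 0, hz 0, js 1, jt 0, jt 1, rfl, ?_⟩
    rw [dTorsion_s_t_t hU hU hF hF (hz 0), hs]
    simp only [cartanNcov, pd_inl_one_cartanN_exF, pd_inl_zero_cartanN_exF, Fin.sum_univ_two,
      berwald_exF_base, cartanN_exF_base]
    simp
    norm_num
  · refine ⟨exJet 0, hz 0, jxt 1 1, jx 1, jy 1 0, rfl, ?_⟩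
    rw [dTorsion_jX_x_y hU hU hF hF (hz 0), ht]
    simp [exJet, berwaldP_exF_one]
  · refine ⟨exJet 1, hz 1, jy 1 1, jx 1, jy 1 0, rfl, ?_⟩
    rw [dTorsion_jX_x_y hU hU hF hF (hz 1), ht]
    simp [Fin.sum_univ_two, exJet, berwaldP_exF_one]
  · refine ⟨exJet 0, hz 0, jxt 1 0, jt 0, jt 1, rfl, ?_⟩
    rw [dTorsion_xt_t_t hU hU hF hF (hz 0), hs]
    have hy : ∀ c, exJet 0 (jy 1 c) = 0 := by intro c; fin_cases c <;> simp [exJet]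
    have hx : ∀ c, exJet 0 (jxt 1 c) = if 1 = c then 1 else 0 := fun c => rfl
    simp only [hy, hx, mul_zero, Finset.sum_const_zero, mul_ite, mul_one, Finset.sum_ite_eq,
      Finset.mem_univ, if_true, curvature_exF]
    norm_num
  · refine ⟨exJet 0, hz 0, jxt 1 1, jt 1, js 1, rfl, ?_⟩
    rw [dTorsion_xt_t_s hU hU hF hF (hz 0), hs]
    have hy : ∀ c, exJet 0 (jy 1 c) = 0 := by intro c; fin_cases c <;> simp [exJet]
    simp only [hy, mul_zero, Finset.sum_const_zero]
    simp [exJet, berwaldP_exF_one]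
  · refine ⟨exJet 0, hz 0, jxt 1 1, js 1, jt 1, rfl, ?_⟩
    rw [dTorsion_xt_s_t hU hU hF hF (hz 0), hs]
    have hy : ∀ c, exJet 0 (jy 1 c) = 0 := by intro c; fin_cases c <;> simp [exJet]
    simp only [hy, mul_zero, Finset.sum_const_zero]
    simp [exJet, berwaldP_exF_one]
  · refine ⟨exJet 1, hz 1, jy 1 0, jt 0, jt 1, rfl, ?_⟩
    rw [dTorsion_y_t_t hU hU hF hF (hz 1), hs]
    have hy : ∀ c, exJet 1 (jy 1 c) = if 1 = c then 1 else 0 := by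
      intro c; fin_cases c <;> simp [exJet]
    simp only [hy, mul_ite, mul_zero, mul_one, Finset.sum_ite_eq, Finset.mem_univ, if_true,
      curvature_exF]
    norm_num
  · refine ⟨exJet 1, hz 1, jy 1 1, jt 1, js 1, rfl, ?_⟩
    rw [dTorsion_y_t_s hU hU hF hF (hz 1), hs]
    simp [Fin.sum_univ_two, exJet, berwaldP_exF_one]
  · refine ⟨exJet 1, hz 1, jy 1 1, js 1, jt 1, rfl, ?_⟩
    rw [dTorsion_y_s_t hU hU hF hF (hz 1), hs]
    simp [Fin.sum_univ_two, exJet, berwaldP_exF_one]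
  · refine ⟨exJet 1, hz 1, jxt 1 1, jt 1, jx 1, rfl, ?_⟩
    rw [dTorsion_jX_t_x hU hU hF hF (hz 1), hs, ht]
    simp [Fin.sum_univ_two, exJet, berwaldP_exF_one, berwald_exF_base]
  · refine ⟨exJet 1, hz 1, jxt 1 1, js 1, jx 1, rfl, ?_⟩
    rw [dTorsion_jX_s_x hU hU hF hF (hz 1), ht]
    simp [Fin.sum_univ_two, exJet, berwaldP_exF_one]
  · refine ⟨exJet 1, hz 1, jy 1 1, jt 1, jx 1, rfl, ?_⟩
    rw [dTorsion_jX_t_x hU hU hF hF (hz 1), hs, ht]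
    simp [Fin.sum_univ_two, exJet, berwaldP_exF_one, berwald_exF_base]
  · refine ⟨exJet 1, hz 1, jy 1 1, js 1, jx 1, rfl, ?_⟩
    rw [dTorsion_jX_s_x hU hU hF hF (hz 1), ht]
    simp [Fin.sum_univ_two, exJet, berwaldP_exF_one]
  · refine ⟨exJet 0, hz 0, jxt 1 0, jx 0, jx 1, rfl, ?_⟩
    rw [dTorsion_exF_x_x _ _ rfl (by simp [exJet])]
    norm_num
  · refine ⟨exJet 0, hz 0, jy 1 0, jx 0, jx 1, rfl, ?_⟩
    rw [dTorsion_exF_x_x _ _ rfl rfl]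
    norm_num

end ExampleTorsion

end JetBerwald

end

theorem mainTheorem7 :
    (∀ (p n : ℕ)
      (M : Type u) [TopologicalSpace M] [ChartedSpace (Fin p → ℝ) M]
      [IsManifold 𝓘(ℝ, Fin p → ℝ) ∞ M]
      (N : Type v) [TopologicalSpace N] [ChartedSpace (Fin n → ℝ) N]
      [IsManifold 𝓘(ℝ, Fin n → ℝ) ∞ N]
      (FM : TangentBundle 𝓘(ℝ, Fin p → ℝ) M → ℝ) (_ : IsFinslerStructure FM)
      (FN : TangentBundle 𝓘(ℝ, Fin n → ℝ) N → ℝ) (_ : IsFinslerStructure FN)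
      (e : OpenPartialHomeomorph M (Fin p → ℝ))
      (_ : e ∈ IsManifold.maximalAtlas 𝓘(ℝ, Fin p → ℝ) ∞ M)
      (e' : OpenPartialHomeomorph N (Fin n → ℝ))
      (_ : e' ∈ IsManifold.maximalAtlas 𝓘(ℝ, Fin n → ℝ) ∞ N)
      (F : (TIdx p → ℝ) → ℝ) (_ : F = localExpr FM e)
      (F' : (TIdx n → ℝ) → ℝ) (_ : F' = localExpr FN e')
      (z : JIdx p n → ℝ) (_ : z ∈ jetDomain e.target e'.target)
      (T : TIdx p → ℝ) (_ : T = source z) (Y : TIdx n → ℝ) (_ : Y = target z),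
      -- (T1)
      (∀ a β γ : Fin p,
        dTorsion F F' (js a) (jt β) (jt γ) z = cartanNcov F a β γ T - cartanNcov F a γ β T ∧
        dTorsion F F' (js a) (jt β) (jt γ) z = berwaldTorsion F a β γ T) ∧
      -- (T2)
      (∀ (m i j : Fin n) (μ b : Fin p),
        dTorsion F F' (jxt m μ) (jx i) (jy j b) z =
          ∑ k, berwaldP F' m i k j Y * z (jxt k μ) * z (js b)) ∧
      -- (T3)
      (∀ (m i j : Fin n) (c b : Fin p),
        dTorsion F F' (jy m c) (jx i) (jy j b) z =
          ∑ k, berwaldP F' m i k j Y * z (jy k c) * z (js b)) ∧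
      -- (T4)
      (∀ (m : Fin n) (μ α β : Fin p),
        dTorsion F F' (jxt m μ) (jt α) (jt β) z =
          -∑ ε, (berwaldR F ε μ α β T
              + ∑ c, berwaldP F ε μ α c T * cartanN F c β T
              - ∑ c, berwaldP F ε μ β c T * cartanN F c α T) * z (jxt m ε)
          + ∑ c, ((pd (Sum.inl α) (cartanNcov F c β μ) T
                + ∑ d, cartanNcov F d β μ T * berwald F c d α T
                - ∑ γ, cartanNcov F c β γ T * berwald F γ α μ T)
              - (pd (Sum.inl β) (cartanNcov F c α μ) T
                + ∑ d, cartanNcov F d α μ T * berwald F c d β T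
                - ∑ γ, cartanNcov F c α γ T * berwald F γ β μ T)) * z (jy m c)) ∧
      -- (T5)
      (∀ (m : Fin n) (μ α b : Fin p),
        dTorsion F F' (jxt m μ) (jt α) (js b) z =
          -∑ ε, berwaldP F ε μ α b T * z (jxt m ε)
          + ∑ c, (pd (Sum.inl α) (berwald F c b μ) T - pd (Sum.inr b) (cartanNcov F c α μ) T
              + ∑ d, berwald F d b μ T * berwald F c d α T
              - ∑ γ, berwald F γ α μ T * berwald F c γ b T) * z (jy m c)) ∧
      -- (T6)
      (∀ (m : Fin n) (μ a β : Fin p),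
        dTorsion F F' (jxt m μ) (js a) (jt β) z =
          ∑ ε, berwaldP F ε μ a β T * z (jxt m ε)
          - ∑ c, (pd (Sum.inl β) (berwald F c a μ) T - pd (Sum.inr a) (cartanNcov F c β μ) T
              + ∑ d, berwald F d a μ T * berwald F c d β T
              - ∑ γ, berwald F γ β μ T * berwald F c γ a T) * z (jy m c)) ∧
      -- (T7)
      (∀ (m : Fin n) (c α β : Fin p),
        dTorsion F F' (jy m c) (jt α) (jt β) z =
          -∑ d, (berwaldR F d c α β T
              + ∑ f, berwaldP F d c α f T * cartanN F f β T
              - ∑ f, berwaldP F d c β f T * cartanN F f α T) * z (jy m d)) ∧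
      -- (T8)
      (∀ (m : Fin n) (c α b : Fin p),
        dTorsion F F' (jy m c) (jt α) (js b) z =
          -∑ d, berwaldP F d c α b T * z (jy m d)) ∧
      -- (T9)
      (∀ (m : Fin n) (c a β : Fin p),
        dTorsion F F' (jy m c) (js a) (jt β) z =
          ∑ d, berwaldP F d c a β T * z (jy m d)) ∧
      -- (T10)
      (∀ (m j : Fin n) (μ α : Fin p),
        dTorsion F F' (jxt m μ) (jt α) (jx j) z =
          -∑ k, ∑ l, ∑ b, ∑ c, berwaldP F' m j k l Y * berwald F c α b T * z (js b)
              * z (jxt k μ) * z (jy l c)) ∧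
      -- (T11)
      (∀ (m j : Fin n) (μ a : Fin p),
        dTorsion F F' (jxt m μ) (js a) (jx j) z =
          -∑ k, ∑ l, berwaldP F' m j k l Y * z (jxt k μ) * z (jy l a)) ∧
      -- (T12)
      (∀ (m j : Fin n) (c α : Fin p),
        dTorsion F F' (jy m c) (jt α) (jx j) z =
          -∑ k, ∑ l, ∑ b, ∑ d, berwaldP F' m j k l Y * berwald F d α b T * z (js b)
              * z (jy k c) * z (jy l d)) ∧
      -- (T13)
      (∀ (m j : Fin n) (c a : Fin p),
        dTorsion F F' (jy m c) (js a) (jx j) z =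
          -∑ k, ∑ l, berwaldP F' m j k l Y * z (jy k c) * z (jy l a)) ∧
      -- (T14)
      (∀ (m i j : Fin n) (μ : Fin p),
        dTorsion F F' (jxt m μ) (jx i) (jx j) z =
          ∑ k, (berwaldR F' m k i j Y
              + ∑ l, berwaldP F' m k i l Y * cartanN F' l j Y
              - ∑ l, berwaldP F' m k j l Y * cartanN F' l i Y) * z (jxt k μ)
          - ∑ k, ∑ q, ∑ a, (∑ l, berwaldP F' m k i l Y * berwald F' l j q Y
              - ∑ l, berwaldP F' m k j l Y * berwald F' l i q Y)
                * z (jxt k μ) * z (jy q a) * z (js a)) ∧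
      -- (T15)
      (∀ (m i j : Fin n) (c : Fin p),
        dTorsion F F' (jy m c) (jx i) (jx j) z =
          ∑ k, (berwaldR F' m k i j Y
              + ∑ l, berwaldP F' m k i l Y * cartanN F' l j Y
              - ∑ l, berwaldP F' m k j l Y * cartanN F' l i Y) * z (jy k c)
          - ∑ k, ∑ q, ∑ a, (∑ l, berwaldP F' m k i l Y * berwald F' l j q Y
              - ∑ l, berwaldP F' m k j l Y * berwald F' l i q Y)
                * z (jy k c) * z (jy q a) * z (js a)) ∧
      -- the torsion is skew-symmetric, and up to this symmetry all other components vanish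
      (∀ c a b : JIdx p n, dTorsion F F' c b a z = -dTorsion F F' c a b z) ∧
      (∀ c a b : JIdx p n, (block c, block a, block b) ∉ torsionFamilies →
        (block c, block b, block a) ∉ torsionFamilies → dTorsion F F' c a b z = 0)) ∧
    -- in general none of the fifteen families vanishes
    (∃ (p n : ℕ) (U : Set (Fin p → ℝ)) (V : Set (Fin n → ℝ))
      (F : (TIdx p → ℝ) → ℝ) (F' : (TIdx n → ℝ) → ℝ),
      IsOpen U ∧ IsOpen V ∧ IsFinslerOn F U ∧ IsFinslerOn F' V ∧
      ∀ f ∈ torsionFamilies, ∃ z ∈ jetDomain U V, ∃ c a b : JIdx p n,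
        (block c, block a, block b) = f ∧ dTorsion F F' c a b z ≠ 0) := by
  refine ⟨?_, 2, 2, exU, exU, exF, exF, isOpen_exU, isOpen_exU, isFinslerOn_exF, isFinslerOn_exF,
    exists_dTorsion_ne_zero⟩
  intro p n M _ _ _ N _ _ _ FM hFM FN hFN e he e' he' F hFe F' hFe' z hz T hT Y hY
  -- The formulas are local: all that is needed from the manifolds is that the chart expressions are
  -- Finsler structures over the open chart targets.
  have hF : IsFinslerOn F e.target := hFe ▸ hFM e he
  have hF' : IsFinslerOn F' e'.target := hFe' ▸ hFN e' he'
  have hU := e.open_target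
  have hV := e'.open_target
  subst hT hY
  refine ⟨fun a β γ => ?_, fun _ _ _ _ _ => dTorsion_jX_x_y hU hV hF hF' hz _ _ _ _ _,
    fun _ _ _ _ _ => dTorsion_jX_x_y hU hV hF hF' hz _ _ _ _ _,
    dTorsion_xt_t_t hU hV hF hF' hz, dTorsion_xt_t_s hU hV hF hF' hz,
    dTorsion_xt_s_t hU hV hF hF' hz, dTorsion_y_t_t hU hV hF hF' hz,
    dTorsion_y_t_s hU hV hF hF' hz, dTorsion_y_s_t hU hV hF hF' hz,
    fun _ _ _ _ => dTorsion_jX_t_x hU hV hF hF' hz _ _ _ _,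
    fun _ _ _ _ => dTorsion_jX_s_x hU hV hF hF' hz _ _ _ _,
    fun _ _ _ _ => dTorsion_jX_t_x hU hV hF hF' hz _ _ _ _,
    fun _ _ _ _ => dTorsion_jX_s_x hU hV hF hF' hz _ _ _ _,
    fun _ _ _ _ => dTorsion_jX_x_x hU hV hF hF' hz _ _ _ _,
    fun _ _ _ _ => dTorsion_jX_x_x hU hV hF hF' hz _ _ _ _,
    fun c a b => dTorsion_swap c a b z, dTorsion_eq_zero hU hV hF hF' hz⟩
  have h := dTorsion_s_t_t hU hV hF hF' hz a β γ
  exact ⟨h, h.trans (cartanNcov_sub_swap hU hF hz.1 a β γ)⟩
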